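/- Let $G=(V,E)$ be a finite simple graph, $F\subseteq E$, and let $k,L\ge 0$ be integers. A \emph{$k$-path $L$-coloring} of $(G,F)$ is a map $c:V\to\{1,\dots,L\}$ such that, for every color $a$, the subgraph of $G$ induced by $c^{-1}(a)$ is a disjoint union of paths, each with at most $k$ edges and with all edges in $F$. The \emph{$k$-path $L$-coloring problem} is to decide whether such a map exists. A tree decomposition of $G$ is a tree $T$ whose nodes $i$ carry bags $X_i\subseteq V$ such that the bags cover $V$, both ends of every edge of $G$ lie in a common bag, and, for each $v\in V$, the nodes whose bags contain $v$ induce a connected subtree of $T$. Its width is $\max_i|X_i|-1$, and $|T|$ is the number of nodes of $T$. A rooted tree decomposition is \emph{nice} if every node $i$ is of one of the following types: a leaf node ($i$ has no child and $|X_i|=1$); an introduce node ($i$ has exactly one child $j$, and $X_i=X_j\cup\{v\}$ for some vertex $v$ that lies in no bag of the subtree rooted at $j$); a forget node ($i$ has exactly one child $j$, and $X_i=X_j\setminus\{v\}$ for some $v\in X_j$); a join node ($i$ has exactly two children $j_1,j_2$, and $X_i=X_{j_1}=X_{j_2}$). \textbf{Theorem.} There exist an algorithm (a single program for a unit-cost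 random access machine with addition and truncated subtraction) and an absolute constant $C$ such that, given any graph $G=(V,E)$ (as a list of edges), any $F\subseteq E$, any integers $k,L\ge 0$ and any nice tree decomposition of $G$ with tree $T$ and width $w$, the algorithm correctly decides the $k$-path $L$-coloring problem for $(G,F)$ in at most $$C\cdot \max(L,1)^{w}\cdot \max(k,2)^{2(3w)^2}\cdot \max(3w,1)^2\cdot |T|$$ steps. In particular, when $L\ge 1$, $k\ge 2$ and $w\ge 1$, the running time is $O\big(L^w\cdot k^{2(3w)^2}\cdot(3w)^2\cdot|T|\big)$. -/

import Mathlib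

/-! ### Path colorings -/

/-- A disjoint union of paths, each with at most `k` edges: every connected component is
isomorphic to the path with `p` edges (and `p + 1` vertices) for some `p ≤ k`. -/
def IsDisjointUnionOfPaths {V : Type*} (H : SimpleGraph V) (k : ℕ) : Prop :=
  ∀ K : H.ConnectedComponent, ∃ p : ℕ, p ≤ k ∧
    Nonempty (K.toSimpleGraph ≃g SimpleGraph.pathGraph (p + 1))

/-- `c` is a `k`-path coloring of `(G, F)`: the subgraph of `G` induced by each color class is a
disjoint union of paths of length at most `k`, all of whose edges belong to `F`. -/
def IsPathColoring {V : Type*} (G : SimpleGraph V) (F : Set (Sym2 V)) (k : ℕ) {L : ℕ}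
    (c : V → Fin L) : Prop :=
  ∀ a : Fin L,
    IsDisjointUnionOfPaths (G.induce {v | c v = a}) k ∧
    ∀ u v : V, c u = a → c v = a → G.Adj u v → s(u, v) ∈ F

/-- The answer to the `k`-path `L`-coloring problem on `(G, F)` is yes. -/
def PathColorable {V : Type*} (G : SimpleGraph V) (F : Set (Sym2 V)) (k L : ℕ) : Prop :=
  ∃ c : V → Fin L, IsPathColoring G F k c

/-! ### Nice tree decompositions -/

/-- A rooted tree decomposition of `G`, with the nodes of the tree indexed by `ι`. -/
structure RootedTreeDecomposition {V : Type*} (G : SimpleGraph V) (ι : Type*) where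
  tree : SimpleGraph ι
  isTree : tree.IsTree
  root : ι
  bag : ι → Finset V
  exists_mem_bag : ∀ v : V, ∃ i, v ∈ bag i
  exists_edge_bag : ∀ u v : V, G.Adj u v → ∃ i, u ∈ bag i ∧ v ∈ bag i
  connected_bags : ∀ v : V, (tree.induce {i | v ∈ bag i}).Connected

namespace RootedTreeDecomposition

variable {V ι : Type*} {G : SimpleGraph V}

/-- The size of the largest bag minus one. -/
def width [Fintype ι] (D : RootedTreeDecomposition G ι) : ℕ :=
  (Finset.univ.sup fun i => (D.bag i).card) - 1

/-- The set of children of the node `i`: its neighbors in the tree that are farther from the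
root. -/
def children (D : RootedTreeDecomposition G ι) (i : ι) : Set ι :=
  {j | D.tree.Adj i j ∧ D.tree.dist D.root j = D.tree.dist D.root i + 1}

def IsLeafBag (D : RootedTreeDecomposition G ι) (i : ι) : Prop :=
  D.children i = ∅ ∧ (D.bag i).card = 1

/-- Since the bags containing `v` form a subtree, `v ∉ D.bag j` amounts here to `v` lying in no
bag of the subtree rooted at the child `j`. -/
def IsIntroduceBag [DecidableEq V] (D : RootedTreeDecomposition G ι) (i : ι) : Prop :=
  ∃ j, D.children i = {j} ∧ ∃ v, v ∉ D.bag j ∧ D.bag i = insert v (D.bag j)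

def IsForgetBag [DecidableEq V] (D : RootedTreeDecomposition G ι) (i : ι) : Prop :=
  ∃ j, D.children i = {j} ∧ ∃ v, v ∈ D.bag j ∧ D.bag i = (D.bag j).erase v

def IsJoinBag (D : RootedTreeDecomposition G ι) (i : ι) : Prop :=
  ∃ j₁ j₂, j₁ ≠ j₂ ∧ D.children i = {j₁, j₂} ∧ D.bag i = D.bag j₁ ∧ D.bag i = D.bag j₂

def IsNice [DecidableEq V] (D : RootedTreeDecomposition G ι) : Prop :=
  ∀ i, D.IsLeafBag i ∨ D.IsIntroduceBag i ∨ D.IsForgetBag i ∨ D.IsJoinBag i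

end RootedTreeDecomposition

/-! ### The machine model

A unit-cost random access machine over the natural numbers, programmed in a structured way. A
program is a fixed finite text, so it uses finitely many scalar variables and finitely many arrays
(array names are literals of the program, only positions inside an array are computed). The
arithmetic operations are addition and truncated subtraction; each operation, memory access,
test and control step costs one unit. -/

namespace RAM

/-- The memory: scalar variables `var x` and arrays `arr a`, all holding natural numbers. -/
structure Store where
  var : ℕ → ℕ
  arr : ℕ → ℕ → ℕ

inductive Expr where
  | const (c : ℕ)
  | var (x : ℕ)
  | add (e₁ e₂ : Expr)
  | sub (e₁ e₂ : Expr)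
  | read (a : ℕ) (e : Expr)

def Expr.eval (s : Store) : Expr → ℕ
  | .const c => c
  | .var x => s.var x
  | .add e₁ e₂ => e₁.eval s + e₂.eval s
  | .sub e₁ e₂ => e₁.eval s - e₂.eval s
  | .read a e => s.arr a (e.eval s)

/-- The cost of evaluating an expression: one unit per node. -/
def Expr.cost : Expr → ℕ
  | .const _ => 1
  | .var _ => 1
  | .add e₁ e₂ => e₁.cost + e₂.cost + 1
  | .sub e₁ e₂ => e₁.cost + e₂.cost + 1
  | .read _ e => e.cost + 1

inductive Program where
  | skip
  | assign (x : ℕ) (e : Expr)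
  | write (a : ℕ) (i e : Expr)
  | seq (p q : Program)
  | branch (e : Expr) (p q : Program)
  | loop (e : Expr) (p : Program)

def Store.setVar (s : Store) (x v : ℕ) : Store :=
  { s with var := Function.update s.var x v }

def Store.setArr (s : Store) (a i v : ℕ) : Store :=
  { s with arr := Function.update s.arr a (Function.update (s.arr a) i v) }

/-- `Exec p s s' t`: started in memory `s`, the program `p` halts in memory `s'` after exactly
`t` steps. A test `e` succeeds when the value of `e` is not zero. -/
inductive Exec : Program → Store → Store → ℕ → Prop
  | skip (s : Store) : Exec .skip s s 1
  | assign (s : Store) (x : ℕ) (e : Expr) :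
      Exec (.assign x e) s (s.setVar x (e.eval s)) (e.cost + 1)
  | write (s : Store) (a : ℕ) (i e : Expr) :
      Exec (.write a i e) s (s.setArr a (i.eval s) (e.eval s)) (i.cost + e.cost + 1)
  | seq {p q : Program} {s s' s'' : Store} {t t' : ℕ} :
      Exec p s s' t → Exec q s' s'' t' → Exec (.seq p q) s s'' (t + t')
  | branch_true {e : Expr} {p q : Program} {s s' : Store} {t : ℕ} :
      e.eval s ≠ 0 → Exec p s s' t → Exec (.branch e p q) s s' (e.cost + 1 + t)
  | branch_false {e : Expr} {p q : Program} {s s' : Store} {t : ℕ} :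
      e.eval s = 0 → Exec q s s' t → Exec (.branch e p q) s s' (e.cost + 1 + t)
  | loop_true {e : Expr} {p : Program} {s s' s'' : Store} {t t' : ℕ} :
      e.eval s ≠ 0 → Exec p s s' t → Exec (.loop e p) s' s'' t' →
        Exec (.loop e p) s s'' (e.cost + 1 + t + t')
  | loop_false {e : Expr} {p : Program} {s : Store} :
      e.eval s = 0 → Exec (.loop e p) s s (e.cost + 1)

end RAM

/-! ### Encoding of the input -/

/-- A listing of the graph and of the decomposition, in any order: the edges of `G` (each once, in
either orientation), the vertices of each bag, and the children of each node of the tree. -/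
structure Listing {n m : ℕ} (G : SimpleGraph (Fin n))
    (D : RootedTreeDecomposition G (Fin m)) where
  edges : List (Fin n × Fin n)
  edges_nodup : (edges.map fun e => s(e.1, e.2)).Nodup
  mem_edges : ∀ e : Sym2 (Fin n), e ∈ edges.map (fun e => s(e.1, e.2)) ↔ e ∈ G.edgeSet
  bag : Fin m → List (Fin n)
  bag_nodup : ∀ i, (bag i).Nodup
  mem_bag : ∀ i v, v ∈ bag i ↔ v ∈ D.bag i
  children : Fin m → List (Fin m)
  children_nodup : ∀ i, (children i).Nodup
  mem_children : ∀ i j, j ∈ children i ↔ j ∈ D.children i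

open Classical in
/-- The initial memory. The variables `0, …, 5` hold the number `n` of vertices, the number `m` of
nodes of the tree, `k`, `L`, the number of edges and the root. The arrays `0, 1, 2` hold the two
ends of each edge and whether it belongs to `F`; array `3` holds the sizes of the bags and array
`4` the contents of all bags, one bag after the other; arrays `5, 6, 7` hold the number of children
of each node, its first child and its second child. All the rest is zero. -/
noncomputable def Listing.initialStore {n m : ℕ} {G : SimpleGraph (Fin n)}
    {D : RootedTreeDecomposition G (Fin m)} (I : Listing G D) (F : Set (Sym2 (Fin n)))
    (k L : ℕ) : RAM.Store where
  var x := [n, m, k, L, I.edges.length, (D.root : ℕ)].getD x 0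
  arr a x :=
    List.getD
      (List.getD
        [I.edges.map fun e => (e.1 : ℕ),
          I.edges.map fun e => (e.2 : ℕ),
          I.edges.map fun e => if s(e.1, e.2) ∈ F then 1 else 0,
          (List.finRange m).map fun i => (I.bag i).length,
          (List.finRange m).flatMap fun i => (I.bag i).map fun v => (v : ℕ),
          (List.finRange m).map fun i => (I.children i).length,
          (List.finRange m).map fun i => ((I.children i).map fun j => (j : ℕ)).getD 0 0,
          (List.finRange m).map fun i => ((I.children i).map fun j => (j : ℕ)).getD 1 0]
        a [])
      x 0

/-- The program `P`, started on the given input, halts within `T` steps, with `1` in variable `0`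
if `(G, F)` has a `k`-path `L`-coloring and with `0` in variable `0` otherwise. -/
def SolvesPathColoring (P : RAM.Program) {n m : ℕ} (G : SimpleGraph (Fin n))
    (F : Set (Sym2 (Fin n))) (D : RootedTreeDecomposition G (Fin m)) (I : Listing G D)
    (k L T : ℕ) : Prop :=
  ∃ (s : RAM.Store) (t : ℕ), RAM.Exec P (I.initialStore F k L) s t ∧ t ≤ T ∧
    (PathColorable G F k L → s.var 0 = 1) ∧ (¬ PathColorable G F k L → s.var 0 = 0)

/-! The argument rests on a local certificate. A coloring is a path coloring exactly when the
vertices can carry positions in `0, …, k` such that any two adjacent vertices of the same color are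
joined by an edge of `F`, have positions differing by exactly one, and every vertex has at most one
neighbor of its color one step above and at most one one step below
(`pathColorable_iff_exists_pos`). Positions exclude monochromatic cycles and bound the length of the
paths. Since the conditions only concern edges and the neighbors of single vertices, a dynamic
program need not remember which path fragments are connected.

A state of a bag gives each of its vertices a color, a position and two flags; a flag reserves the
single place for a neighbor above or below, for use by vertices that are already eliminated. The
bags are put in an order with parents first, behind an extra empty bag. What the decomposition
contributes is the running intersection property: a vertex shared by a bag and some earlier bag lies
in the parent of that bag (`RootedTreeDecomposition.IsOrder.mem_bag_parent`). The last bag can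
therefore be merged into its parent. `BagSequence.Feasible` says that the remaining vertices can be
labeled in agreement with the tables of states of the remaining bags, and `Feasible.eliminate` and
`Feasible.of_eliminate` show that a merge preserves it. At the start every state is allowed and
feasibility means that a certificate exists; at the end only the empty bag is left, and feasibility
means that its table is nonempty.

Let `S = w + 1` be the size of the largest bag. If `L ≥ S`, a greedy proper coloring exists
(`BagSequence.certified_of_le`); if `L = 0 < S`, there is a vertex and no color. Otherwise `1 ≤ L ≤
w`, and there are `N = (4 L (k + 1)) ^ S` states per bag. A merge tries all triples of states, at a
cost of order `N ^ 3 * S ^ 2` per node. The excess over `L ^ w` is absorbed by the power of `max k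
2`, because `L ≤ w ≤ 2 ^ (w - 1)` (`stateCount_pow_le`).

The program is verified with a time-bounded weakest precondition `WP`. Its loop rules, together with
the syntactic frame condition `Exec.frame`, reduce each phase to an invariant. As the machine has no
multiplication, the multiples used as row offsets and the digits of the states are tabulated
beforehand. -/

namespace RAM

/-! ### Program logic: frames, weakest preconditions with time bounds, loop rules -/

@[simp] theorem Store.setVar_var (s : Store) (x v y : ℕ) :
    (s.setVar x v).var y = if y = x then v else s.var y := by
  simp [Store.setVar, Function.update_apply]

@[simp] theorem Store.setVar_arr (s : Store) (x v a i : ℕ) :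
    (s.setVar x v).arr a i = s.arr a i := rfl

@[simp] theorem Store.setArr_var (s : Store) (a i v y : ℕ) :
    (s.setArr a i v).var y = s.var y := rfl

@[simp] theorem Store.setArr_arr (s : Store) (a i v b j : ℕ) :
    (s.setArr a i v).arr b j = if b = a ∧ j = i then v else s.arr b j := by
  simp only [Store.setArr, Function.update_apply]
  by_cases hb : b = a
  · subst hb; by_cases hj : j = i <;> simp [hj]
  · simp [hb]

/-- The scalar variables which an expression reads. -/
def Expr.vars : Expr → List ℕ
  | .const _ => []
  | .var x => [x]
  | .add e₁ e₂ => e₁.vars ++ e₂.vars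
  | .sub e₁ e₂ => e₁.vars ++ e₂.vars
  | .read _ e => e.vars

/-- The arrays which an expression reads. -/
def Expr.arrs : Expr → List ℕ
  | .const _ => []
  | .var _ => []
  | .add e₁ e₂ => e₁.arrs ++ e₂.arrs
  | .sub e₁ e₂ => e₁.arrs ++ e₂.arrs
  | .read a e => a :: e.arrs

theorem Expr.eval_congr {s s' : Store} (e : Expr) (hv : ∀ x ∈ e.vars, s'.var x = s.var x)
    (ha : ∀ a ∈ e.arrs, s'.arr a = s.arr a) : e.eval s' = e.eval s := by
  induction e with
  | const c => rfl
  | var x => exact hv x (by simp [vars])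
  | add e₁ e₂ h₁ h₂ | sub e₁ e₂ h₁ h₂ =>
    simp only [vars, arrs, List.mem_append] at hv ha
    simp only [eval]
    rw [h₁ (fun x hx => hv x (.inl hx)) (fun x hx => ha x (.inl hx)),
      h₂ (fun x hx => hv x (.inr hx)) (fun x hx => ha x (.inr hx))]
  | read a e h =>
    simp only [vars, arrs, List.mem_cons] at hv ha
    simp only [eval]
    rw [h hv (fun x hx => ha x (.inr hx)), ha a (.inl rfl)]

/-- The scalar variables which a program may modify. -/
def Program.modV : Program → List ℕ
  | .skip => []
  | .assign x _ => [x]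
  | .write _ _ _ => []
  | .seq p q => p.modV ++ q.modV
  | .branch _ p q => p.modV ++ q.modV
  | .loop _ p => p.modV

/-- The arrays which a program may modify. -/
def Program.modA : Program → List ℕ
  | .skip => []
  | .assign _ _ => []
  | .write a _ _ => [a]
  | .seq p q => p.modA ++ q.modA
  | .branch _ p q => p.modA ++ q.modA
  | .loop _ p => p.modA

/-- Two stores agree on everything which the program `P` does not modify. -/
structure Frame (P : Program) (s s' : Store) : Prop where
  var : ∀ x, x ∉ P.modV → s'.var x = s.var x
  arr : ∀ a, a ∉ P.modA → s'.arr a = s.arr a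

theorem Frame.refl (P : Program) (s : Store) : Frame P s s := ⟨fun _ _ => rfl, fun _ _ => rfl⟩

theorem Frame.trans {P : Program} {s s' s'' : Store} (h : Frame P s s') (h' : Frame P s' s'') :
    Frame P s s'' :=
  ⟨fun x hx => (h'.var x hx).trans (h.var x hx), fun x hx => (h'.arr x hx).trans (h.arr x hx)⟩

theorem Frame.mono {P Q : Program} {s s' : Store} (h : Frame P s s') (hv : P.modV ⊆ Q.modV)
    (ha : P.modA ⊆ Q.modA) : Frame Q s s' :=
  ⟨fun x hx => h.var x fun h' => hx (hv h'), fun x hx => h.arr x fun h' => hx (ha h')⟩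

/-- The lists `modV` and `modA` are read off the program text, so for a concrete program the fact
that a given variable or array survives is settled by `decide`. -/
theorem Exec.frame {P : Program} {s s' : Store} {t : ℕ} (h : Exec P s s' t) : Frame P s s' := by
  induction h with
  | skip s => exact Frame.refl _ _
  | assign s x e =>
    refine ⟨fun y hy => ?_, fun _ _ => rfl⟩
    simp only [Program.modV, List.mem_singleton] at hy
    simp [hy]
  | write s a i e =>
    refine ⟨fun _ _ => rfl, fun b hb => ?_⟩
    simp only [Program.modA, List.mem_singleton] at hb
    funext j
    simp [hb]
  | seq h₁ h₂ ih₁ ih₂ =>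
    exact (ih₁.mono (by simp [Program.modV]) (by simp [Program.modA])).trans
      (ih₂.mono (by simp [Program.modV]) (by simp [Program.modA]))
  | branch_true _ _ ih => exact ih.mono (by simp [Program.modV]) (by simp [Program.modA])
  | branch_false _ _ ih => exact ih.mono (by simp [Program.modV]) (by simp [Program.modA])
  | loop_true _ _ _ ih₁ ih₂ =>
    exact (ih₁.mono (by simp [Program.modV]) (by simp [Program.modA])).trans ih₂
  | loop_false => exact Frame.refl _ _

/-- Started in `s`, the program `P` halts within `T` steps in a store satisfying `Q`. -/
def WP (P : Program) (s : Store) (T : ℕ) (Q : Store → Prop) : Prop :=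
  ∃ s' t, Exec P s s' t ∧ t ≤ T ∧ Q s'

/-- The frame condition is handed to the consequence for free; postconditions need only mention what
the program changes. -/
theorem WP.mono {P : Program} {s : Store} {T T' : ℕ} {Q Q' : Store → Prop} (h : WP P s T Q)
    (hT : T ≤ T') (hQ : ∀ s', Frame P s s' → Q s' → Q' s') : WP P s T' Q' := by
  obtain ⟨s', t, he, ht, hq⟩ := h
  exact ⟨s', t, he, ht.trans hT, hQ s' he.frame hq⟩

theorem WP.seq {P P' : Program} {s : Store} {T T' : ℕ} {R Q : Store → Prop} (h : WP P s T R)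
    (h' : ∀ s', Frame P s s' → R s' → WP P' s' T' Q) : WP (.seq P P') s (T + T') Q := by
  obtain ⟨s', t, he, ht, hq⟩ := h
  obtain ⟨s'', t', he', ht', hq'⟩ := h' s' he.frame hq
  exact ⟨s'', t + t', .seq he he', by omega, hq'⟩

theorem WP.branch {e : Expr} {P P' : Program} {s : Store} {T : ℕ} {Q : Store → Prop}
    (h : e.eval s ≠ 0 → WP P s T Q) (h' : e.eval s = 0 → WP P' s T Q) :
    WP (.branch e P P') s (e.cost + 1 + T) Q := by
  by_cases he : e.eval s = 0
  · obtain ⟨s', t, hx, ht, hq⟩ := h' he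
    exact ⟨s', _, .branch_false he hx, by omega, hq⟩
  · obtain ⟨s', t, hx, ht, hq⟩ := h he
    exact ⟨s', _, .branch_true he hx, by omega, hq⟩

/-- The effect of a program without loops. -/
def Program.straight : Program → Store → Store
  | .skip, s => s
  | .assign x e, s => s.setVar x (e.eval s)
  | .write a i e, s => s.setArr a (i.eval s) (e.eval s)
  | .seq p q, s => q.straight (p.straight s)
  | .branch e p q, s => if e.eval s = 0 then q.straight s else p.straight s
  | .loop _ _, s => s

def Program.loopFree : Program → Bool
  | .skip => true
  | .assign _ _ => true
  | .write _ _ _ => true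
  | .seq p q => p.loopFree && q.loopFree
  | .branch _ p q => p.loopFree && q.loopFree
  | .loop _ _ => false

/-- A bound on the running time of a program without loops. -/
def Program.straightCost : Program → ℕ
  | .skip => 1
  | .assign _ e => e.cost + 1
  | .write _ i e => i.cost + e.cost + 1
  | .seq p q => p.straightCost + q.straightCost
  | .branch e p q => e.cost + 1 + max p.straightCost q.straightCost
  | .loop _ _ => 0

/-- Symbolic execution: for loop-free code the final store is a function of the initial one, so a
specification becomes a statement about `Program.straight` that simplification can unfold. -/
theorem WP.straight {P : Program} (hP : P.loopFree = true) (s : Store) {T : ℕ}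
    (hT : P.straightCost ≤ T) {Q : Store → Prop} (hQ : Q (P.straight s)) : WP P s T Q := by
  suffices h : WP P s P.straightCost (fun s' => s' = P.straight s) from
    h.mono hT fun s' _ hs' => hs' ▸ hQ
  clear hQ hT
  induction P generalizing s with
  | skip => exact ⟨_, _, .skip s, le_rfl, rfl⟩
  | assign x e => exact ⟨_, _, .assign s x e, le_rfl, rfl⟩
  | write a i e => exact ⟨_, _, .write s a i e, le_rfl, rfl⟩
  | seq p q hp hq =>
    simp only [Program.loopFree, Bool.and_eq_true] at hP
    refine (hp hP.1 s).seq fun s' _ hs' => ?_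
    subst hs'
    exact hq hP.2 _
  | branch e p q hp hq =>
    simp only [Program.loopFree, Bool.and_eq_true] at hP
    refine WP.branch (fun he => (hp hP.1 s).mono (le_max_left _ _) fun s' _ hs' => ?_)
      (fun he => (hq hP.2 s).mono (le_max_right _ _) fun s' _ hs' => ?_)
    · simp [Program.straight, he, hs']
    · simp [Program.straight, he, hs']
  | loop e p _ => simp [Program.loopFree] at hP

/-- A `while` loop with a bound on the number of rounds. -/
theorem WP.loop {e : Expr} {P : Program} {t : ℕ} {I : Store → Prop} {μ : Store → ℕ}
    (hstep : ∀ s, e.eval s ≠ 0 → I s → WP P s t (fun s' => I s' ∧ μ s' < μ s)) {s : Store}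
    (h0 : I s) :
    WP (.loop e P) s ((μ s + 1) * (e.cost + 1 + t)) (fun s' => I s' ∧ e.eval s' = 0) := by
  induction hm : μ s using Nat.strong_induction_on generalizing s with
  | _ m ih =>
    subst hm
    by_cases he : e.eval s = 0
    · exact ⟨s, _, .loop_false he, by nlinarith, h0, he⟩
    · obtain ⟨s', t', hx, ht', hI, hlt⟩ := hstep s he h0
      obtain ⟨s'', t'', hx', ht'', hQ⟩ := ih _ hlt hI rfl
      refine ⟨s'', _, .loop_true he hx hx', ?_, hQ⟩
      have : (μ s' + 1) * (e.cost + 1 + t) ≤ μ s * (e.cost + 1 + t) :=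
        Nat.mul_le_mul_right _ hlt
      have : (μ s + 1) * (e.cost + 1 + t) = μ s * (e.cost + 1 + t) + (e.cost + 1 + t) := by ring
      omega

/-- `for x = 0, …, b - 1 do P`. -/
def forLoop (x : ℕ) (b : Expr) (P : Program) : Program :=
  .seq (.assign x (.const 0))
    (.loop (.sub b (.var x)) (.seq P (.assign x (.add (.var x) (.const 1)))))

/-- The body does not touch the counter and does not change the bound. -/
def forOK (x : ℕ) (b : Expr) (P : Program) : Bool :=
  decide (x ∉ P.modV) && decide (∀ y ∈ b.vars, y ≠ x ∧ y ∉ P.modV) &&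
    decide (∀ a ∈ b.arrs, a ∉ P.modA)

/-- By `forOK` the body changes neither the counter nor anything the bound depends on, so the number
of rounds is fixed in advance. The body is given the frame with respect to the start of the whole
loop, which keeps unchanged data out of the invariant. -/
theorem WP.forLoop {x : ℕ} {b : Expr} {P : Program} (hok : forOK x b P = true) {s : Store} {t : ℕ}
    (I : ℕ → Store → Prop) (h0 : I 0 (s.setVar x 0))
    (hstep : ∀ i s', i < b.eval s → Frame (forLoop x b P) s s' → s'.var x = i → I i s' →
      WP P s' t (fun s'' => I (i + 1) (s''.setVar x (i + 1)))) :
    WP (forLoop x b P) s ((b.eval s + 1) * (t + b.cost + 7)) (fun s' => I (b.eval s) s') := by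
  simp only [forOK, Bool.and_eq_true, decide_eq_true_eq] at hok
  obtain ⟨⟨hx, hbv⟩, hba⟩ := hok
  have hb : ∀ s', Frame (RAM.forLoop x b P) s s' → b.eval s' = b.eval s := fun s' hF =>
    b.eval_congr (fun y hy => hF.var y (by
        simp [RAM.forLoop, Program.modV, (hbv y hy).1, (hbv y hy).2]))
      (fun a ha => hF.arr a (by simp [RAM.forLoop, Program.modA, hba a ha]))
  -- Induction on the number `j` of remaining rounds. A successful test costs `b.cost + 3` and the
  -- increment `4`; the additional `b.cost + 3` pays for the final failing test.
  have key : ∀ j i s', i + j = b.eval s → Frame (RAM.forLoop x b P) s s' → s'.var x = i → I i s' →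
      WP (.loop (.sub b (.var x)) (.seq P (.assign x (.add (.var x) (.const 1))))) s'
        (j * (t + b.cost + 7) + b.cost + 3) (fun s' => I (b.eval s) s') := by
    intro j
    induction j with
    | zero =>
      intro i s' hij hF hi hI
      have he : (Expr.sub b (.var x)).eval s' = 0 := by
        simp only [Expr.eval, hb s' hF, hi]; omega
      refine ⟨s', _, .loop_false he, ?_, ?_⟩
      · simp [Expr.cost]
      · rw [← hij]; exact hI
    | succ j ih =>
      intro i s' hij hF hi hI
      have he : (Expr.sub b (.var x)).eval s' ≠ 0 := by
        simp only [Expr.eval, hb s' hF, hi]; omega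
      obtain ⟨s₁, t₁, hx₁, ht₁, hI₁⟩ := hstep i s' (by omega) hF hi hI
      have hF₁ := hx₁.frame
      have hs₁ : s₁.var x = i := by rw [hF₁.var x hx, hi]
      have hx₂ := Exec.assign s₁ x (.add (.var x) (.const 1))
      have hev : (Expr.add (.var x) (.const 1)).eval s₁ = i + 1 := by simp [Expr.eval, hs₁]
      rw [hev] at hx₂
      obtain ⟨s₃, t₃, hx₃, ht₃, hq⟩ := ih (i + 1) (s₁.setVar x (i + 1)) (by omega)
        (hF.trans ((Exec.seq hx₁ hx₂).frame.mono (by simp [RAM.forLoop, Program.modV])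
          (by simp [RAM.forLoop, Program.modA]))) (by simp) hI₁
      refine ⟨s₃, _, .loop_true he (.seq hx₁ hx₂) hx₃, ?_, hq⟩
      simp only [Expr.cost] at *
      have : (j + 1) * (t + b.cost + 7) = j * (t + b.cost + 7) + (t + b.cost + 7) := by ring
      omega
  obtain ⟨s', t', hx', ht', hq⟩ := key (b.eval s) 0 (s.setVar x 0) (by omega)
    (Exec.frame (Exec.assign s x (.const 0)) |>.mono (by simp [RAM.forLoop, Program.modV])
      (by simp [Program.modA])) (by simp) h0
  refine ⟨s', _, .seq (.assign s x (.const 0)) hx', ?_, hq⟩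
  simp only [Expr.cost]
  have : (b.eval s + 1) * (t + b.cost + 7)
    = b.eval s * (t + b.cost + 7) + (t + b.cost + 7) := by ring
  omega

end RAM

/-! ### Eliminating the bags of a sequence with the running intersection property -/

/-- The position `p` comes right after `q` (for `d = true`) or right before it. -/
abbrev StepRel (d : Bool) (p q : ℕ) : Prop := cond d p q = cond d q p + 1

/-- Bags `0, …, m` of vertices, each one but the first with an earlier parent. The bag `t` has the
vertices `vert t 0, …, vert t (len t - 1)`, and `ind t v` is zero if `v` is not among them and one
plus its position otherwise. The weight of a pair of vertices is zero if they are not adjacent. -/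
structure BagSequence where
  m : ℕ
  weight : ℕ → ℕ → ℕ
  len : ℕ → ℕ
  vert : ℕ → ℕ → ℕ
  par : ℕ → ℕ
  ind : ℕ → ℕ → ℕ
  ind_eq : ∀ t ≤ m, ∀ v a, ind t v = a + 1 ↔ a < len t ∧ vert t a = v
  weight_symm : ∀ u v, weight u v = weight v u
  par_lt : ∀ h, 1 ≤ h → h ≤ m → par h < h
  running_intersection : ∀ h, 1 ≤ h → h ≤ m → ∀ t < h, ∀ v, ind h v ≠ 0 → ind t v ≠ 0 →
    ind (par h) v ≠ 0
  exists_edge_bag : ∀ u v, weight u v ≠ 0 → ∃ t ≤ m, ind t u ≠ 0 ∧ ind t v ≠ 0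
  len_zero : len 0 = 0

/-- Codes below `N` for the lists of `S` states of vertices; a state consists of a color below `L`,
a position up to `k` and two flags. -/
structure StateCode (N S L k : ℕ) where
  col : ℕ → ℕ → ℕ
  pos : ℕ → ℕ → ℕ
  flag : Bool → ℕ → ℕ → ℕ
  col_lt : ∀ X < N, ∀ a < S, col X a < L
  pos_le : ∀ X < N, ∀ a < S, pos X a ≤ k
  exists_code : ∀ (c p : ℕ → ℕ) (f : Bool → ℕ → ℕ),
    (∀ a < S, c a < L ∧ p a ≤ k ∧ ∀ d, f d a ≤ 1) →
    ∃ X < N, ∀ a < S, col X a = c a ∧ pos X a = p a ∧ ∀ d, flag d X a = f d a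

namespace BagSequence

variable (B : BagSequence)

/-- The vertices of the bag `t`. -/
def bag (t : ℕ) : Finset ℕ := (Finset.range (B.len t)).image (B.vert t)

/-- The vertices of the first `h` bags. -/
def below (h : ℕ) : Finset ℕ := (Finset.range h).biUnion B.bag

/-- The number of neighbors of `v` in `U` with the color of `v` and the next position. -/
def steps (col pos : ℕ → ℕ) (d : Bool) (U : Finset ℕ) (v : ℕ) : ℕ :=
  (U.filter fun u => B.weight u v ≠ 0 ∧ col u = col v ∧ StepRel d (pos u) (pos v)).card

/-- The neighbors with the color of `v` are joined to `v` by an edge of weight two and their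
positions differ by one from that of `v`. -/
def GoodOn (col pos : ℕ → ℕ) (U : Finset ℕ) : Prop :=
  ∀ u ∈ U, ∀ v ∈ U, B.weight u v ≠ 0 → col u = col v →
    2 ≤ B.weight u v ∧ (pos u = pos v + 1 ∨ pos v = pos u + 1)

/-- The number of neighbors of the vertex number `a` of the bag `h` with the same color and the
next position, not counting pairs inside the bag `p`, in the state `Z`. -/
def codeSteps {N S L k : ℕ} (E : StateCode N S L k) (h p : ℕ) (d : Bool) (Z a : ℕ) : ℕ :=
  ((Finset.range (B.len h)).filter fun b =>
    B.weight (B.vert h b) (B.vert h a) ≠ 0 ∧ E.col Z b = E.col Z a ∧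
    (B.ind p (B.vert h a) = 0 ∨ B.ind p (B.vert h b) = 0) ∧
    StepRel d (E.pos Z b) (E.pos Z a)).card

/-- The states `Y` of the bag `p` and `Z` of the bag `h` can be merged into the state `X` of the
bag `p`. -/
structure Compat {N S L k : ℕ} (E : StateCode N S L k) (h p X Y Z : ℕ) : Prop where
  parent : ∀ a < B.len p, E.col X a = E.col Y a ∧ E.pos X a = E.pos Y a ∧
    ∀ d, E.flag d Y a ≤ E.flag d X a
  good : ∀ a < B.len h, ∀ b < B.len h, B.weight (B.vert h b) (B.vert h a) ≠ 0 →
    E.col Z b = E.col Z a → 2 ≤ B.weight (B.vert h b) (B.vert h a) ∧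
      (E.pos Z b = E.pos Z a + 1 ∨ E.pos Z a = E.pos Z b + 1)
  private_le : ∀ a < B.len h, B.ind p (B.vert h a) = 0 → ∀ d,
    E.flag d Z a + B.codeSteps E h p d Z a ≤ 1
  shared : ∀ a < B.len h, ∀ i, B.ind p (B.vert h a) = i + 1 →
    E.col Z a = E.col X i ∧ E.pos Z a = E.pos X i ∧
      ∀ d, E.flag d Z a + B.codeSteps E h p d Z a + E.flag d Y i ≤ E.flag d X i

/-- There are colors and positions of the vertices of the first `h` bags which extend to states
allowed by the tables `T` and satisfy all constraints. -/
def Feasible {N S L k : ℕ} (E : StateCode N S L k) (h : ℕ) (T : ℕ → ℕ → Prop) : Prop :=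
  ∃ (col pos : ℕ → ℕ) (g : ℕ → Bool → ℕ → ℕ),
    (∀ t d v, v ∉ B.bag t → g t d v = 0) ∧
    (∀ v ∈ B.below h, col v < L ∧ pos v ≤ k) ∧
    B.GoodOn col pos (B.below h) ∧
    (∀ v ∈ B.below h, ∀ d,
      ∑ t ∈ Finset.range h, g t d v + B.steps col pos d (B.below h) v ≤ 1) ∧
    ∀ t < h, ∃ X < N, T t X ∧ ∀ a < B.len t, E.col X a = col (B.vert t a) ∧
      E.pos X a = pos (B.vert t a) ∧ ∀ d, E.flag d X a = g t d (B.vert t a)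

variable {B}

theorem mem_bag_iff {t v : ℕ} : v ∈ B.bag t ↔ ∃ a < B.len t, B.vert t a = v := by
  simp [bag]

theorem mem_bag_iff_ind {t : ℕ} (ht : t ≤ B.m) {v : ℕ} : v ∈ B.bag t ↔ B.ind t v ≠ 0 := by
  rw [mem_bag_iff]
  constructor
  · rintro ⟨a, ha⟩
    rw [(B.ind_eq t ht v a).2 ha]
    exact a.succ_ne_zero
  · intro h
    obtain ⟨a, ha⟩ := Nat.exists_eq_succ_of_ne_zero h
    exact ⟨a, (B.ind_eq t ht v a).1 ha⟩

theorem ind_vert {t : ℕ} (ht : t ≤ B.m) {a : ℕ} (ha : a < B.len t) :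
    B.ind t (B.vert t a) = a + 1 := (B.ind_eq t ht _ _).2 ⟨ha, rfl⟩

theorem vert_mem {t a : ℕ} (ha : a < B.len t) : B.vert t a ∈ B.bag t := mem_bag_iff.2 ⟨a, ha, rfl⟩

theorem vert_injOn {t : ℕ} (ht : t ≤ B.m) : Set.InjOn (B.vert t) (Finset.range (B.len t)) := by
  intro a ha b hb hab
  simp only [Finset.coe_range, Set.mem_Iio] at ha hb
  have h1 := ind_vert ht ha
  rw [hab, ind_vert ht hb] at h1
  omega

theorem mem_below {h v : ℕ} : v ∈ B.below h ↔ ∃ t < h, v ∈ B.bag t := by simp [below]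

theorem below_succ (h : ℕ) : B.below (h + 1) = B.below h ∪ B.bag h := by
  ext v
  simp only [mem_below, Finset.mem_union, Nat.lt_succ_iff_lt_or_eq]
  constructor
  · rintro ⟨t, ht | rfl, hv⟩
    exacts [.inl ⟨t, ht, hv⟩, .inr hv]
  · rintro (⟨t, ht, hv⟩ | hv)
    exacts [⟨t, .inl ht, hv⟩, ⟨h, .inr rfl, hv⟩]

theorem bag_subset_below {t h : ℕ} (ht : t < h) : B.bag t ⊆ B.below h :=
  fun _ hv => mem_below.2 ⟨t, ht, hv⟩

/-- Adjacent vertices of the first bags lie together in one of them. -/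
theorem exists_common_bag {h : ℕ} (hm : h ≤ B.m) {u v : ℕ} (hu : u ∈ B.below (h + 1))
    (hv : v ∈ B.below (h + 1)) (huv : B.weight u v ≠ 0) :
    ∃ t ≤ h, u ∈ B.bag t ∧ v ∈ B.bag t := by
  obtain ⟨t, ht, htu, htv⟩ := B.exists_edge_bag u v huv
  rw [← mem_bag_iff_ind ht] at htu htv
  induction t using Nat.strong_induction_on with
  | _ t ih =>
    by_cases hth : t ≤ h
    · exact ⟨t, hth, htu, htv⟩
    · have h1 : 1 ≤ t := by omega
      have hp := B.par_lt t h1 ht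
      -- A common bag beyond `h` can be replaced by its parent: both vertices also lie in a bag
      -- before it, so running intersection applies. Parents are strictly earlier, hence the descent
      -- reaches a bag up to `h`.
      have key : ∀ x, x ∈ B.below (h + 1) → x ∈ B.bag t → x ∈ B.bag (B.par t) := by
        intro x hx hxt
        obtain ⟨r, hr, hxr⟩ := mem_below.1 hx
        rw [mem_bag_iff_ind (by omega)] at hxt hxr ⊢
        exact B.running_intersection t h1 ht r (by omega) x hxt hxr
      exact ih _ hp (by omega) (key u hu htu) (key v hv htv)

theorem steps_union {col pos : ℕ → ℕ} {d : Bool} {U W : Finset ℕ} (hd : Disjoint U W) (v : ℕ) :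
    B.steps col pos d (U ∪ W) v = B.steps col pos d U v + B.steps col pos d W v := by
  rw [steps, Finset.filter_union, Finset.card_union_of_disjoint]
  · rfl
  · exact Finset.disjoint_filter_filter hd

theorem steps_congr {col pos col' pos' : ℕ → ℕ} {d : Bool} {U : Finset ℕ} {v : ℕ}
    (hU : ∀ u ∈ U, col u = col' u ∧ pos u = pos' u) (hv : col v = col' v ∧ pos v = pos' v) :
    B.steps col pos d U v = B.steps col' pos' d U v := by
  unfold steps
  congr 1
  refine Finset.filter_congr fun u hu => ?_
  rw [(hU u hu).1, (hU u hu).2, hv.1, hv.2]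

/-- The vertices of the bag `h` outside of its parent are in no earlier bag. -/
theorem sdiff_disjoint {h : ℕ} (h1 : 1 ≤ h) (hm : h ≤ B.m) :
    Disjoint (B.below h) (B.bag h \ B.bag (B.par h)) := by
  rw [Finset.disjoint_right]
  intro v hv hvb
  rw [Finset.mem_sdiff] at hv
  obtain ⟨t, ht, hvt⟩ := mem_below.1 hvb
  have hp := B.par_lt h h1 hm
  rw [mem_bag_iff_ind (by omega), mem_bag_iff_ind (by omega)] at hv
  rw [mem_bag_iff_ind (by omega)] at hvt
  exact hv.2 (B.running_intersection h h1 hm t ht v hv.1 hvt)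

theorem below_succ_eq {h : ℕ} (h1 : 1 ≤ h) (hm : h ≤ B.m) :
    B.below (h + 1) = B.below h ∪ (B.bag h \ B.bag (B.par h)) := by
  rw [below_succ]
  ext v
  have := bag_subset_below (B := B) (B.par_lt h h1 hm)
  simp only [Finset.mem_union, Finset.mem_sdiff]
  by_cases hv : v ∈ B.bag (B.par h)
  · simp [hv, this hv]
  · simp [hv]

/-- A neighbor of a new vertex of the bag `h` lies in that bag. -/
theorem mem_bag_of_weight {h : ℕ} (h1 : 1 ≤ h) (hm : h ≤ B.m) {u v : ℕ}
    (hu : u ∈ B.bag h \ B.bag (B.par h)) (hv : v ∈ B.below (h + 1)) (huv : B.weight u v ≠ 0) :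
    v ∈ B.bag h := by
  have hu' : u ∈ B.below (h + 1) := by
    rw [below_succ_eq h1 hm]; exact Finset.mem_union_right _ hu
  obtain ⟨t, ht, htu, htv⟩ := exists_common_bag hm hu' hv huv
  rcases ht.lt_or_eq with ht | rfl
  · exact absurd hu (Finset.disjoint_left.1 (sdiff_disjoint h1 hm) (bag_subset_below ht htu))
  · exact htv

/-- Pairs inside the bag `p` stay visible after the merge and must not be charged twice. So a vertex
of `p` only counts its neighbors outside of `p`, whereas for a vertex outside of `p` the restriction
is void. Places and vertices correspond because `vert` is injective on a bag. -/
theorem steps_bag {N S L k : ℕ} (E : StateCode N S L k) {h p : ℕ} (hh : h ≤ B.m) (hp : p ≤ B.m)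
    {col pos : ℕ → ℕ} {Z : ℕ}
    (hZ : ∀ a < B.len h, E.col Z a = col (B.vert h a) ∧ E.pos Z a = pos (B.vert h a))
    {a : ℕ} (ha : a < B.len h) (d : Bool) :
    B.codeSteps E h p d Z a = B.steps col pos d
      (if B.vert h a ∈ B.bag p then B.bag h \ B.bag p else B.bag h) (B.vert h a) := by
  have himg : ∀ P : ℕ → Prop, ∀ _ : DecidablePred P, ((B.bag h).filter P).card =
      ((Finset.range (B.len h)).filter fun b => P (B.vert h b)).card := by
    intro P _
    rw [bag, Finset.filter_image, Finset.card_image_of_injOn]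
    refine (vert_injOn hh).mono fun x hx => ?_
    simp only [Finset.coe_filter, Finset.mem_range, Set.mem_ofPred_eq] at hx
    simpa using hx.1
  unfold codeSteps steps
  by_cases hap : B.vert h a ∈ B.bag p
  · have hap' := (mem_bag_iff_ind hp).1 hap
    rw [if_pos hap, Finset.sdiff_eq_filter, Finset.filter_filter, himg]
    congr 1
    refine Finset.filter_congr fun b hb => ?_
    rw [Finset.mem_range] at hb
    rw [(hZ a ha).1, (hZ a ha).2, (hZ b hb).1, (hZ b hb).2, mem_bag_iff_ind hp]
    tauto
  · have hap' : B.ind p (B.vert h a) = 0 := by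
      rw [mem_bag_iff_ind hp] at hap
      tauto
    rw [if_neg hap, himg]
    congr 1
    refine Finset.filter_congr fun b hb => ?_
    rw [Finset.mem_range] at hb
    rw [(hZ a ha).1, (hZ a ha).2, (hZ b hb).1, (hZ b hb).2]
    tauto

end BagSequence

/-! ### Feasibility is preserved by merging the last bag into its parent -/

namespace BagSequence

variable {B : BagSequence}

/-- Eliminating the last bag: its table is merged into the table of its parent. -/
theorem Feasible.eliminate {N S L k : ℕ} {E : StateCode N S L k} (hlen : ∀ t ≤ B.m, B.len t ≤ S)
    {h : ℕ} (h1 : 1 ≤ h) (hm : h ≤ B.m) {T T' : ℕ → ℕ → Prop}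
    (hT : ∀ X < N, ∀ Y < N, ∀ Z < N, T (B.par h) Y → T h Z → B.Compat E h (B.par h) X Y Z →
      T' (B.par h) X)
    (hT' : ∀ t < h, t ≠ B.par h → ∀ X < N, T t X → T' t X) (hF : B.Feasible E (h + 1) T) :
    B.Feasible E h T' := by
  obtain ⟨col, pos, g, hg0, hbd, hgood, hsum, hcode⟩ := hF
  set p := B.par h with hp
  have hph : p < h := B.par_lt h h1 hm
  have hdisj := sdiff_disjoint h1 hm
  have hsub : B.below h ⊆ B.below (h + 1) := by
    rw [below_succ]; exact Finset.subset_union_left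
  have hbag : B.bag h ⊆ B.below (h + 1) := bag_subset_below (Nat.lt_succ_self h)
  obtain ⟨Z, hZN, hTZ, hZ⟩ := hcode h (Nat.lt_succ_self h)
  obtain ⟨Y, hYN, hTY, hY⟩ := hcode p (by omega)
  have hst : ∀ v d, B.steps col pos d (B.below (h + 1)) v = B.steps col pos d (B.below h) v +
      B.steps col pos d (B.bag h \ B.bag p) v := by
    intro v d
    rw [below_succ_eq h1 hm, steps_union hdisj]
  -- For a shared vertex, everything that disappears with the bag `h` is charged to the parent: what
  -- was already charged to `h`, and the neighbors among the vertices private to `h`.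
  let extra : Bool → ℕ → ℕ := fun d v => if v ∈ B.bag p ∧ v ∈ B.bag h then
    g h d v + B.steps col pos d (B.bag h \ B.bag p) v else 0
  let g' : ℕ → Bool → ℕ → ℕ := fun t d v => g t d v + if t = p then extra d v else 0
  have hsum' : ∀ d v, ∑ t ∈ Finset.range h, g' t d v =
      ∑ t ∈ Finset.range h, g t d v + extra d v := by
    intro d v
    simp only [g', Finset.sum_add_distrib]
    rw [Finset.sum_ite_eq' (Finset.range h) p, if_pos (Finset.mem_range.2 hph)]
  have hext : ∀ d v, extra d v ≤ g h d v + B.steps col pos d (B.bag h \ B.bag p) v := by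
    intro d v
    simp only [extra]
    split_ifs <;> omega
  have htot : ∀ v ∈ B.below h, ∀ d,
      ∑ t ∈ Finset.range h, g' t d v + B.steps col pos d (B.below h) v ≤ 1 := by
    intro v hv d
    have := hsum v (hsub hv) d
    rw [Finset.sum_range_succ, hst] at this
    rw [hsum']
    have := hext d v
    omega
  -- The charge is one summand of a total of at most one, so it fits into a flag.
  have hg1 : ∀ v ∈ B.bag p, ∀ d, g' p d v ≤ 1 := by
    intro v hv d
    have := htot v (bag_subset_below hph hv) d
    have h2 := Finset.single_le_sum (f := fun t => g' t d v) (fun _ _ => Nat.zero_le _)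
      (Finset.mem_range.2 hph)
    omega
  have hpS := hlen p (by omega)
  have hhS := hlen h hm
  -- A code fixes all `S` places. Beyond the size of the bag the values of `Y` serve as admissible
  -- fillers.
  obtain ⟨X, hXN, hX⟩ := E.exists_code
    (fun a => if a < B.len p then col (B.vert p a) else E.col Y a)
    (fun a => if a < B.len p then pos (B.vert p a) else E.pos Y a)
    (fun d a => if a < B.len p then g' p d (B.vert p a) else 0) (by
      intro a ha
      by_cases hap : a < B.len p
      · have hb := hbd _ (hsub (bag_subset_below hph (vert_mem hap)))
        simp only [hap, if_true]
        exact ⟨hb.1, hb.2, hg1 _ (vert_mem hap)⟩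
      · simp only [hap, if_false]
        exact ⟨E.col_lt Y hYN a ha, E.pos_le Y hYN a ha, fun _ => Nat.zero_le _⟩)
  have hXv : ∀ a < B.len p, E.col X a = col (B.vert p a) ∧ E.pos X a = pos (B.vert p a) ∧
      ∀ d, E.flag d X a = g' p d (B.vert p a) := by
    intro a ha
    simpa [ha] using hX a (by omega)
  have hZc := fun a ha => And.intro (hZ a ha).1 (hZ a ha).2.1
  have hcompat : B.Compat E h p X Y Z := by
    refine ⟨fun a ha => ?_, fun a ha b hb hw hc => ?_, fun a ha hi d => ?_, fun a ha i hi => ?_⟩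
    · rw [(hXv a ha).1, (hXv a ha).2.1, (hY a ha).1, (hY a ha).2.1]
      refine ⟨rfl, rfl, fun d => ?_⟩
      rw [(hXv a ha).2.2, (hY a ha).2.2]
      exact Nat.le_add_right _ _
    · rw [(hZ a ha).1, (hZ b hb).1] at hc
      rw [(hZ a ha).2.1, (hZ b hb).2.1]
      exact hgood _ (hbag (vert_mem hb)) _ (hbag (vert_mem ha)) hw hc
    · have hap : B.vert h a ∉ B.bag p := by
        rw [mem_bag_iff_ind (by omega)]; tauto
      rw [steps_bag E hm (by omega) hZc ha d, if_neg hap, (hZ a ha).2.2]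
      have h2 := hsum _ (hbag (vert_mem ha)) d
      rw [Finset.sum_range_succ] at h2
      have h3 : B.steps col pos d (B.bag h) (B.vert h a) ≤
          B.steps col pos d (B.below (h + 1)) (B.vert h a) :=
        Finset.card_le_card (Finset.filter_subset_filter _ hbag)
      omega
    · have hi' := (B.ind_eq p (by omega) _ _).1 hi
      have hap : B.vert h a ∈ B.bag p := mem_bag_iff.2 ⟨i, hi'⟩
      obtain ⟨e1, e2, e3⟩ := hXv i hi'.1
      obtain ⟨f1, f2, f3⟩ := hY i hi'.1
      rw [hi'.2] at e1 e2 e3 f1 f2 f3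
      rw [(hZ a ha).1, (hZ a ha).2.1, e1, e2]
      refine ⟨rfl, rfl, fun d => ?_⟩
      rw [steps_bag E hm (by omega) hZc ha d, if_pos hap, (hZ a ha).2.2, e3, f3]
      simp only [g', extra, if_true, if_pos (And.intro hap (vert_mem ha))]
      omega
  refine ⟨col, pos, g', ?_, fun v hv => hbd v (hsub hv),
    fun u hu v hv => hgood u (hsub hu) v (hsub hv), htot, ?_⟩
  · intro t d v hv
    simp only [g', extra, hg0 t d v hv]
    split_ifs with h2 h3
    · subst h2; exact absurd h3.1 hv
    · rfl
    · rfl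
  intro t ht
  by_cases htp : t = p
  · subst htp
    exact ⟨X, hXN, hT X hXN Y hYN Z hZN hTY hTZ hcompat, hXv⟩
  · obtain ⟨X', hX'N, hTX', hX'⟩ := hcode t (by omega)
    refine ⟨X', hX'N, hT' t ht htp X' hX'N hTX', ?_⟩
    simpa [g', htp] using hX'

/-- Undoing the elimination of the last bag. -/
theorem Feasible.of_eliminate {N S L k : ℕ} {E : StateCode N S L k}
    (hlen : ∀ t ≤ B.m, B.len t ≤ S)
    {h : ℕ} (h1 : 1 ≤ h) (hm : h ≤ B.m) {T T' : ℕ → ℕ → Prop}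
    (hT : ∀ X < N, T' (B.par h) X →
      ∃ Y < N, ∃ Z < N, T (B.par h) Y ∧ T h Z ∧ B.Compat E h (B.par h) X Y Z)
    (hT' : ∀ t < h, t ≠ B.par h → ∀ X < N, T' t X → T t X) (hF : B.Feasible E h T') :
    B.Feasible E (h + 1) T := by
  obtain ⟨col, pos, g, hg0, hbd, hgood, hsum, hcode⟩ := hF
  set p := B.par h with hp
  have hph : p < h := B.par_lt h h1 hm
  have hdisj := sdiff_disjoint h1 hm
  obtain ⟨X, hXN, hTX, hX⟩ := hcode p hph
  obtain ⟨Y, hYN, Z, hZN, hTY, hTZ, hC⟩ := hT X hXN hTX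
  have hhS := hlen h hm
  have hpm : p ≤ B.m := by omega
  let R := B.bag h \ B.bag p
  -- Private vertices of `h` read their labels from `Z`, the others keep theirs. The subtraction is
  -- there because `ind` is one plus the place.
  let col' : ℕ → ℕ := fun v => if v ∈ R then E.col Z (B.ind h v - 1) else col v
  let pos' : ℕ → ℕ := fun v => if v ∈ R then E.pos Z (B.ind h v - 1) else pos v
  let gY : Bool → ℕ → ℕ := fun d v => if v ∈ B.bag p then E.flag d Y (B.ind p v - 1) else 0
  let gZ : Bool → ℕ → ℕ := fun d v => if v ∈ B.bag h then E.flag d Z (B.ind h v - 1) else 0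
  let g' : ℕ → Bool → ℕ → ℕ := fun t d v =>
    if t = h then gZ d v else if t = p then gY d v else g t d v
  have hbelow : ∀ v ∈ B.below h, col' v = col v ∧ pos' v = pos v := by
    intro v hv
    have : v ∉ R := Finset.disjoint_left.1 hdisj hv
    simp [col', pos', this]
  have hbp : ∀ v ∈ B.bag p, v ∈ B.below h := fun v hv => bag_subset_below hph hv
  have hZ : ∀ a < B.len h, E.col Z a = col' (B.vert h a) ∧ E.pos Z a = pos' (B.vert h a) := by
    intro a ha
    by_cases hap : B.vert h a ∈ B.bag p
    · obtain ⟨i, hi⟩ := mem_bag_iff.1 hap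
      obtain ⟨h2, h3, -⟩ := hC.shared a ha i ((B.ind_eq p hpm _ _).2 hi)
      obtain ⟨h4, h5⟩ := hbelow _ (hbp _ hap)
      rw [h4, h5, h2, h3, ← hi.2]
      exact ⟨(hX i hi.1).1, (hX i hi.1).2.1⟩
    · have : B.vert h a ∈ R := Finset.mem_sdiff.2 ⟨vert_mem ha, hap⟩
      simp [col', pos', this, ind_vert hm ha]
  have hgZ : ∀ a < B.len h, ∀ d, gZ d (B.vert h a) = E.flag d Z a := by
    intro a ha d
    simp [gZ, vert_mem ha, ind_vert hm ha]
  have hgY : ∀ a < B.len p, ∀ d, gY d (B.vert p a) = E.flag d Y a := by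
    intro a ha d
    simp [gY, vert_mem ha, ind_vert hpm ha]
  have hunion := below_succ_eq h1 hm
  have hgood_h : B.GoodOn col' pos' (B.bag h) := by
    intro u hu v hv hw hc
    obtain ⟨b, hb, rfl⟩ := mem_bag_iff.1 hu
    obtain ⟨a, ha, rfl⟩ := mem_bag_iff.1 hv
    have := hC.good a ha b hb hw (by rw [(hZ a ha).1, (hZ b hb).1, hc])
    rwa [(hZ a ha).2, (hZ b hb).2] at this
  have hgYg : ∀ v ∈ B.bag p, ∀ d, gY d v ≤ g p d v := by
    intro v hv d
    obtain ⟨a, ha, rfl⟩ := mem_bag_iff.1 hv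
    rw [hgY a ha, ← (hX a ha).2.2]
    exact (hC.parent a ha).2.2 d
  -- The charge `g p` is replaced by the flags of `Y`, and the flags of `Z` are added. The balance
  -- is written additively to avoid truncated subtraction.
  have hsum' : ∀ d v, ∑ t ∈ Finset.range (h + 1), g' t d v + g p d v =
      ∑ t ∈ Finset.range h, g t d v + gY d v + gZ d v := by
    intro d v
    rw [Finset.sum_range_succ]
    have e1 := Finset.add_sum_erase (Finset.range h) (fun t => g' t d v) (Finset.mem_range.2 hph)
    have e2 := Finset.add_sum_erase (Finset.range h) (fun t => g t d v) (Finset.mem_range.2 hph)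
    have e3 : ∑ t ∈ (Finset.range h).erase p, g' t d v = ∑ t ∈ (Finset.range h).erase p, g t d v := by
      refine Finset.sum_congr rfl fun t ht => ?_
      rw [Finset.mem_erase, Finset.mem_range] at ht
      simp [g', ht.1, ht.2.ne]
    have e4 : g' p d v = gY d v := by simp [g', hph.ne]
    have e5 : g' h d v = gZ d v := by simp [g']
    omega
  refine ⟨col', pos', g', ?_, ?_, ?_, ?_, ?_⟩
  · intro t d v hv
    by_cases h2 : t = h
    · subst h2; simp [g', gZ, hv]
    by_cases h3 : t = p
    · subst h3; simp [g', gY, hv, h2]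
    · simp [g', h2, h3, hg0 t d v hv]
  · intro v hv
    rw [hunion, Finset.mem_union] at hv
    rcases hv with hv | hv
    · rw [(hbelow v hv).1, (hbelow v hv).2]; exact hbd v hv
    · obtain ⟨a, ha, rfl⟩ := mem_bag_iff.1 (Finset.mem_sdiff.1 hv).1
      rw [← (hZ a ha).1, ← (hZ a ha).2]
      exact ⟨E.col_lt Z hZN a (by omega), E.pos_le Z hZN a (by omega)⟩
  · intro u hu v hv hw hc
    by_cases hboth : u ∈ B.below h ∧ v ∈ B.below h
    · rw [(hbelow u hboth.1).1, (hbelow v hboth.2).1] at hc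
      rw [(hbelow u hboth.1).2, (hbelow v hboth.2).2]
      exact hgood u hboth.1 v hboth.2 hw hc
    -- If one end of an edge is private to `h`, the other end also lies in the bag `h`, where the
    -- condition was checked on the state `Z`.
    · have hR : u ∈ R ∨ v ∈ R := by
        rw [hunion, Finset.mem_union] at hu hv
        simp only [R]
        tauto
      obtain ⟨hu', hv'⟩ : u ∈ B.bag h ∧ v ∈ B.bag h := by
        rcases hR with hR | hR
        · exact ⟨(Finset.mem_sdiff.1 hR).1, mem_bag_of_weight h1 hm hR hv hw⟩
        · exact ⟨mem_bag_of_weight h1 hm hR hu (by rwa [B.weight_symm]), (Finset.mem_sdiff.1 hR).1⟩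
      exact hgood_h u hu' v hv' hw hc
  · intro v hv d
    have hs := hsum' d v
    by_cases hvb : v ∈ B.below h
    · have h2 := hsum v hvb d
      have h3 : B.steps col' pos' d (B.below h) v = B.steps col pos d (B.below h) v :=
        steps_congr hbelow (hbelow v hvb)
      rw [hunion, steps_union hdisj, h3, ← hp]
      by_cases hvh : v ∈ B.bag h
      · have hvp : v ∈ B.bag p := by
          by_contra hvp
          exact Finset.disjoint_left.1 hdisj hvb (Finset.mem_sdiff.2 ⟨hvh, hvp⟩)
        obtain ⟨a, ha, rfl⟩ := mem_bag_iff.1 hvh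
        obtain ⟨i, hi⟩ := mem_bag_iff.1 hvp
        have h4 := (hC.shared a ha i ((B.ind_eq p hpm _ _).2 hi)).2.2 d
        rw [steps_bag E hm hpm hZ ha d, if_pos hvp, ← hgZ a ha, ← hgY i hi.1, (hX i hi.1).2.2,
          hi.2] at h4
        omega
      -- An old vertex outside of the bag `h` gains no neighbors, and its charge can only drop.
      · have h4 : B.steps col' pos' d (B.bag h \ B.bag p) v = 0 := by
          refine Finset.card_eq_zero.2 (Finset.filter_eq_empty_iff.2 fun u hu hc => hvh ?_)
          exact mem_bag_of_weight h1 hm hu hv hc.1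
        have h5 : gZ d v = 0 := by simp [gZ, hvh]
        have h6 : gY d v ≤ g p d v := by
          by_cases hvp : v ∈ B.bag p
          · exact hgYg v hvp d
          · simp [gY, hvp]
        omega
    -- A private vertex has no charges in earlier bags, and all its neighbors lie in the bag `h`, so
    -- `private_le` is exactly its condition.
    · have hvR : v ∈ B.bag h \ B.bag p := by
        rw [hunion, Finset.mem_union] at hv; tauto
      have hvp := (Finset.mem_sdiff.1 hvR).2
      have h2 : ∀ t < h, g t d v = 0 := fun t ht =>
        hg0 t d v fun hvt => hvb (bag_subset_below ht hvt)
      have h3 : ∑ t ∈ Finset.range h, g t d v = 0 :=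
        Finset.sum_eq_zero fun t ht => h2 t (Finset.mem_range.1 ht)
      have h4 : gY d v = 0 := by simp [gY, hvp]
      obtain ⟨a, ha, rfl⟩ := mem_bag_iff.1 (Finset.mem_sdiff.1 hvR).1
      have h5 := hC.private_le a ha (by rw [mem_bag_iff_ind hpm] at hvp; tauto) d
      rw [steps_bag E hm hpm hZ ha d, if_neg hvp, ← hgZ a ha] at h5
      have h6 : B.steps col' pos' d (B.below (h + 1)) (B.vert h a) ≤
          B.steps col' pos' d (B.bag h) (B.vert h a) := by
        refine Finset.card_le_card fun u hu => ?_
        rw [Finset.mem_filter] at hu ⊢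
        exact ⟨mem_bag_of_weight h1 hm hvR hu.1 (by rw [B.weight_symm]; exact hu.2.1), hu.2⟩
      omega
  · intro t ht
    by_cases hth : t = h
    · subst hth
      refine ⟨Z, hZN, hTZ, fun a ha => ⟨(hZ a ha).1, (hZ a ha).2, fun d => ?_⟩⟩
      simp [g', hgZ a ha]
    have hth' : t < h := by omega
    by_cases htp : t = p
    · subst htp
      refine ⟨Y, hYN, hTY, fun a ha => ?_⟩
      have h2 := hbelow _ (hbp _ (vert_mem ha))
      have h3 := hC.parent a ha
      refine ⟨?_, ?_, fun d => ?_⟩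
      · rw [h2.1, ← h3.1, (hX a ha).1]
      · rw [h2.2, ← h3.2.1, (hX a ha).2.1]
      · simp [g', hth, hgY a ha]
    · obtain ⟨X', hX'N, hTX', hX'⟩ := hcode t hth'
      refine ⟨X', hX'N, hT' t hth' htp X' hX'N hTX', fun a ha => ?_⟩
      have h2 := hbelow _ (bag_subset_below hth' (vert_mem ha))
      rw [h2.1, h2.2]
      simpa [g', hth, htp] using hX' a ha

end BagSequence

/-! ### The two ends of the elimination, and the case of many colors -/

namespace BagSequence

variable (B : BagSequence)

/-- There are colors below `L` and positions up to `k` of the vertices of all bags such that the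
positions certify a path coloring. -/
def Certified (L k : ℕ) : Prop :=
  ∃ col pos : ℕ → ℕ, (∀ v ∈ B.below (B.m + 1), col v < L ∧ pos v ≤ k) ∧
    B.GoodOn col pos (B.below (B.m + 1)) ∧
    ∀ v ∈ B.below (B.m + 1), ∀ d, B.steps col pos d (B.below (B.m + 1)) v ≤ 1

variable {B}

/-- When all states are allowed, the charges may be taken to be zero, and given charges may simply
be dropped since the constraints are upper bounds. The hypothesis `hL` supplies a color for the
unused places of a code. -/
theorem feasible_all_iff {N S L k : ℕ} {E : StateCode N S L k} (hL : 0 < L)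
    (hlen : ∀ t ≤ B.m, B.len t ≤ S) {T : ℕ → ℕ → Prop} (hT : ∀ t ≤ B.m, ∀ X, T t X) :
    B.Feasible E (B.m + 1) T ↔ B.Certified L k := by
  constructor
  · rintro ⟨col, pos, g, -, hbd, hgood, hsum, -⟩
    exact ⟨col, pos, hbd, hgood, fun v hv d => (Nat.le_add_left _ _).trans (hsum v hv d)⟩
  · rintro ⟨col, pos, hbd, hgood, hsum⟩
    refine ⟨col, pos, fun _ _ _ => 0, fun _ _ _ _ => rfl, hbd, hgood, fun v hv d => ?_,
      fun t ht => ?_⟩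
    · simpa using hsum v hv d
    · obtain ⟨X, hXN, hX⟩ := E.exists_code
        (fun a => if a < B.len t then col (B.vert t a) else 0)
        (fun a => if a < B.len t then pos (B.vert t a) else 0) (fun _ _ => 0) (by
          intro a ha
          by_cases hap : a < B.len t
          · simpa [hap] using hbd _ (bag_subset_below ht (vert_mem hap))
          · simpa [hap] using hL)
      refine ⟨X, hXN, hT t (by omega) X, fun a ha => ?_⟩
      have := hlen t (by omega)
      simpa [ha] using hX a (by omega)

/-- Bag `0` is empty, so no labeling condition remains and only the table is left to inspect. -/
theorem feasible_one_iff {N S L k : ℕ} {E : StateCode N S L k} {T : ℕ → ℕ → Prop} :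
    B.Feasible E 1 T ↔ ∃ X < N, T 0 X := by
  have hb : B.below 1 = ∅ := by
    simp [below, bag, B.len_zero]
  constructor
  · rintro ⟨col, pos, g, -, -, -, -, h⟩
    obtain ⟨X, hX, hT, -⟩ := h 0 one_pos
    exact ⟨X, hX, hT⟩
  · rintro ⟨X, hX, hT⟩
    refine ⟨fun _ => 0, fun _ => 0, fun _ _ _ => 0, fun _ _ _ _ => rfl, by simp [hb],
      by simp [hb, GoodOn], by simp [hb], fun t ht => ⟨X, hX, ?_⟩⟩
    obtain rfl : t = 0 := by omega
    exact ⟨hT, by simp [B.len_zero]⟩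

/-- The vertices can be colored with as many colors as the bags have places, with distinct colors
within each bag. -/
theorem exists_injOn_bags {S : ℕ} (hlen : ∀ t ≤ B.m, B.len t ≤ S) (h : ℕ) (hm : h ≤ B.m + 1) :
    ∃ col : ℕ → ℕ, (∀ v ∈ B.below h, col v < S) ∧ ∀ t < h, Set.InjOn col (B.bag t) := by
  induction h with
  | zero => exact ⟨fun _ => 0, by simp [below], by simp⟩
  | succ h ih =>
    obtain ⟨col, hS, hinj⟩ := ih (by omega)
    rcases Nat.eq_zero_or_pos h with rfl | h1
    · refine ⟨fun _ => 0, ?_, ?_⟩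
      · simp [below, bag, B.len_zero]
      · intro t ht
        obtain rfl : t = 0 := by omega
        simp [bag, B.len_zero]
    have hm' : h ≤ B.m := by omega
    have hp := B.par_lt h h1 hm'
    have hcard : (B.bag h).card ≤ S := by
      refine (Finset.card_image_le).trans ?_
      simpa using hlen h hm'
    have hold : ((B.bag h ∩ B.bag (B.par h)).image col) ⊆ Finset.range S := by
      intro c hc
      obtain ⟨v, hv, rfl⟩ := Finset.mem_image.1 hc
      exact Finset.mem_range.2 (hS v (bag_subset_below hp (Finset.mem_inter.1 hv).2))
    have hinj' : Set.InjOn col (B.bag h ∩ B.bag (B.par h) : Finset ℕ) :=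
      (hinj _ hp).mono (by simp)
    -- The vertices shared with the parent use distinct colors, so the colors they leave free are at
    -- least as many as the private vertices of the bag.
    have hfree : (B.bag h \ B.bag (B.par h)).card ≤
        (Finset.range S \ (B.bag h ∩ B.bag (B.par h)).image col).card := by
      rw [Finset.card_sdiff_of_subset hold, Finset.card_image_of_injOn hinj', Finset.card_range]
      have := Finset.card_inter_add_card_sdiff (B.bag h) (B.bag (B.par h))
      omega
    obtain ⟨f, hf⟩ := Finset.exists_subset_card_eq hfree
    have e := Finset.equivOfCardEq hf.2.symm
    let col' : ℕ → ℕ := fun v =>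
      if hv : v ∈ B.bag h \ B.bag (B.par h) then (e ⟨v, hv⟩ : ℕ) else col v
    have hdisj := sdiff_disjoint h1 hm'
    have hbelow : ∀ v ∈ B.below h, col' v = col v := fun v hv => by
      simp only [col', dif_neg (Finset.disjoint_left.1 hdisj hv)]
    have hnew : ∀ v ∈ B.bag h \ B.bag (B.par h),
        col' v ∈ Finset.range S \ (B.bag h ∩ B.bag (B.par h)).image col := fun v hv => by
      simp only [col', dif_pos hv]
      exact hf.1 (e ⟨v, hv⟩).2
    refine ⟨col', fun v hv => ?_, fun t ht => ?_⟩
    · rw [below_succ_eq h1 hm', Finset.mem_union] at hv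
      rcases hv with hv | hv
      · rw [hbelow v hv]; exact hS v hv
      · exact Finset.mem_range.1 (Finset.mem_sdiff.1 (hnew v hv)).1
    · rcases Nat.lt_succ_iff_lt_or_eq.1 ht with ht | rfl
      · intro u hu v hv huv
        rw [hbelow u (bag_subset_below ht hu), hbelow v (bag_subset_below ht hv)] at huv
        exact hinj t ht hu hv huv
      · have hmix : ∀ u ∈ B.bag t, ∀ v ∈ B.bag t, u ∈ B.bag (B.par t) → v ∉ B.bag (B.par t) →
            col' u ≠ col' v := by
          intro u hu v hv hup hvp huv
          have h2 := (Finset.mem_sdiff.1 (hnew v (Finset.mem_sdiff.2 ⟨hv, hvp⟩))).2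
          rw [← huv, hbelow u (bag_subset_below hp hup)] at h2
          exact h2 (Finset.mem_image_of_mem _ (Finset.mem_inter.2 ⟨hu, hup⟩))
        intro u hu v hv huv
        by_cases hup : u ∈ B.bag (B.par t) <;> by_cases hvp : v ∈ B.bag (B.par t)
        · rw [hbelow u (bag_subset_below hp hup), hbelow v (bag_subset_below hp hvp)] at huv
          exact hinj _ hp hup hvp huv
        · exact absurd huv (hmix u hu v hv hup hvp)
        · exact absurd huv.symm (hmix v hv u hu hvp hup)
        · have hu' := Finset.mem_sdiff.2 ⟨hu, hup⟩
          have hv' := Finset.mem_sdiff.2 ⟨hv, hvp⟩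
          simp only [col', dif_pos hu', dif_pos hv'] at huv
          simpa using e.injective (Subtype.ext huv)

/-- With as many colors as the largest bag has vertices there is a proper coloring. -/
theorem certified_of_le {S L : ℕ} (hlen : ∀ t ≤ B.m, B.len t ≤ S) (hSL : S ≤ L)
    (hloop : ∀ v, B.weight v v = 0) (k : ℕ) : B.Certified L k := by
  obtain ⟨col, hS, hinj⟩ := exists_injOn_bags hlen (B.m + 1) le_rfl
  have hproper : ∀ u v, B.weight u v ≠ 0 → col u ≠ col v := by
    intro u v huv hc
    obtain ⟨t, ht, hu, hv⟩ := B.exists_edge_bag u v huv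
    rw [← mem_bag_iff_ind ht] at hu hv
    obtain rfl := hinj t (by omega) hu hv hc
    exact huv (hloop u)
  refine ⟨col, fun _ => 0, fun v hv => ⟨(hS v hv).trans_le hSL, Nat.zero_le _⟩,
    fun u _ v _ hw hc => absurd hc (hproper u v hw), fun v _ d => ?_⟩
  have : B.steps col (fun _ => 0) d (B.below (B.m + 1)) v = 0 :=
    Finset.card_eq_zero.2 (Finset.filter_eq_empty_iff.2 fun u _ hc => hproper u v hc.1 hc.2.1)
  omega

end BagSequence

/-! ### Positions along the paths -/

section Positions

variable {V : Type*} {H : SimpleGraph V}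

/-- Positions certify that a graph is a disjoint union of paths. -/
structure IsPathLabeling (H : SimpleGraph V) (k : ℕ) (pos : V → ℕ) : Prop where
  le : ∀ v, pos v ≤ k
  adj : ∀ u v, H.Adj u v → pos u = pos v + 1 ∨ pos v = pos u + 1
  unique : ∀ d u u' v, H.Adj u v → H.Adj u' v → StepRel d (pos u) (pos v) →
    StepRel d (pos u') (pos v) → u = u'

/-- Every edge goes up or down by one position, and steps are unique in both directions. Hence any
two vertices of a component are comparable under chains of upward steps, positions are injective on
a component and fill an interval, and adjacency means consecutive positions. -/
theorem IsPathLabeling.isDisjointUnionOfPaths {k : ℕ} {pos : V → ℕ}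
    (h : IsPathLabeling H k pos) : IsDisjointUnionOfPaths H k := by
  intro K
  let Up : V → V → Prop := fun a b => H.Adj a b ∧ pos b = pos a + 1
  have huniq : Relator.RightUnique Up := fun a b c hb hc =>
    h.unique true b c a hb.1.symm hc.1.symm hb.2 hc.2
  have huniq' : Relator.RightUnique (Function.swap Up) := fun a b c hb hc =>
    h.unique false b c a hb.1 hc.1 hb.2 hc.2
  have hle : ∀ {a b}, Relation.ReflTransGen Up a b → pos a ≤ pos b := by
    intro a b hab
    induction hab with
    | refl => exact le_rfl
    | tail _ hbc ih => have := hbc.2; omega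
  -- Induction along a walk. When the first edge and the known chain leave the same vertex in the
  -- same direction, uniqueness of steps makes one of them a prefix of the other.
  have hcomp : ∀ u v, H.Reachable u v →
      Relation.ReflTransGen Up u v ∨ Relation.ReflTransGen Up v u := by
    rintro u v ⟨w⟩
    induction w with
    | nil => exact .inl .refl
    | @cons a b c hab _ ih =>
      rcases h.adj a b hab with hp | hp
      · have hba : Up b a := ⟨hab.symm, hp⟩
        rcases ih with ih | ih
        · exact Relation.ReflTransGen.total_of_right_unique huniq (.single hba) ih
        · exact .inr (ih.tail hba)
      · have hba : Up a b := ⟨hab, hp⟩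
        rcases ih with ih | ih
        · exact .inl (.head hba ih)
        · have := Relation.ReflTransGen.total_of_right_unique huniq'
            (Relation.ReflTransGen.single (r := Function.swap Up) hba)
            (Relation.reflTransGen_swap.2 ih)
          rcases this with hc | hc
          · exact .inr (Relation.reflTransGen_swap.1 hc)
          · exact .inl (Relation.reflTransGen_swap.1 hc)
  have heq : ∀ {a b}, Relation.ReflTransGen Up a b → pos a = pos b → a = b := by
    intro a b hab hp
    rcases Relation.ReflTransGen.cases_head hab with rfl | ⟨c, hac, hcb⟩
    · rfl
    · have := hle hcb; have := hac.2; omega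
  have hstep : ∀ {a b}, Relation.ReflTransGen Up a b → pos b = pos a + 1 → H.Adj a b := by
    intro a b hab hp
    rcases Relation.ReflTransGen.cases_head hab with rfl | ⟨c, hac, hcb⟩
    · omega
    · have := hac.2
      rw [← heq hcb (by omega)]
      exact hac.1
  have hK : ∀ a b : K, H.Reachable a b := fun a b =>
    SimpleGraph.ConnectedComponent.exact (a.2.trans b.2.symm)
  obtain ⟨x0, hx0⟩ := K.nonempty_supp
  have hbetween : ∀ {a b}, Relation.ReflTransGen Up a b → ∀ n, pos a ≤ n → n ≤ pos b →
      ∃ c, pos c = n ∧ H.Reachable c b := by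
    intro a b hab
    induction hab with
    | refl => intro n h1 h2; exact ⟨a, by omega, .refl _⟩
    | @tail b c _ hbc ih =>
      intro n h1 h2
      have := hbc.2
      rcases h2.lt_or_eq with h2 | rfl
      · obtain ⟨x, hx, hxr⟩ := ih n h1 (by omega)
        exact ⟨x, hx, hxr.trans hbc.1.reachable⟩
      · exact ⟨c, rfl, .refl _⟩
  -- The component is not known to be finite; its positions are, being bounded by `k`.
  have hfin : (Set.range fun a : K => pos a).Finite :=
    (Set.finite_Iic k).subset (by rintro _ ⟨a, rfl⟩; exact h.le a)
  have hne : (Set.range fun a : K => pos a).Nonempty := ⟨_, ⟨x0, hx0⟩, rfl⟩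
  obtain ⟨_, ⟨lo, rfl⟩, hlo⟩ := Set.exists_min_image _ id hfin hne
  obtain ⟨_, ⟨hi, rfl⟩, hhi⟩ := Set.exists_max_image _ id hfin hne
  have hlo' : ∀ a : K, pos lo ≤ pos a := fun a => hlo _ ⟨a, rfl⟩
  have hhi' : ∀ a : K, pos a ≤ pos hi := fun a => hhi _ ⟨a, rfl⟩
  have hinj : ∀ a b : K, pos a = pos b → a = b := by
    intro a b hab
    rcases hcomp a b (hK a b) with hc | hc
    · exact Subtype.ext (heq hc hab)
    · exact Subtype.ext (heq hc hab.symm).symm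
  refine ⟨pos hi - pos lo, (Nat.sub_le _ _).trans (h.le hi), ⟨?_⟩⟩
  have hbij : Function.Bijective fun a : K =>
      (⟨pos a - pos lo, by have := hhi' a; omega⟩ : Fin (pos hi - pos lo + 1)) := by
    constructor
    · intro a b hab
      simp only [Fin.mk.injEq] at hab
      have := hlo' a
      have := hlo' b
      exact hinj a b (by omega)
    -- Surjectivity: the upward chain from a lowest to a highest vertex passes through every
    -- position in between.
    · rintro ⟨n, hn⟩
      have hlh : Relation.ReflTransGen Up (lo : V) hi := by
        rcases hcomp lo hi (hK lo hi) with hc | hc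
        · exact hc
        · have h1 := hle hc
          have h2 : pos lo ≤ pos hi := hlo' hi
          rw [heq hc (le_antisymm h1 h2)]
      have hlohi : pos lo ≤ pos hi := hlo' hi
      obtain ⟨c, hc, hcr⟩ := hbetween hlh (pos lo + n) (by omega) (by omega)
      refine ⟨⟨c, (SimpleGraph.ConnectedComponent.sound hcr).trans hi.2⟩, ?_⟩
      simp [hc]
  refine ⟨Equiv.ofBijective _ hbij, ?_⟩
  intro a b
  change _ ↔ H.Adj (a : V) (b : V)
  simp only [Equiv.ofBijective_apply, SimpleGraph.pathGraph_adj]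
  have ha := hlo' a
  have hb := hlo' b
  constructor
  · rintro (hab | hab)
    · rcases hcomp a b (hK a b) with hc | hc
      · exact hstep hc (by omega)
      · have := hle hc; omega
    · rcases hcomp a b (hK a b) with hc | hc
      · have := hle hc; omega
      · exact (hstep hc (by omega)).symm
  · intro hab
    rcases h.adj a b hab with hp | hp
    · right; omega
    · left; omega

/-- Each component inherits its positions from the chosen isomorphism with a path graph; two
neighbors on the same side of `v` have the same image and therefore coincide. -/
theorem IsDisjointUnionOfPaths.exists_labeling {k : ℕ} (h : IsDisjointUnionOfPaths H k) :
    ∃ pos, IsPathLabeling H k pos := by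
  choose p hp e using h
  let pos : V → ℕ := fun v => ((e (H.connectedComponentMk v)).some ⟨v, rfl⟩ : Fin _)
  have hpos : ∀ (K : H.ConnectedComponent) (v : K), pos v = ((e K).some v : Fin _) := by
    rintro _ ⟨v, rfl⟩
    rfl
  have hadj : ∀ u v, H.Adj u v → pos u = pos v + 1 ∨ pos v = pos u + 1 := by
    intro u v huv
    let K := H.connectedComponentMk v
    have hu : H.connectedComponentMk u = K := SimpleGraph.ConnectedComponent.sound huv.reachable
    have h1 := (e K).some.map_rel_iff (a := ⟨u, hu⟩) (b := ⟨v, rfl⟩)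
    have h2 := h1.2 huv
    rw [SimpleGraph.pathGraph_adj, ← hpos, ← hpos] at h2
    tauto
  refine ⟨pos, fun v => ?_, hadj, fun d u u' v hu hu' h1 h2 => ?_⟩
  · have := ((e (H.connectedComponentMk v)).some ⟨v, rfl⟩).2
    have := hp (H.connectedComponentMk v)
    simp only [pos]
    omega
  · let K := H.connectedComponentMk v
    have ku : H.connectedComponentMk u = K := SimpleGraph.ConnectedComponent.sound hu.reachable
    have ku' : H.connectedComponentMk u' = K := SimpleGraph.ConnectedComponent.sound hu'.reachable
    have hpp : pos u = pos u' := by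
      cases d <;> simp [StepRel] at h1 h2 <;> omega
    rw [hpos K ⟨u, ku⟩, hpos K ⟨u', ku'⟩] at hpp
    exact congrArg Subtype.val ((e K).some.injective (Fin.ext hpp))

end Positions

/-- A coloring with positions certifies a path coloring. -/
theorem pathColorable_iff_exists_pos {V : Type*} (G : SimpleGraph V) (F : Set (Sym2 V)) (k L : ℕ) :
    PathColorable G F k L ↔ ∃ (c : V → Fin L) (pos : V → ℕ), (∀ v, pos v ≤ k) ∧
      (∀ u v, G.Adj u v → c u = c v →
        s(u, v) ∈ F ∧ (pos u = pos v + 1 ∨ pos v = pos u + 1)) ∧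
      ∀ d u u' v, G.Adj u v → G.Adj u' v → c u = c v → c u' = c v → StepRel d (pos u) (pos v) →
        StepRel d (pos u') (pos v) → u = u' := by
  constructor
  · rintro ⟨c, hc⟩
    choose pos hpos using fun a => (hc a).1.exists_labeling
    have key : ∀ a u (hu : c u = a), pos (c u) ⟨u, rfl⟩ = pos a ⟨u, hu⟩ := by
      rintro _ u rfl; rfl
    refine ⟨c, fun v => pos (c v) ⟨v, rfl⟩, fun v => (hpos _).le _, fun u v huv huc => ?_, ?_⟩
    · refine ⟨(hc (c v)).2 u v huc rfl huv, ?_⟩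
      simp only [key (c v) u huc]
      exact (hpos (c v)).adj ⟨u, huc⟩ ⟨v, rfl⟩ huv
    · intro d u u' v hu hu' huc huc' h1 h2
      simp only [key (c v) u huc] at h1
      simp only [key (c v) u' huc'] at h2
      simpa using (hpos (c v)).unique d ⟨u, huc⟩ ⟨u', huc'⟩ ⟨v, rfl⟩ hu hu' h1 h2
  · rintro ⟨c, pos, hk, hadj, huniq⟩
    refine ⟨c, fun a => ⟨IsPathLabeling.isDisjointUnionOfPaths (pos := fun v => pos v)
      ⟨fun v => hk v, ?_, ?_⟩, fun u v hu hv huv => (hadj u v huv (hu.trans hv.symm)).1⟩⟩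
    · rintro ⟨u, hu⟩ ⟨v, hv⟩ huv
      exact (hadj u v huv (Eq.trans hu (Eq.symm hv))).2
    · rintro d ⟨u, hu⟩ ⟨u', hu'⟩ ⟨v, hv⟩ h1 h2 h3 h4
      exact Subtype.ext (huniq d u u' v h1 h2 (Eq.trans hu (Eq.symm hv))
        (Eq.trans hu' (Eq.symm hv)) h3 h4)

/-! ### From a rooted tree decomposition to a sequence of bags -/

open Classical in
/-- Zero for a pair which is no edge, one for an edge outside of `F`, two for an edge in `F`. -/
noncomputable def edgeWeight {n : ℕ} (G : SimpleGraph (Fin n)) (F : Set (Sym2 (Fin n)))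
    (u v : ℕ) : ℕ :=
  if h : u < n ∧ v < n then
    if G.Adj ⟨u, h.1⟩ ⟨v, h.2⟩ then
      if s(⟨u, h.1⟩, ⟨v, h.2⟩) ∈ F then 2 else 1
    else 0
  else 0

section EdgeWeight

variable {n : ℕ} {G : SimpleGraph (Fin n)} {F : Set (Sym2 (Fin n))}

theorem edgeWeight_coe_ne_zero {u v : Fin n} : edgeWeight G F u v ≠ 0 ↔ G.Adj u v := by
  simp only [edgeWeight, u.2, v.2, and_self, dite_true, Fin.eta]
  split_ifs <;> simp_all

theorem two_le_edgeWeight_coe {u v : Fin n} :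
    2 ≤ edgeWeight G F u v ↔ G.Adj u v ∧ s(u, v) ∈ F := by
  simp only [edgeWeight, u.2, v.2, and_self, dite_true, Fin.eta]
  split_ifs <;> simp_all

theorem edgeWeight_symm (u v : ℕ) : edgeWeight G F u v = edgeWeight G F v u := by
  unfold edgeWeight
  by_cases h : u < n ∧ v < n
  · rw [dif_pos h, dif_pos h.symm]
    classical exact if_congr (G.adj_comm _ _) (by rw [Sym2.eq_swap]) rfl
  · rw [dif_neg h, dif_neg (fun h' => h h'.symm)]

theorem edgeWeight_self (u : ℕ) : edgeWeight G F u u = 0 := by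
  simp [edgeWeight]

theorem lt_of_edgeWeight_ne_zero {u v : ℕ} (h : edgeWeight G F u v ≠ 0) : u < n ∧ v < n := by
  by_contra hc
  exact h (dif_neg hc)

/-- Weight at least two encodes an edge in `F`, and a count of at most one encodes uniqueness of the
next vertex in each direction. -/
theorem BagSequence.certified_iff_pathColorable {B : BagSequence}
    (hw : B.weight = edgeWeight G F) (hb : ∀ v, v ∈ B.below (B.m + 1) ↔ v < n) {L k : ℕ} :
    B.Certified L k ↔ PathColorable G F k L := by
  rw [pathColorable_iff_exists_pos]
  constructor
  · rintro ⟨col, pos, hbd, hgood, hsteps⟩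
    have hv : ∀ v : Fin n, (v : ℕ) ∈ B.below (B.m + 1) := fun v => (hb v).2 v.2
    refine ⟨fun v => ⟨col v, (hbd v (hv v)).1⟩, fun v => pos v, fun v => (hbd v (hv v)).2,
      fun u v huv hc => ?_, fun d u u' v hu hu' hc hc' h1 h2 => ?_⟩
    · have := hgood u (hv u) v (hv v) (by rw [hw]; exact edgeWeight_coe_ne_zero.2 huv)
        (by simpa using hc)
      rw [hw] at this
      exact ⟨(two_le_edgeWeight_coe.1 this.1).2, this.2⟩
    · have := Finset.card_le_one.1 (hsteps v (hv v) d) u (by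
        rw [Finset.mem_filter, hw]
        exact ⟨hv u, edgeWeight_coe_ne_zero.2 hu, by simpa using hc, h1⟩) u' (by
        rw [Finset.mem_filter, hw]
        exact ⟨hv u', edgeWeight_coe_ne_zero.2 hu', by simpa using hc', h2⟩)
      exact Fin.ext this
  · rintro ⟨c, pos, hk, hadj, huniq⟩
    refine ⟨fun v => if h : v < n then c ⟨v, h⟩ else 0, fun v => if h : v < n then pos ⟨v, h⟩ else 0,
      fun v hv => ?_, fun u hu v hv huv hc => ?_, fun v hv d => ?_⟩
    · rw [hb] at hv
      simp only [dif_pos hv]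
      exact ⟨(c _).2, hk _⟩
    · rw [hb] at hu hv
      lift u to Fin n using hu
      lift v to Fin n using hv
      rw [hw] at huv ⊢
      rw [edgeWeight_coe_ne_zero] at huv
      simp only [Fin.is_lt, dite_true, Fin.eta] at hc ⊢
      have := hadj u v huv (Fin.ext hc)
      exact ⟨two_le_edgeWeight_coe.2 ⟨huv, this.1⟩, this.2⟩
    · rw [hb] at hv
      lift v to Fin n using hv
      refine Finset.card_le_one.2 fun u hu u' hu' => ?_
      rw [Finset.mem_filter, hb, hw] at hu hu'
      obtain ⟨hu, h1, h2, h3⟩ := hu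
      obtain ⟨hu', h1', h2', h3'⟩ := hu'
      lift u to Fin n using hu
      lift u' to Fin n using hu'
      rw [edgeWeight_coe_ne_zero] at h1 h1'
      simp only [Fin.is_lt, dite_true, Fin.eta] at h2 h3 h2' h3'
      rw [huniq d u u' v h1 h1' (Fin.ext h2) (Fin.ext h2') h3 h3']

end EdgeWeight

/-! ### Parents in the rooted tree and orders with parents first -/

namespace RootedTreeDecomposition

variable {V ι : Type*} {G : SimpleGraph V} (D : RootedTreeDecomposition G ι)

/-- Geodesics from the root to two parents extend to geodesics to `j`. These are paths between the
same ends of a tree, hence equal, and the parents are their penultimate vertices. -/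
theorem parent_unique {i i' j : ι} (h : j ∈ D.children i) (h' : j ∈ D.children i') : i = i' := by
  obtain ⟨p, -, hpl⟩ := D.isTree.connected.exists_path_of_dist D.root i
  obtain ⟨p', -, hpl'⟩ := D.isTree.connected.exists_path_of_dist D.root i'
  have h1 := (p.concat h.1).isPath_of_length_eq_dist (by
    rw [SimpleGraph.Walk.length_concat, hpl]; exact h.2.symm)
  have h2 := (p'.concat h'.1).isPath_of_length_eq_dist (by
    rw [SimpleGraph.Walk.length_concat, hpl']; exact h'.2.symm)
  have := (D.isTree.isAcyclic.subsingleton_path D.root j).elim ⟨_, h1⟩ ⟨_, h2⟩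
  have h3 := congrArg SimpleGraph.Walk.penultimate (Subtype.mk.inj this)
  simpa using h3

theorem adj_cases {i j : ι} (h : D.tree.Adj i j) : j ∈ D.children i ∨ i ∈ D.children j := by
  rcases D.isTree.dist_eq_dist_add_one_of_adj D.root h with h' | h'
  · exact .inr ⟨h.symm, h'⟩
  · exact .inl ⟨h, h'⟩

theorem root_not_mem_children (i : ι) : D.root ∉ D.children i := fun h => by
  have := h.2
  simp at this

theorem exists_parent {j : ι} (h : j ≠ D.root) : ∃ i, j ∈ D.children i := by
  obtain ⟨p, hp, hpl⟩ := D.isTree.connected.exists_path_of_dist j D.root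
  cases p with
  | nil => exact absurd rfl h
  | @cons _ i _ hij p =>
    refine ⟨i, hij.symm, ?_⟩
    have h1 := SimpleGraph.dist_le p
    rw [SimpleGraph.Walk.length_cons, D.tree.dist_comm] at hpl
    rw [D.tree.dist_comm] at h1
    rcases D.isTree.dist_eq_dist_add_one_of_adj D.root hij with h' | h'
    · exact h'
    · omega

/-- A set of nodes which contains the root and all children of its members is everything. -/
theorem mem_of_closed {s : Set ι} (hr : D.root ∈ s) (hs : ∀ i ∈ s, D.children i ⊆ s) (i : ι) :
    i ∈ s := by
  induction hd : D.tree.dist D.root i generalizing i with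
  | zero =>
    rw [(D.isTree.connected.dist_eq_zero_iff).1 hd] at hr
    exact hr
  | succ d ih =>
    have hne : i ≠ D.root := by
      rintro rfl
      simp at hd
    obtain ⟨j, hj⟩ := D.exists_parent hne
    exact hs j (ih j (by have := hj.2; omega)) hj

/-- `q` lists the nodes with the root first and parents before children; the parent of the node at
place `a` is at place `par (a + 1) - 1`. -/
structure IsOrder (q : List ι) (par : ℕ → ℕ) : Prop where
  nodup : q.Nodup
  mem : ∀ i, i ∈ q
  root : q[0]? = some D.root
  par_one : par 1 = 0
  par_eq : ∀ a < q.length, 0 < a → ∃ b < a, par (a + 1) = b + 1 ∧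
    ∃ i j, q[b]? = some i ∧ q[a]? = some j ∧ j ∈ D.children i

variable {D}

/-- This is running intersection. The node `r` precedes `j` and so is not a descendant of `j`; the
connected set of nodes whose bags contain `v` must leave the descendants of `j`, and the only way
out is the edge from `j` to its parent. -/
theorem IsOrder.mem_bag_parent {q : List ι} {par : ℕ → ℕ} (h : D.IsOrder q par) {a b c : ℕ}
    {i j r : ι} (hab : b < a) (hj : q[a]? = some j) (hr : q[b]? = some r) (hc : par (a + 1) = c + 1)
    (hi : q[c]? = some i) {v : V} (hvj : v ∈ D.bag j) (hvr : v ∈ D.bag r) : v ∈ D.bag i := by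
  have hinj : ∀ {a b : ℕ} {i : ι}, q[a]? = some i → q[b]? = some i → a = b := fun h1 h2 => by
    obtain ⟨h3, h3'⟩ := List.getElem?_eq_some_iff.1 h1
    obtain ⟨h4, h4'⟩ := List.getElem?_eq_some_iff.1 h2
    exact h.nodup.getElem_inj_iff.1 (h3'.trans h4'.symm)
  -- children come after their parents
  have hchild : ∀ {a b : ℕ} {i j : ι}, q[a]? = some i → q[b]? = some j → j ∈ D.children i →
      a < b := by
    intro a b i j ha hb hij
    rcases Nat.eq_zero_or_pos b with rfl | hb0
    · rw [h.root, Option.some_inj] at hb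
      subst hb
      exact absurd hij (D.root_not_mem_children i)
    · obtain ⟨h3, -⟩ := List.getElem?_eq_some_iff.1 hb
      obtain ⟨c, hcb, -, i', j', hi', hj', hij'⟩ := h.par_eq b h3 hb0
      rw [hb, Option.some_inj] at hj'
      subst hj'
      rw [D.parent_unique hij hij'] at ha
      rw [hinj ha hi']
      exact hcb
  let R : ι → ι → Prop := fun x y => y ∈ D.children x
  have hdesc : ∀ x, Relation.ReflTransGen R j x → ∀ e, q[e]? = some x → a ≤ e := by
    intro x hx
    induction hx with
    | refl => intro e he; exact (hinj hj he).le
    | @tail y z _ hyz ih =>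
      intro e he
      obtain ⟨f, hf⟩ := List.mem_iff_getElem?.1 (h.mem y)
      exact (ih f hf).trans (hchild hf he hyz).le
  obtain ⟨h3, -⟩ := List.getElem?_eq_some_iff.1 hj
  obtain ⟨c', -, hc', i', j', hi', hj', hij'⟩ := h.par_eq a h3 (by omega)
  obtain rfl : c = c' := by omega
  rw [hj, Option.some_inj] at hj'
  rw [hi, Option.some_inj] at hi'
  subst hj' hi'
  obtain ⟨w⟩ := (D.connected_bags v).preconnected ⟨j, hvj⟩ ⟨r, hvr⟩
  -- The dart where the walk leaves the descendants of `j` goes upward; unless it starts at `j`, the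
  -- parent reached would still be a descendant.
  obtain ⟨d, -, hd1, hd2⟩ := w.exists_boundary_dart {x | Relation.ReflTransGen R j x}
    Relation.ReflTransGen.refl (fun hx => by have := hdesc r hx b hr; omega)
  have hadj : D.tree.Adj d.fst d.snd := d.adj
  rcases D.adj_cases hadj with hx | hx
  · exact absurd (Relation.ReflTransGen.tail hd1 hx) hd2
  · rcases Relation.ReflTransGen.cases_tail hd1 with hy | ⟨y, hy, hy'⟩
    · rw [hy] at hx
      rw [D.parent_unique hij' hx]
      exact d.snd.2
    · have := D.parent_unique hx hy'
      exact absurd (show Relation.ReflTransGen R j d.snd from this ▸ hy) hd2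

end RootedTreeDecomposition

/-! ### The bag sequence of a listed decomposition -/

namespace Listing

variable {n m : ℕ} {G : SimpleGraph (Fin n)} {D : RootedTreeDecomposition G (Fin m)}

/-- An empty bag followed by the bags of the nodes `q`. -/
def bagList (I : Listing G D) (q : List (Fin m)) : ℕ → List ℕ
  | 0 => []
  | h + 1 => (q[h]?.map fun i => (I.bag i).map Fin.val).getD []

variable (I : Listing G D) {q : List (Fin m)} {par : ℕ → ℕ}

theorem bagList_succ {h : ℕ} {i : Fin m} (hi : q[h]? = some i) :
    I.bagList q (h + 1) = (I.bag i).map Fin.val := by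
  simp [bagList, hi]

theorem bagList_nodup (t : ℕ) : (I.bagList q t).Nodup := by
  cases t with
  | zero => exact List.nodup_nil
  | succ h =>
    cases hi : q[h]? with
    | none => simp [bagList, hi]
    | some i =>
      rw [I.bagList_succ hi]
      exact (I.bag_nodup i).map Fin.val_injective

theorem mem_bagList {h : ℕ} {i : Fin m} (hi : q[h]? = some i) {v : Fin n} :
    (v : ℕ) ∈ I.bagList q (h + 1) ↔ v ∈ D.bag i := by
  rw [I.bagList_succ hi, List.mem_map]
  simp [Fin.val_inj, I.mem_bag]

theorem exists_of_mem_bagList {t v : ℕ} (hv : v ∈ I.bagList q t) :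
    ∃ h i, ∃ w : Fin n, t = h + 1 ∧ q[h]? = some i ∧ (w : ℕ) = v ∧ w ∈ D.bag i := by
  cases t with
  | zero => simp [bagList] at hv
  | succ h =>
    cases hi : q[h]? with
    | none => simp [bagList, hi] at hv
    | some i =>
      rw [I.bagList_succ hi, List.mem_map] at hv
      obtain ⟨w, hw, rfl⟩ := hv
      exact ⟨h, i, w, rfl, hi, rfl, (I.mem_bag i w).1 hw⟩

/-- Bags in an order with parents first have the running intersection property. -/
noncomputable def toBagSequence (F : Set (Sym2 (Fin n))) (h : D.IsOrder q par) :
    BagSequence where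
  m := m
  weight := edgeWeight G F
  len t := (I.bagList q t).length
  vert t a := (I.bagList q t).getD a 0
  par := par
  ind t v := if v ∈ I.bagList q t then (I.bagList q t).idxOf v + 1 else 0
  ind_eq t _ v a := by
    constructor
    · intro hv
      split_ifs at hv with hm
      · have ha : (I.bagList q t).idxOf v = a := by omega
        subst ha
        have hl := List.idxOf_lt_length_of_mem hm
        refine ⟨hl, ?_⟩
        rw [List.getD_eq_getElem _ _ hl, List.getElem_idxOf]
    · rintro ⟨ha, rfl⟩
      rw [List.getD_eq_getElem _ _ ha, if_pos (List.getElem_mem ha),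
        (I.bagList_nodup t).idxOf_getElem]
  weight_symm := edgeWeight_symm
  par_lt := by
    intro t ht htm
    have hl : q.length = m := by
      have := List.Nodup.length_le_card h.nodup
      have h2 := Finset.card_le_card (s := Finset.univ) (t := q.toFinset) (fun i _ => by
        simp [h.mem i])
      have h3 := List.toFinset_card_le q
      simp at this h2
      omega
    obtain ⟨a, rfl⟩ : ∃ a, t = a + 1 := ⟨t - 1, by omega⟩
    rcases Nat.eq_zero_or_pos a with rfl | ha
    · rw [h.par_one]; omega
    · obtain ⟨b, hb, hp, -⟩ := h.par_eq a (by omega) ha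
      omega
  running_intersection := by
    intro t ht htm r hr v hvt hvr
    have hvt' : v ∈ I.bagList q t := by by_contra hc; simp [hc] at hvt
    have hvr' : v ∈ I.bagList q r := by by_contra hc; simp [hc] at hvr
    obtain ⟨a, j, w, rfl, hj, rfl, hw⟩ := I.exists_of_mem_bagList hvt'
    obtain ⟨b, i, w', rfl, hi, hww, hw'⟩ := I.exists_of_mem_bagList hvr'
    obtain rfl : w' = w := Fin.ext hww
    obtain ⟨hal, -⟩ := List.getElem?_eq_some_iff.1 hj
    obtain ⟨c, -, hp, i', j', hi', -, -⟩ := h.par_eq a hal (by omega)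
    have hmem : (w' : ℕ) ∈ I.bagList q (par (a + 1)) := by
      rw [hp, I.mem_bagList hi']
      exact h.mem_bag_parent (by omega) hj hi hp hi' hw hw'
    simp [hmem]
  exists_edge_bag := by
    intro u v huv
    obtain ⟨hu, hv⟩ := lt_of_edgeWeight_ne_zero huv
    lift u to Fin n using hu
    lift v to Fin n using hv
    obtain ⟨i, hui, hvi⟩ := D.exists_edge_bag u v (edgeWeight_coe_ne_zero.1 huv)
    obtain ⟨a, ha⟩ := List.mem_iff_getElem?.1 (h.mem i)
    have hal := (List.getElem?_eq_some_iff.1 ha).1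
    have hl := List.Nodup.length_le_card h.nodup
    rw [Fintype.card_fin] at hl
    refine ⟨a + 1, by omega, ?_, ?_⟩
    · simp [(I.mem_bagList ha).2 hui]
    · simp [(I.mem_bagList ha).2 hvi]
  len_zero := rfl

theorem mem_below_toBagSequence {F : Set (Sym2 (Fin n))} (h : D.IsOrder q par) {v : ℕ} :
    v ∈ (I.toBagSequence F h).below ((I.toBagSequence F h).m + 1) ↔ v < n := by
  rw [BagSequence.mem_below]
  have hmem : ∀ t ≤ m, v ∈ (I.toBagSequence F h).bag t ↔ v ∈ I.bagList q t := by
    intro t ht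
    rw [BagSequence.mem_bag_iff_ind (B := I.toBagSequence F h) ht]
    simp [toBagSequence]
  constructor
  · rintro ⟨t, ht, hv⟩
    have ht' : t ≤ m := Nat.lt_succ_iff.1 ht
    rw [hmem t ht'] at hv
    obtain ⟨a, j, w, rfl, hj, rfl, hw⟩ := I.exists_of_mem_bagList hv
    exact w.2
  · intro hv
    lift v to Fin n using hv
    obtain ⟨i, hi⟩ := D.exists_mem_bag v
    obtain ⟨a, ha⟩ := List.mem_iff_getElem?.1 (h.mem i)
    have hal := (List.getElem?_eq_some_iff.1 ha).1
    have hl := List.Nodup.length_le_card h.nodup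
    rw [Fintype.card_fin] at hl
    refine ⟨a + 1, Nat.lt_succ_iff.2 (by change a + 1 ≤ m; omega), ?_⟩
    rw [hmem _ (by omega)]
    exact (I.mem_bagList ha).2 hi

end Listing

namespace RAM

/-! ### Programs: notation -/

abbrev vr (x : ℕ) : Expr := .var x

abbrev rd (a : ℕ) (e : Expr) : Expr := .read a e

instance : Add Expr := ⟨.add⟩

instance : Sub Expr := ⟨.sub⟩

instance (c : ℕ) : OfNat Expr c := ⟨.const c⟩

infixr:60 " ;; " => Program.seq

/-- The distance of two numbers. -/
def Expr.dist (e f : Expr) : Expr := (e - f) + (f - e)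

theorem WP.straight_seq {P P' : Program} (hP : P.loopFree = true) {s : Store} {T T' : ℕ}
    (hT : P.straightCost ≤ T) {Q : Store → Prop} (h : Frame P s (P.straight s) →
      WP P' (P.straight s) T' Q) : WP (P ;; P') s (T + T') Q :=
  (WP.straight hP s hT (Q := fun s' => s' = P.straight s) rfl).seq fun s' hF hs' => by
    subst hs'
    exact h hF

theorem Expr.eval_vr (s : Store) (x : ℕ) : (vr x).eval s = s.var x := rfl

theorem Expr.eval_rd (s : Store) (a : ℕ) (e : Expr) : (rd a e).eval s = s.arr a (e.eval s) := rfl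

theorem Expr.eval_add (s : Store) (e f : Expr) : (e + f).eval s = e.eval s + f.eval s := rfl

theorem Expr.eval_sub (s : Store) (e f : Expr) : (e - f).eval s = e.eval s - f.eval s := rfl

theorem Expr.eval_zero (s : Store) : (0 : Expr).eval s = 0 := rfl

theorem Expr.eval_one (s : Store) : (1 : Expr).eval s = 1 := rfl

theorem Expr.eval_two (s : Store) : (2 : Expr).eval s = 2 := rfl

theorem Expr.eval_dist (s : Store) (e f : Expr) :
    (e.dist f).eval s = (e.eval s - f.eval s) + (f.eval s - e.eval s) := rfl

/-! ### The program -/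

/-- Checks the first condition of `BagSequence.Compat`. -/
def checkParent : Program :=
  forLoop 27 (rd 3 (rd 11 (vr 21)))
    (.assign 31 (vr 22 + rd 19 (vr 27)) ;;
    .assign 32 (vr 23 + rd 19 (vr 27)) ;;
    .assign 26 (vr 26 + (rd 15 (vr 31)).dist (rd 15 (vr 32)) +
      (rd 16 (vr 31)).dist (rd 16 (vr 32)) + (rd 17 (vr 32) - rd 17 (vr 31)) +
      (rd 18 (vr 32) - rd 18 (vr 31))))

/-- Examines all neighbors of a vertex in its bag. -/
def checkNeighbors : Program :=
  forLoop 28 (rd 3 (rd 11 (vr 20)))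
    (.assign 30 (rd 4 (rd 8 (rd 11 (vr 20)) + vr 28)) ;;
    .assign 32 (vr 24 + rd 19 (vr 28)) ;;
    .branch (rd 10 (rd 9 (vr 30) + vr 29))
      (.branch ((rd 15 (vr 32)).dist (rd 15 (vr 31))) .skip
        (.assign 26 (vr 26 + (2 - rd 10 (rd 9 (vr 30) + vr 29)) +
          ((rd 16 (vr 32)).dist (rd 16 (vr 31))).dist 1) ;;
        .branch ((1 - vr 37) + (1 - rd 14 (rd 9 (vr 21) + vr 30)))
          (.assign 35 (vr 35 + (1 - (rd 16 (vr 32)).dist (rd 16 (vr 31) + 1))) ;;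
          .assign 36 (vr 36 + (1 - (rd 16 (vr 31)).dist (rd 16 (vr 32) + 1))))
          .skip))
      .skip)

/-- Checks the other conditions of `BagSequence.Compat`. -/
def checkChild : Program :=
  forLoop 27 (rd 3 (rd 11 (vr 20)))
    ((.assign 29 (rd 4 (rd 8 (rd 11 (vr 20)) + vr 27)) ;;
    .assign 31 (vr 24 + rd 19 (vr 27)) ;;
    .assign 35 (rd 17 (vr 31)) ;;
    .assign 36 (rd 18 (vr 31)) ;;
    .assign 37 (rd 14 (rd 9 (vr 21) + vr 29))) ;;
    checkNeighbors ;;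
    .branch (vr 37)
      (.assign 33 (vr 22 + rd 19 (vr 37 - 1)) ;;
      .assign 34 (vr 23 + rd 19 (vr 37 - 1)) ;;
      .assign 26 (vr 26 + (rd 15 (vr 31)).dist (rd 15 (vr 33)) +
        (rd 16 (vr 31)).dist (rd 16 (vr 33)) +
        (vr 35 + rd 17 (vr 34) - rd 17 (vr 33)) + (vr 36 + rd 18 (vr 34) - rd 18 (vr 33))))
      (.assign 26 (vr 26 + (vr 35 - 1) + (vr 36 - 1))))

/-- Records in `var 25` whether the states `var 23` and `var 24` merge into the state `var 22`. -/
def mergeTest : Program :=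
  .branch (rd 20 (rd 19 (vr 21) + vr 23) + rd 20 (rd 19 (vr 20) + vr 24)) .skip
    (.assign 26 0 ;; checkParent ;; checkChild ;; .branch (vr 26) .skip (.assign 25 0))

/-- Computes the new table of the parent `var 21` after merging the child `var 20`. -/
def mergeTable : Program :=
  forLoop 22 (vr 9)
    (.assign 25 1 ;; forLoop 23 (vr 9) (forLoop 24 (vr 9) mergeTest) ;; .write 21 (vr 22) (vr 25))

/-- Stores the new table of the parent `var 21`. -/
def copyTable : Program :=
  forLoop 22 (vr 9) (.write 20 (rd 19 (vr 21) + vr 22) (rd 21 (vr 22)))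

/-- Merges all bags into their parents, the last bag first. -/
def mergeAll : Program :=
  forLoop 38 (vr 1)
    ((.assign 20 (vr 1 - vr 38) ;; .assign 21 (rd 12 (vr 20))) ;; mergeTable ;; copyTable)

/-- Looks for a feasible state of the first bag. -/
def readAnswer : Program :=
  .assign 0 0 ;; forLoop 22 (vr 9) (.branch (rd 20 (rd 19 0 + vr 22)) .skip (.assign 0 1))

/-! ### Correctness of the merging -/

/-- The memory holds a sequence of bags and the states. -/
structure Ready (B : BagSequence) {N S L k : ℕ} (E : StateCode N S L k) (s : Store) : Prop where
  num : s.var 1 = B.m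
  codes : s.var 9 = N
  len_le : ∀ t ≤ B.m, B.len t ≤ S
  len : ∀ t ≤ B.m, s.arr 3 (s.arr 11 t) = B.len t
  vert : ∀ t ≤ B.m, ∀ a < B.len t, s.arr 4 (s.arr 8 (s.arr 11 t) + a) = B.vert t a
  weight : ∀ t ≤ B.m, ∀ a < B.len t, ∀ b < B.len t,
    s.arr 10 (s.arr 9 (B.vert t b) + B.vert t a) = B.weight (B.vert t b) (B.vert t a)
  ind : ∀ t ≤ B.m, ∀ t' ≤ B.m, ∀ a < B.len t,
    s.arr 14 (s.arr 9 t' + B.vert t a) = B.ind t' (B.vert t a)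
  par : ∀ h, 1 ≤ h → h ≤ B.m → s.arr 12 h = B.par h
  stride : ∀ i < S + B.m + 1, s.arr 19 i = i * N
  col : ∀ X < N, ∀ a < S, s.arr 15 (X + a * N) = E.col X a
  pos : ∀ X < N, ∀ a < S, s.arr 16 (X + a * N) = E.pos X a
  flag_true : ∀ X < N, ∀ a < S, s.arr 17 (X + a * N) = E.flag true X a
  flag_false : ∀ X < N, ∀ a < S, s.arr 18 (X + a * N) = E.flag false X a

theorem Ready.congr {B : BagSequence} {N S L k : ℕ} {E : StateCode N S L k} {s s' : Store}
    (h : Ready B E s) (hv1 : s'.var 1 = s.var 1) (hv9 : s'.var 9 = s.var 9)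
    (ha : ∀ a < 20, s'.arr a = s.arr a) : Ready B E s' := by
  obtain ⟨h1, h2, h3, h4, h5, h6, h7, h8, h9, h10, h11, h12, h13⟩ := h
  constructor
  all_goals
    try simp only [hv1, hv9, ha 3 (by decide), ha 4 (by decide), ha 8 (by decide),
      ha 9 (by decide), ha 10 (by decide), ha 11 (by decide), ha 12 (by decide),
      ha 14 (by decide), ha 15 (by decide), ha 16 (by decide), ha 17 (by decide),
      ha 18 (by decide), ha 19 (by decide)]
    assumption

theorem Frame.arr_eq {P : Program} {s s' : Store} (h : Frame P s s') (hP : P.modA = []) :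
    s'.arr = s.arr :=
  funext fun a => h.arr a (by simp [hP])

theorem card_filter_range_succ (P : ℕ → Prop) [DecidablePred P] (j : ℕ) :
    ((Finset.range (j + 1)).filter P).card =
      ((Finset.range j).filter P).card + if P j then 1 else 0 := by
  simp only [Finset.card_filter, Finset.sum_range_succ]

theorem forall_lt_succ_iff {P : ℕ → Prop} {j : ℕ} :
    (∀ b < j + 1, P b) ↔ (∀ b < j, P b) ∧ P j := by
  simp only [Nat.lt_succ_iff_lt_or_eq, or_imp, forall_and, forall_eq]

section

variable {B : BagSequence} {N S L k : ℕ} {E : StateCode N S L k} {s : Store}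

/-- Throughout the merging, variables `20` and `21` hold the child and parent bags, and `22`, `23`,
`24` the states `X`, `Y`, `Z`. Variable `26` accumulates defects, each a truncated difference that
vanishes exactly when its condition holds. -/
theorem checkParent_spec (hR : Ready B E s) {p X Y : ℕ} (hp : p ≤ B.m) (hX : X < N) (hY : Y < N)
    (h21 : s.var 21 = p) (h22 : s.var 22 = X) (h23 : s.var 23 = Y) :
    WP checkParent s ((B.len p + 1) * 100) (fun s' => s'.var 26 = 0 ↔ s.var 26 = 0 ∧
      ∀ a < B.len p, E.col X a = E.col Y a ∧ E.pos X a = E.pos Y a ∧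
        ∀ d, E.flag d Y a ≤ E.flag d X a) := by
  have hb : (rd 3 (rd 11 (vr 21))).eval s = B.len p := by
    simp only [Expr.eval_rd, Expr.eval_vr, h21, hR.len p hp]
  refine (WP.forLoop (t := 80) (by decide) (fun j s' => s'.var 26 = 0 ↔ s.var 26 = 0 ∧
      ∀ a < j, E.col X a = E.col Y a ∧ E.pos X a = E.pos Y a ∧
        ∀ d, E.flag d Y a ≤ E.flag d X a) ?_ ?_).mono ?_ ?_
  · simp
  · intro i s' hi hF hi' hI
    rw [hb] at hi
    have := hR.len_le p hp
    refine WP.straight (by decide) _ (by decide) ?_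
    have h22' : s'.var 22 = X := (hF.var 22 (by decide)).trans h22
    have h23' : s'.var 23 = Y := (hF.var 23 (by decide)).trans h23
    have harr : s'.arr = s.arr := hF.arr_eq rfl
    simp only [Program.straight, Expr.eval_rd, Expr.eval_vr, Expr.eval_add, Expr.eval_sub,
      Expr.eval_dist, Store.setVar_var, Store.setVar_arr, harr, hi', h22', h23', if_true,
      hR.stride i (by omega), hR.col X hX i (by omega), hR.col Y hY i (by omega),
      hR.pos X hX i (by omega), hR.pos Y hY i (by omega), hR.flag_true X hX i (by omega),
      hR.flag_true Y hY i (by omega), hR.flag_false X hX i (by omega),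
      hR.flag_false Y hY i (by omega), forall_lt_succ_iff, Bool.forall_bool, Nat.reduceEqDiff,
      if_false]
    simp only [Bool.forall_bool] at hI
    rw [← and_assoc, ← hI]
    omega
  · rw [hb]
    exact Nat.mul_le_mul_left _ (by decide)
  · intro s' _ h
    rwa [hb] at h

end

end RAM

namespace RAM

section

variable {B : BagSequence} {N S L k : ℕ} {E : StateCode N S L k} {s : Store}

/-- One pass over the bag checks the pairs at the place `a` and adds the two counts of steps to
variables `35` and `36`, which the caller presets to the flags of `Z`. Variable `37` is zero exactly
when the vertex is private. -/
theorem checkNeighbors_spec (hR : Ready B E s) {h p Z a : ℕ} (hh : h ≤ B.m) (hp : p ≤ B.m)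
    (hZ : Z < N) (ha : a < B.len h) (h20 : s.var 20 = h) (h21 : s.var 21 = p) (h24 : s.var 24 = Z)
    (h29 : s.var 29 = B.vert h a) (h31 : s.var 31 = Z + a * N)
    (h37 : s.var 37 = B.ind p (B.vert h a)) :
    WP checkNeighbors s ((B.len h + 1) * 200) (fun s' =>
      (s'.var 26 = 0 ↔ s.var 26 = 0 ∧ ∀ b < B.len h,
        B.weight (B.vert h b) (B.vert h a) ≠ 0 → E.col Z b = E.col Z a →
          2 ≤ B.weight (B.vert h b) (B.vert h a) ∧
          (E.pos Z b = E.pos Z a + 1 ∨ E.pos Z a = E.pos Z b + 1)) ∧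
      s'.var 35 = s.var 35 + B.codeSteps E h p true Z a ∧
      s'.var 36 = s.var 36 + B.codeSteps E h p false Z a) := by
  have hb : (rd 3 (rd 11 (vr 20))).eval s = B.len h := by
    simp only [Expr.eval_rd, Expr.eval_vr, h20, hR.len h hh]
  have hlen := hR.len_le h hh
  -- The part of `codeSteps` contributed by the first `j` places, which makes the count a loop
  -- invariant.
  let cnt : Bool → ℕ → ℕ := fun d j => ((Finset.range j).filter fun b =>
    B.weight (B.vert h b) (B.vert h a) ≠ 0 ∧ E.col Z b = E.col Z a ∧
    (B.ind p (B.vert h a) = 0 ∨ B.ind p (B.vert h b) = 0) ∧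
    StepRel d (E.pos Z b) (E.pos Z a)).card
  refine (WP.forLoop (t := 180) (by decide) (fun j s' => (s'.var 26 = 0 ↔ s.var 26 = 0 ∧
      ∀ b < j, B.weight (B.vert h b) (B.vert h a) ≠ 0 → E.col Z b = E.col Z a →
          2 ≤ B.weight (B.vert h b) (B.vert h a) ∧
          (E.pos Z b = E.pos Z a + 1 ∨ E.pos Z a = E.pos Z b + 1)) ∧
      s'.var 35 = s.var 35 + cnt true j ∧ s'.var 36 = s.var 36 + cnt false j) ?_ ?_).mono ?_ ?_
  · simp [cnt]
  · intro i s' hi hF hi' hI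
    rw [hb] at hi
    refine WP.straight (by decide) _ (by decide) ?_
    have h20' : s'.var 20 = h := (hF.var 20 (by decide)).trans h20
    have h21' : s'.var 21 = p := (hF.var 21 (by decide)).trans h21
    have h24' : s'.var 24 = Z := (hF.var 24 (by decide)).trans h24
    have h29' : s'.var 29 = B.vert h a := (hF.var 29 (by decide)).trans h29
    have h31' : s'.var 31 = Z + a * N := (hF.var 31 (by decide)).trans h31
    have h37' : s'.var 37 = B.ind p (B.vert h a) := (hF.var 37 (by decide)).trans h37
    have harr : s'.arr = s.arr := hF.arr_eq rfl
    obtain ⟨hI1, hI2, hI3⟩ := hI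
    simp only [forall_lt_succ_iff]
    rw [← and_assoc (a := s.var 26 = 0), ← hI1]
    simp only [cnt, card_filter_range_succ]
    simp only [Program.straight, Expr.eval_rd, Expr.eval_vr, Expr.eval_add, Expr.eval_sub,
      Expr.eval_dist, Expr.eval_one, Expr.eval_two, apply_ite Store.var, ite_apply,
      Store.setVar_var, harr, hi', h20', h21', h24',
      h29', h31', h37', if_true, Store.setVar_arr,
      hR.stride i (by omega), hR.col Z hZ i (by omega), hR.col Z hZ a (by omega),
      hR.pos Z hZ i (by omega), hR.pos Z hZ a (by omega), hR.vert h hh i hi,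
      hR.weight h hh a ha i hi, hR.ind h hh p hp i hi, Nat.reduceEqDiff, if_false]
    rw [hI2, hI3]
    simp only [cnt, StepRel, cond_true, cond_false]
    by_cases hw : B.weight (B.vert h i) (B.vert h a) = 0
    · simp [hw]
    by_cases hc : E.col Z i = E.col Z a
    · by_cases hq : B.ind p (B.vert h a) = 0 ∨ B.ind p (B.vert h i) = 0
      · have hq' : ¬ (1 - B.ind p (B.vert h a) + (1 - B.ind p (B.vert h i)) = 0) := by omega
        simp only [hw, hc, hq, hq', Nat.sub_self, Nat.add_zero, if_true, if_false, ne_eq,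
          not_false_eq_true, true_and, forall_true_left]
        clear hR hF
        refine ⟨?_, ?_, ?_⟩
        · omega
        · split_ifs <;> omega
        · split_ifs <;> omega
      · have hq' : 1 - B.ind p (B.vert h a) + (1 - B.ind p (B.vert h i)) = 0 := by omega
        simp only [hw, hc, hq, hq', Nat.sub_self, Nat.add_zero, if_true, if_false, ne_eq,
          not_false_eq_true, and_true, false_and, and_false, forall_true_left]
        clear hR hF
        omega
    · have hc' : ¬ (E.col Z i - E.col Z a + (E.col Z a - E.col Z i) = 0) := by omega
      simp only [hc', if_false, hc, false_and, and_false, hw]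
      simp
  · rw [hb]
    exact Nat.mul_le_mul_left _ (by decide)
  · intro s' _ h
    rwa [hb] at h

end

end RAM

namespace RAM

section

variable {B : BagSequence} {N S L k : ℕ} {E : StateCode N S L k} {s : Store}

theorem checkChild_spec (hR : Ready B E s) {h p X Y Z : ℕ} (hh : h ≤ B.m) (hp : p ≤ B.m)
    (hX : X < N) (hY : Y < N) (hZ : Z < N) (h20 : s.var 20 = h) (h21 : s.var 21 = p)
    (h22 : s.var 22 = X) (h23 : s.var 23 = Y) (h24 : s.var 24 = Z) :
    WP checkChild s ((B.len h + 1) * ((B.len h + 1) * 400)) (fun s' => s'.var 26 = 0 ↔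
      s.var 26 = 0 ∧ ∀ a < B.len h,
        (∀ b < B.len h, B.weight (B.vert h b) (B.vert h a) ≠ 0 → E.col Z b = E.col Z a →
          2 ≤ B.weight (B.vert h b) (B.vert h a) ∧
          (E.pos Z b = E.pos Z a + 1 ∨ E.pos Z a = E.pos Z b + 1)) ∧
        (B.ind p (B.vert h a) = 0 → ∀ d, E.flag d Z a + B.codeSteps E h p d Z a ≤ 1) ∧
        ∀ i, B.ind p (B.vert h a) = i + 1 → E.col Z a = E.col X i ∧ E.pos Z a = E.pos X i ∧
          ∀ d, E.flag d Z a + B.codeSteps E h p d Z a + E.flag d Y i ≤ E.flag d X i) := by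
  have hb : (rd 3 (rd 11 (vr 20))).eval s = B.len h := by
    simp only [Expr.eval_rd, Expr.eval_vr, h20, hR.len h hh]
  have hlen := hR.len_le h hh
  refine (WP.forLoop (t := 40 + ((B.len h + 1) * 200 + 100)) (by decide)
    (fun j s' => s'.var 26 = 0 ↔ s.var 26 = 0 ∧ ∀ a < j,
        (∀ b < B.len h, B.weight (B.vert h b) (B.vert h a) ≠ 0 → E.col Z b = E.col Z a →
          2 ≤ B.weight (B.vert h b) (B.vert h a) ∧
          (E.pos Z b = E.pos Z a + 1 ∨ E.pos Z a = E.pos Z b + 1)) ∧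
        (B.ind p (B.vert h a) = 0 → ∀ d, E.flag d Z a + B.codeSteps E h p d Z a ≤ 1) ∧
        ∀ i, B.ind p (B.vert h a) = i + 1 → E.col Z a = E.col X i ∧ E.pos Z a = E.pos X i ∧
          ∀ d, E.flag d Z a + B.codeSteps E h p d Z a + E.flag d Y i ≤ E.flag d X i)
      ?_ ?_).mono ?_ ?_
  · simp
  · intro i s' hi hF hi' hI
    rw [hb] at hi
    have h20' : s'.var 20 = h := (hF.var 20 (by decide)).trans h20
    have h21' : s'.var 21 = p := (hF.var 21 (by decide)).trans h21
    have h22' : s'.var 22 = X := (hF.var 22 (by decide)).trans h22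
    have h23' : s'.var 23 = Y := (hF.var 23 (by decide)).trans h23
    have h24' : s'.var 24 = Z := (hF.var 24 (by decide)).trans h24
    have harr : s'.arr = s.arr := hF.arr_eq rfl
    refine WP.straight_seq (by decide) (by decide) fun hF1 => ?_
    set s1 := Program.straight _ s' with hs1
    have harr1 : s1.arr = s.arr := (hF1.arr_eq rfl).trans harr
    have k20 : s1.var 20 = h := (hF1.var 20 (by decide)).trans h20'
    have k21 : s1.var 21 = p := (hF1.var 21 (by decide)).trans h21'
    have k22 : s1.var 22 = X := (hF1.var 22 (by decide)).trans h22'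
    have k23 : s1.var 23 = Y := (hF1.var 23 (by decide)).trans h23'
    have k24 : s1.var 24 = Z := (hF1.var 24 (by decide)).trans h24'
    have k26 : s1.var 26 = s'.var 26 := hF1.var 26 (by decide)
    have k29 : s1.var 29 = B.vert h i := by
      simp only [hs1, Program.straight, Expr.eval_rd, Expr.eval_vr, Expr.eval_add,
        Store.setVar_var, Store.setVar_arr, harr, hi', h20', hR.vert h hh i hi, if_true,
        Nat.reduceEqDiff, if_false]
    have k31 : s1.var 31 = Z + i * N := by
      simp only [hs1, Program.straight, Expr.eval_rd, Expr.eval_vr, Expr.eval_add,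
        Store.setVar_var, Store.setVar_arr, harr, hi', h24', hR.stride i (by omega), if_true,
        Nat.reduceEqDiff, if_false]
    have k35 : s1.var 35 = E.flag true Z i := by
      simp only [hs1, Program.straight, Expr.eval_rd, Expr.eval_vr, Expr.eval_add,
        Store.setVar_var, Store.setVar_arr, harr, hi', h24', hR.stride i (by omega), if_true,
        Nat.reduceEqDiff, if_false, hR.flag_true Z hZ i (by omega)]
    have k36 : s1.var 36 = E.flag false Z i := by
      simp only [hs1, Program.straight, Expr.eval_rd, Expr.eval_vr, Expr.eval_add,
        Store.setVar_var, Store.setVar_arr, harr, hi', h24', hR.stride i (by omega), if_true,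
        Nat.reduceEqDiff, if_false, hR.flag_false Z hZ i (by omega)]
    have k37 : s1.var 37 = B.ind p (B.vert h i) := by
      simp only [hs1, Program.straight, Expr.eval_rd, Expr.eval_vr, Expr.eval_add,
        Store.setVar_var, Store.setVar_arr, harr, hi', h20', h21', hR.vert h hh i hi, if_true,
        Nat.reduceEqDiff, if_false, hR.ind h hh p hp i hi]
    clear_value s1
    have hR1 : Ready B E s1 := hR.congr ((hF1.var 1 (by decide)).trans (hF.var 1 (by decide)))
      ((hF1.var 9 (by decide)).trans (hF.var 9 (by decide))) (fun a _ => by rw [harr1])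
    refine (checkNeighbors_spec hR1 hh hp hZ hi k20 k21 k24 k29 k31 k37).seq fun s2 hF2 h2 => ?_
    obtain ⟨h26, h35, h36⟩ := h2
    have harr2 : s2.arr = s.arr := (hF2.arr_eq rfl).trans harr1
    have l22 : s2.var 22 = X := (hF2.var 22 (by decide)).trans k22
    have l23 : s2.var 23 = Y := (hF2.var 23 (by decide)).trans k23
    have l31 : s2.var 31 = Z + i * N := (hF2.var 31 (by decide)).trans k31
    have l37 : s2.var 37 = B.ind p (B.vert h i) := (hF2.var 37 (by decide)).trans k37
    rw [k35] at h35
    rw [k36] at h36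
    rw [k26, hI] at h26
    refine WP.straight (by decide) _ (by decide) ?_
    simp only [forall_lt_succ_iff]
    rw [← and_assoc, ← and_assoc, ← h26]
    have hcZ := hR.col Z hZ i (by omega)
    have hpZ := hR.pos Z hZ i (by omega)
    clear hF hF1 hF2 h26 hI
    -- Index zero is a vertex private to the child; index `r + 1` is the place `r` of the parent,
    -- which the program recovers as `vr 37 - 1`.
    rcases hind : B.ind p (B.vert h i) with _ | r
    · simp only [Program.straight, Expr.eval_vr, Expr.eval_add, Expr.eval_sub, Expr.eval_one,
        Store.setVar_var, l37, hind, if_true, h35, h36, Nat.reduceEqDiff, if_false,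
        Bool.forall_bool, true_imp_iff, false_imp_iff, implies_true, and_true,
        Nat.right_eq_add, Nat.add_eq_zero_iff, one_ne_zero, and_false]
      omega
    · have hr := (B.ind_eq p hp _ _).1 hind
      have hrS : r < S := hr.1.trans_le (hR.len_le p hp)
      simp only [Program.straight, Expr.eval_vr, Expr.eval_rd, Expr.eval_add, Expr.eval_sub,
        Expr.eval_one, Expr.eval_dist, Store.setVar_arr, harr2, l22, l23, l31, hcZ, hpZ,
        Nat.add_sub_cancel, hR.stride r (by omega), hR.col X hX r hrS, hR.pos X hX r hrS,
        hR.flag_true X hX r hrS, hR.flag_true Y hY r hrS, hR.flag_false X hX r hrS,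
        hR.flag_false Y hY r hrS,
        Store.setVar_var, l37, hind, if_true, h35, h36, Nat.reduceEqDiff, if_false,
        Bool.forall_bool, Nat.add_right_cancel_iff, forall_eq', Nat.add_eq_zero_iff, one_ne_zero,
        and_false, false_imp_iff, true_and]
      omega
  · rw [hb]
    refine Nat.mul_le_mul_left _ ?_
    have : (rd 3 (rd 11 (vr 20))).cost = 3 := rfl
    omega
  · intro s' _ h
    rwa [hb] at h

end

end RAM

/-! ### Tables of feasible states and the loops which merge them -/

namespace RAM

/-- The state `X` of the bag `t` is feasible according to the table in memory. -/
def Store.Table (s : Store) (N t X : ℕ) : Prop := s.arr 20 (t * N + X) = 0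

section

variable {B : BagSequence} {N S L k : ℕ} {E : StateCode N S L k} {s : Store}

theorem compat_iff {h p X Y Z : ℕ} : B.Compat E h p X Y Z ↔
    (∀ a < B.len p, E.col X a = E.col Y a ∧ E.pos X a = E.pos Y a ∧
        ∀ d, E.flag d Y a ≤ E.flag d X a) ∧
      ∀ a < B.len h,
        (∀ b < B.len h, B.weight (B.vert h b) (B.vert h a) ≠ 0 → E.col Z b = E.col Z a →
          2 ≤ B.weight (B.vert h b) (B.vert h a) ∧
          (E.pos Z b = E.pos Z a + 1 ∨ E.pos Z a = E.pos Z b + 1)) ∧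
        (B.ind p (B.vert h a) = 0 → ∀ d, E.flag d Z a + B.codeSteps E h p d Z a ≤ 1) ∧
        ∀ i, B.ind p (B.vert h a) = i + 1 → E.col Z a = E.col X i ∧ E.pos Z a = E.pos X i ∧
          ∀ d, E.flag d Z a + B.codeSteps E h p d Z a + E.flag d Y i ≤ E.flag d X i :=
  ⟨fun h => ⟨h.parent, fun a ha => ⟨h.good a ha, h.private_le a ha, h.shared a ha⟩⟩,
    fun h => ⟨h.1, fun a ha => (h.2 a ha).1, fun a ha => (h.2 a ha).2.1,
      fun a ha => (h.2 a ha).2.2⟩⟩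

/-- Zero means success: table entries are zero for feasible states, and variable `25` is set to zero
once a merging pair is found and is never raised here, whence the disjunction. -/
theorem mergeTest_spec (hR : Ready B E s) {h p X Y Z : ℕ} (hh : h ≤ B.m) (hp : p ≤ B.m)
    (hX : X < N) (hY : Y < N) (hZ : Z < N) (h20 : s.var 20 = h) (h21 : s.var 21 = p)
    (h22 : s.var 22 = X) (h23 : s.var 23 = Y) (h24 : s.var 24 = Z) :
    WP mergeTest s ((S + 1) * (S + 1) * 550) (fun s' => s'.var 25 = 0 ↔ s.var 25 = 0 ∨
      (s.Table N p Y ∧ s.Table N h Z ∧ B.Compat E h p X Y Z)) := by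
  have hlh := hR.len_le h hh
  have hlp := hR.len_le p hp
  have heval : (rd 20 (rd 19 (vr 21) + vr 23) + rd 20 (rd 19 (vr 20) + vr 24)).eval s = 0 ↔
      s.Table N p Y ∧ s.Table N h Z := by
    simp only [Expr.eval_rd, Expr.eval_add, Expr.eval_vr, h20, h21, h23, h24,
      hR.stride p (by omega), hR.stride h (by omega), Nat.add_eq_zero_iff, Store.Table]
  refine (WP.branch (T := 10 + ((S + 1) * 100 + ((S + 1) * ((S + 1) * 400) + 10))) (fun he => ?_)
    (fun he => ?_)).mono ?_ (fun _ _ h => h)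
  · rw [Ne, heval] at he
    refine WP.straight (by decide) _ (by simp only [Program.straightCost]; omega) ?_
    simp only [Program.straight]
    tauto
  · rw [heval] at he
    refine WP.straight_seq (by decide) (by decide) fun hF1 => ?_
    set s1 := Program.straight _ s with hs1
    have k26 : s1.var 26 = 0 := by simp [hs1, Program.straight, Expr.eval_zero]
    clear_value s1
    have harr1 := hF1.arr_eq rfl
    have hR1 : Ready B E s1 := hR.congr (hF1.var 1 (by decide)) (hF1.var 9 (by decide))
      (fun a _ => by rw [harr1])
    have hw1 := checkParent_spec hR1 hp hX hY ((hF1.var 21 (by decide)).trans h21)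
      ((hF1.var 22 (by decide)).trans h22) ((hF1.var 23 (by decide)).trans h23)
    refine (hw1.mono (Nat.mul_le_mul_right _ (by omega)) fun _ _ h => h).seq fun s2 hF2 h2 => ?_
    have harr2 : s2.arr = s.arr := (hF2.arr_eq rfl).trans harr1
    have hv2 : ∀ x, x ∉ checkParent.modV → x ≠ 26 → s2.var x = s.var x := fun x hx hx' =>
      (hF2.var x hx).trans (hF1.var x (by simpa [Program.modV] using hx'))
    have hR2 : Ready B E s2 := hR.congr (hv2 1 (by decide) (by decide))
      (hv2 9 (by decide) (by decide)) (fun a _ => by rw [harr2])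
    have hw2 := checkChild_spec hR2 hh hp hX hY hZ ((hv2 20 (by decide) (by decide)).trans h20)
      ((hv2 21 (by decide) (by decide)).trans h21) ((hv2 22 (by decide) (by decide)).trans h22)
      ((hv2 23 (by decide) (by decide)).trans h23) ((hv2 24 (by decide) (by decide)).trans h24)
    refine (hw2.mono (show _ ≤ (S + 1) * ((S + 1) * 400) from Nat.mul_le_mul (by omega)
      (Nat.mul_le_mul_right _ (by omega))) fun _ _ h => h).seq fun s3 hF3 h3 => ?_
    have hv3 : s3.var 25 = s.var 25 :=
      (hF3.var 25 (by decide)).trans (hv2 25 (by decide) (by decide))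
    refine WP.straight (by decide) _ (by decide) ?_
    simp only [Program.straight, Expr.eval_vr]
    have hC : s3.var 26 = 0 ↔ B.Compat E h p X Y Z := by
      rw [h3, h2, compat_iff]
      simp [k26]
    by_cases hc : s3.var 26 = 0
    · simp [hc, he, hC.1 hc, Expr.eval_zero]
    · have hc' : ¬ B.Compat E h p X Y Z := fun h => hc (hC.2 h)
      simp [hc, hc', hv3]
  · have : (rd 20 (rd 19 (vr 21) + vr 23) + rd 20 (rd 19 (vr 20) + vr 24)).cost = 11 := rfl
    nlinarith

/-- The states merging into the state `X` of the bag `p`. -/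
def Merges (B : BagSequence) (E : StateCode N S L k) (s : Store) (h p X : ℕ) : Prop :=
  ∃ Y < N, ∃ Z < N, s.Table N p Y ∧ s.Table N h Z ∧ B.Compat E h p X Y Z

theorem exists_lt_succ_iff {P : ℕ → Prop} {j : ℕ} :
    (∃ b < j + 1, P b) ↔ (∃ b < j, P b) ∨ P j := by
  simp only [Nat.lt_succ_iff_lt_or_eq, or_and_right, exists_or, exists_eq_left]

/-- Results go to the scratch array `21`, so that all tests for different `X` see the old table of
the parent in array `20`. The three nested loops over codes give the factor `N ^ 3`. -/
theorem mergeTable_spec (hR : Ready B E s) {h p : ℕ} (hh : h ≤ B.m) (hp : p ≤ B.m)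
    (h20 : s.var 20 = h) (h21 : s.var 21 = p) :
    WP mergeTable s ((N + 1) * ((N + 1) * ((N + 1) * ((S + 1) * (S + 1) * 550 + 8) + 8) + 30))
      (fun s' => ∀ X < N, s'.arr 21 X = 0 ↔ Merges B E s h p X) := by
  have hb : (vr 9).eval s = N := hR.codes
  refine (WP.forLoop (t := 2 + ((N + 1) * ((N + 1) * ((S + 1) * (S + 1) * 550 + 8) + 8) + 5))
    (by decide) (fun j s' => ∀ X < j, s'.arr 21 X = 0 ↔ Merges B E s h p X) ?_ ?_).mono ?_ ?_
  · simp
  · intro X s' hX hF hX' hI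
    rw [hb] at hX
    refine WP.straight_seq (by decide) (by decide) fun hF1 => ?_
    set s1 := Program.straight _ s' with hs1
    have k25 : s1.var 25 = 1 := by simp [hs1, Program.straight, Expr.eval_one]
    clear_value s1
    have hv1 : ∀ x, x ∉ mergeTable.modV → s1.var x = s.var x := fun x hx =>
      (hF1.var x (fun hx' => hx (by revert hx'; simp [mergeTable, forLoop, Program.modV]; tauto))).trans
        (hF.var x hx)
    have k22 : s1.var 22 = X := (hF1.var 22 (by decide)).trans hX'
    have ha1 : ∀ a, a ≠ 21 → s1.arr a = s.arr a := fun a ha =>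
      (hF1.arr a (by simp [Program.modA])).trans (hF.arr a (by
        have : (forLoop 22 (vr 9) (.assign 25 1 ;; forLoop 23 (vr 9) (forLoop 24 (vr 9) mergeTest) ;;
          .write 21 (vr 22) (vr 25))).modA = [21] := rfl
        rw [this]; simpa using ha))
    have hN1 : (vr 9).eval s1 = N := (hv1 9 (by decide)).trans hb
    refine (((WP.forLoop (t := (N + 1) * ((S + 1) * (S + 1) * 550 + 8)) (by decide)
      (fun j s'' => s''.var 25 = 0 ↔ ∃ Y < j, ∃ Z < N, s.Table N p Y ∧ s.Table N h Z ∧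
        B.Compat E h p X Y Z) ?_ ?_).mono (le_of_eq ?_) (fun _ _ h => h)).seq fun s2 hF2 h2 => ?_)
    · simp [k25]
    · intro Y s2 hY hF2 hY' hI2
      rw [hN1] at hY
      have hN2 : (vr 9).eval s2 = N := (hF2.var 9 (by decide)).trans hN1
      refine (WP.forLoop (t := (S + 1) * (S + 1) * 550) (by decide)
        (fun j s'' => s''.var 25 = 0 ↔ s2.var 25 = 0 ∨ ∃ Z < j, s.Table N p Y ∧ s.Table N h Z ∧
        B.Compat E h p X Y Z) ?_ ?_).mono (le_of_eq ?_) (fun s3 _ h => ?_)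
      · simp
      · intro Z s3 hZ hF3 hZ' hI3
        rw [hN2] at hZ
        have ha3 : ∀ a, a ≠ 21 → s3.arr a = s.arr a := fun a ha => by
          rw [hF3.arr_eq rfl, hF2.arr_eq rfl, ha1 a ha]
        have hR3 : Ready B E s3 := hR.congr
          ((hF3.var 1 (by decide)).trans ((hF2.var 1 (by decide)).trans (hv1 1 (by decide))))
          ((hF3.var 9 (by decide)).trans ((hF2.var 9 (by decide)).trans (hv1 9 (by decide))))
          (fun a ha => ha3 a (by omega))
        have hT : ∀ t X, s3.Table N t X ↔ s.Table N t X := fun t X => by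
          rw [Store.Table, Store.Table, ha3 20 (by decide)]
        refine (mergeTest_spec hR3 (X := X) (Y := Y) (Z := Z) hh hp hX hY hZ
          ((hF3.var 20 (by decide)).trans ((hF2.var 20 (by decide)).trans
            ((hv1 20 (by decide)).trans h20)))
          ((hF3.var 21 (by decide)).trans ((hF2.var 21 (by decide)).trans
            ((hv1 21 (by decide)).trans h21)))
          ((hF3.var 22 (by decide)).trans ((hF2.var 22 (by decide)).trans k22))
          ((hF3.var 23 (by decide)).trans hY') hZ').mono le_rfl fun s4 _ h4 => ?_
        rw [hT, hT] at h4
        simp only [Store.setVar_var, Nat.reduceEqDiff, if_false, exists_lt_succ_iff]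
        rw [h4, hI3, or_assoc]
      · rw [hN2]; rfl
      · rw [hN2] at h
        simp only [Store.setVar_var, Nat.reduceEqDiff, if_false, exists_lt_succ_iff]
        rw [h, hI2]
    · rw [hN1]; rfl
    · rw [hN1] at h2
      have k22' : s2.var 22 = X := (hF2.var 22 (by decide)).trans k22
      have ha2 : ∀ Y, s2.arr 21 Y = s'.arr 21 Y := fun Y => by
        rw [hF2.arr_eq rfl, hF1.arr_eq rfl]
      refine WP.straight (by decide) _ (by decide) ?_
      simp only [forall_lt_succ_iff, Program.straight, Expr.eval_vr, Store.setVar_arr,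
        Store.setArr_arr, k22', if_true, true_and]
      refine ⟨fun Y hY => ?_, h2⟩
      rw [if_neg hY.ne, ha2]
      exact hI Y hY
  · rw [hb]
    refine Nat.mul_le_mul_left _ ?_
    have : (vr 9).cost = 1 := rfl
    omega
  · intro s' _ h
    rwa [hb] at h

end

end RAM

namespace RAM

theorem mul_add_inj {N t p X Y : ℕ} (hX : X < N) (hY : Y < N) (h : t * N + X = p * N + Y) :
    t = p ∧ X = Y := by
  have h1 : (t * N + X) / N = t := by
    rw [mul_comm, Nat.mul_add_div (by omega), Nat.div_eq_of_lt hX, add_zero]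
  have h2 : (p * N + Y) / N = p := by
    rw [mul_comm, Nat.mul_add_div (by omega), Nat.div_eq_of_lt hY, add_zero]
  rw [h, h2] at h1
  subst h1
  exact ⟨rfl, by omega⟩

section

variable {B : BagSequence} {N S L k : ℕ} {E : StateCode N S L k} {s : Store}

/-- The row of `p` starts at `p * N`; rows of other bags are untouched since `t * N + X` with `X <
N` determines `t` and `X`. -/
theorem copyTable_spec (hR : Ready B E s) {p : ℕ} (hp : p ≤ B.m) (h21 : s.var 21 = p) :
    WP copyTable s ((N + 1) * 30) (fun s' => (∀ X < N, s'.arr 20 (p * N + X) = s.arr 21 X) ∧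
      ∀ t ≠ p, ∀ X < N, s'.arr 20 (t * N + X) = s.arr 20 (t * N + X)) := by
  have hb : (vr 9).eval s = N := hR.codes
  refine (WP.forLoop (t := 20) (by decide) (fun j s' =>
    (∀ X < j, s'.arr 20 (p * N + X) = s.arr 21 X) ∧
      ∀ t ≠ p, ∀ X < N, s'.arr 20 (t * N + X) = s.arr 20 (t * N + X)) ?_ ?_).mono ?_ ?_
  · simp
  · intro i s' hi hF hi' hI
    rw [hb] at hi
    refine WP.straight (by decide) _ (by decide) ?_
    have e21 : s'.arr 21 = s.arr 21 := hF.arr 21 (by decide)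
    have e19 : s'.arr 19 = s.arr 19 := hF.arr 19 (by decide)
    have h21' : s'.var 21 = p := (hF.var 21 (by decide)).trans h21
    simp only [Program.straight, Expr.eval_rd, Expr.eval_vr, Expr.eval_add, Store.setVar_arr,
      Store.setArr_arr, e21, e19, h21', hi', hR.stride p (by omega), true_and, and_true, forall_lt_succ_iff,
      if_true]
    refine ⟨fun X hX => ?_, fun t ht X hX => ?_⟩
    · rw [if_neg (by omega)]
      exact hI.1 X hX
    · rw [if_neg fun h => ht (mul_add_inj hX hi h).1]
      exact hI.2 t ht X hX
  · rw [hb]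
    exact Nat.mul_le_mul_left _ (by decide)
  · intro s' _ h
    rwa [hb] at h

/-- The invariant is that certification is equivalent to feasibility of the first `B.m + 1 - j` bags
with the current tables. It holds initially because array `20` is all zero, which allows every
state; round `i` eliminates the bag `B.m - i`. -/
theorem mergeAll_spec (hR : Ready B E s) (hL : 0 < L) (h20 : ∀ i, s.arr 20 i = 0) :
    WP mergeAll s ((B.m + 1) * ((N + 1) * ((N + 1) * ((N + 1) *
      ((S + 1) * (S + 1) * 550 + 8) + 8) + 60) + 40))
      (fun s' => B.Certified L k ↔ ∃ X < N, s'.Table N 0 X) := by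
  have hb : (vr 1).eval s = B.m := hR.num
  refine (WP.forLoop (t := 20 + ((N + 1) * ((N + 1) * ((N + 1) *
      ((S + 1) * (S + 1) * 550 + 8) + 8) + 30) + (N + 1) * 30)) (by decide)
    (fun j s' => B.Certified L k ↔ B.Feasible E (B.m + 1 - j) (s'.Table N)) ?_ ?_).mono ?_ ?_
  · refine (BagSequence.feasible_all_iff hL hR.len_le fun t _ X => ?_).symm
    simp [Store.Table, h20]
  · intro i s' hi hF hi' hI
    rw [hb] at hi
    have hR' : Ready B E s' := hR.congr (hF.var 1 (by decide)) (hF.var 9 (by decide)) fun a ha => by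
      have : a ∉ (forLoop 38 (vr 1) ((.assign 20 (vr 1 - vr 38) ;; .assign 21 (rd 12 (vr 20))) ;;
        mergeTable ;; copyTable)).modA := fun hc => by
          have : (forLoop 38 (vr 1) ((.assign 20 (vr 1 - vr 38) ;; .assign 21 (rd 12 (vr 20))) ;;
            mergeTable ;; copyTable)).modA = [21, 20] := rfl
          rw [this] at hc
          simp only [List.mem_cons, List.not_mem_nil, or_false] at hc
          omega
      exact hF.arr a this
    have h1 : 1 ≤ B.m - i := by omega
    have hp := B.par_lt (B.m - i) h1 (Nat.sub_le _ _)
    refine WP.straight_seq (by decide) (by decide) fun hF1 => ?_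
    set s1 := Program.straight _ s' with hs1
    have k20 : s1.var 20 = B.m - i := by
      simp [hs1, Program.straight, Expr.eval_vr, Expr.eval_sub, hi', hR'.num]
    have k21 : s1.var 21 = B.par (B.m - i) := by
      simp [hs1, Program.straight, Expr.eval_vr, Expr.eval_sub, Expr.eval_rd, hi', hR'.num,
        hR'.par _ h1 (Nat.sub_le _ _)]
    clear_value s1
    have harr1 : s1.arr = s'.arr := hF1.arr_eq rfl
    have hR1 : Ready B E s1 := hR'.congr (hF1.var 1 (by decide)) (hF1.var 9 (by decide))
      fun a _ => by rw [harr1]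
    have hT1 : s1.Table N = s'.Table N := by
      funext t X
      rw [Store.Table, harr1, Store.Table]
    refine (mergeTable_spec hR1 (by omega) (by omega) k20 k21).seq fun s2 hF2 h2 => ?_
    have harr2 : ∀ a, a ≠ 21 → s2.arr a = s1.arr a := fun a ha => hF2.arr a (by
      have : mergeTable.modA = [21] := rfl
      rw [this]; simpa using ha)
    have hR2 : Ready B E s2 := hR1.congr (hF2.var 1 (by decide)) (hF2.var 9 (by decide))
      fun a ha => harr2 a (by omega)
    refine (copyTable_spec hR2 (by omega) ((hF2.var 21 (by decide)).trans k21)).mono le_rfl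
      fun s3 _ h3 => ?_
    rw [hI]
    have hT : ∀ X < N, s3.Table N (B.par (B.m - i)) X ↔
        Merges B E s1 (B.m - i) (B.par (B.m - i)) X := fun X hX => by
      rw [Store.Table, h3.1 X hX, h2 X hX]
    have hT' : ∀ t, t ≠ B.par (B.m - i) → ∀ X < N, s3.Table N t X ↔ s1.Table N t X :=
      fun t ht X hX => by rw [Store.Table, h3.2 t ht X hX, harr2 20 (by decide), Store.Table]
    have hset : (s3.setVar 38 (i + 1)).Table N = s3.Table N := rfl
    rw [hset, ← hT1, show B.m + 1 - i = B.m - i + 1 by omega,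
      show B.m + 1 - (i + 1) = B.m - i by omega]
    constructor
    · exact BagSequence.Feasible.eliminate hR.len_le h1 (Nat.sub_le _ _)
        (fun X hX Y hY Z hZ hTY hTZ hC => (hT X hX).2 ⟨Y, hY, Z, hZ, hTY, hTZ, hC⟩)
        (fun t _ ht X hX => (hT' t ht X hX).2)
    · exact BagSequence.Feasible.of_eliminate hR.len_le h1 (Nat.sub_le _ _)
        (fun X hX hTX => (hT X hX).1 hTX) (fun t _ ht X hX => (hT' t ht X hX).1)
  · rw [hb]
    refine Nat.mul_le_mul_left _ ?_
    have : (vr 1).cost = 1 := rfl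
    have h2 : ∀ q, (N + 1) * (q + 60) = (N + 1) * (q + 30) + (N + 1) * 30 := fun q => by ring
    rw [h2]
    omega
  · intro s' _ h
    rw [hb, show B.m + 1 - B.m = 1 by omega, BagSequence.feasible_one_iff] at h
    exact h

theorem readAnswer_spec (hR : Ready B E s) :
    WP readAnswer s ((N + 1) * 40) (fun s' => ((∃ X < N, s.Table N 0 X) → s'.var 0 = 1) ∧
      ((¬ ∃ X < N, s.Table N 0 X) → s'.var 0 = 0)) := by
  classical
  refine WP.mono (T := 2 + (N + 1) * 35) (WP.straight_seq (by decide) (by decide) fun hF1 => ?_)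
    (by omega) fun _ _ h => h
  set s1 := Program.straight _ s with hs1
  have k0 : s1.var 0 = 0 := by simp [hs1, Program.straight, Expr.eval_zero]
  clear_value s1
  have harr1 : s1.arr = s.arr := hF1.arr_eq rfl
  have hb : (vr 9).eval s1 = N := (hF1.var 9 (by decide)).trans hR.codes
  refine (WP.forLoop (t := 20) (by decide) (fun j s' =>
    s'.var 0 = if ∃ X < j, s.Table N 0 X then 1 else 0) ?_ ?_).mono ?_ ?_
  · simp [k0]
  · intro i s' hi hF hi' hI
    rw [hb] at hi
    refine WP.straight (by decide) _ (by decide) ?_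
    have harr : s'.arr = s.arr := (hF.arr_eq rfl).trans harr1
    have hev : (rd 20 (rd 19 0 + vr 22)).eval s' = 0 ↔ s.Table N 0 i := by
      simp only [Expr.eval_rd, Expr.eval_add, Expr.eval_vr, Expr.eval_zero, harr, hi',
        hR.stride 0 (by omega), Store.Table]
    simp only [Program.straight, exists_lt_succ_iff]
    by_cases ht : s.Table N 0 i
    · rw [if_pos (hev.2 ht)]
      simp [ht, Expr.eval_one]
    · rw [if_neg (fun h => ht (hev.1 h))]
      simp [ht, hI]
  · rw [hb]
    exact Nat.mul_le_mul_left _ (by decide)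
  · intro s' _ h
    rw [hb] at h
    constructor
    · intro h2; rw [h, if_pos h2]
    · intro h2; rw [h, if_neg h2]

end

end RAM

/-! ### Codes for states -/

/-- The higher digits are kept as an explicit remainder `r` instead of a residue, since each digit
is itself split further by division into color, position and flags. -/
theorem exists_digits (b S : ℕ) (d : ℕ → ℕ) (hd : ∀ a < S, d a < b) :
    ∃ X < b ^ S, ∀ a < S, ∃ r, X / b ^ a = d a + b * r := by
  induction S generalizing d with
  | zero => exact ⟨0, by simp, by simp⟩
  | succ S ih =>
    obtain ⟨X, hX, h⟩ := ih (fun a => d (a + 1)) fun a ha => hd (a + 1) (by omega)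
    have h0 := hd 0 (by omega)
    refine ⟨d 0 + b * X, ?_, fun a ha => ?_⟩
    · calc d 0 + b * X < b + b * X := by omega
        _ = b * (X + 1) := by ring
        _ ≤ b * b ^ S := Nat.mul_le_mul_left _ hX
        _ = b ^ (S + 1) := by ring
    · cases a with
      | zero => exact ⟨X, by simp⟩
      | succ a =>
        obtain ⟨r, hr⟩ := h a (by omega)
        refine ⟨r, ?_⟩
        rw [pow_succ', ← Nat.div_div_eq_div_mul, Nat.add_mul_div_left _ _ (by omega),
          Nat.div_eq_of_lt h0, zero_add, hr]

/-- The number of states of a vertex. -/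
def stateCount (L k : ℕ) : ℕ := L * ((k + 1) * (2 * 2))

/-- The states of the vertices of a bag are the digits of a number. -/
def digitCode (S k L : ℕ) (hL : 0 < L) : StateCode (stateCount L k ^ S) S L k where
  col X a := X / stateCount L k ^ a % L
  pos X a := X / stateCount L k ^ a / L % (k + 1)
  flag d X a := cond d (X / stateCount L k ^ a / L / (k + 1) % 2)
    (X / stateCount L k ^ a / L / (k + 1) / 2 % 2)
  col_lt _ _ _ _ := Nat.mod_lt _ hL
  pos_le _ _ _ _ := Nat.lt_succ_iff.1 (Nat.mod_lt _ (Nat.succ_pos k))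
  exists_code c p f h := by
    obtain ⟨X, hX, hd⟩ := exists_digits (stateCount L k) S
      (fun a => c a + L * (p a + (k + 1) * (f true a + 2 * f false a))) (fun a ha => by
        obtain ⟨h1, h2, h3⟩ := h a ha
        have h4 := h3 true
        have h5 := h3 false
        calc c a + L * (p a + (k + 1) * (f true a + 2 * f false a))
            < L + L * (p a + (k + 1) * (f true a + 2 * f false a)) := by omega
          _ = L * (p a + 1 + (k + 1) * (f true a + 2 * f false a)) := by ring
          _ ≤ L * (k + 1 + (k + 1) * 3) := by
            refine Nat.mul_le_mul_left _ (Nat.add_le_add (by omega) (Nat.mul_le_mul_left _ ?_))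
            omega
          _ = stateCount L k := by unfold stateCount; ring)
    refine ⟨X, hX, fun a ha => ?_⟩
    obtain ⟨r, hr⟩ := hd a ha
    obtain ⟨h1, h2, h3⟩ := h a ha
    have h4 := h3 true
    have h5 := h3 false
    have e1 : X / stateCount L k ^ a =
        c a + L * (p a + (k + 1) * (f true a + 2 * (f false a + 2 * r))) := by
      rw [hr]; unfold stateCount; ring
    have e2 : X / stateCount L k ^ a / L =
        p a + (k + 1) * (f true a + 2 * (f false a + 2 * r)) := by
      rw [e1, Nat.add_mul_div_left _ _ hL, Nat.div_eq_of_lt h1, zero_add]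
    have e3 : X / stateCount L k ^ a / L / (k + 1) = f true a + 2 * (f false a + 2 * r) := by
      rw [e2, Nat.add_mul_div_left _ _ (Nat.succ_pos k), Nat.div_eq_of_lt (by omega), zero_add]
    refine ⟨?_, ?_, ?_⟩
    · rw [e1, Nat.add_mul_mod_self_left, Nat.mod_eq_of_lt h1]
    · rw [e2, Nat.add_mul_mod_self_left, Nat.mod_eq_of_lt (by omega)]
    · rw [e3]
      intro d
      cases d <;> simp only [cond_true, cond_false] <;> omega

/-! ### Decoding states by repeated subtraction -/

namespace RAM

/-- Divides `var 16` by `r` and stores the remainder in the array `a`. -/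
def divide (r : Expr) (a : ℕ) : Program :=
  .assign 17 0 ;;
  .loop (vr 16 + 1 - r) (.assign 16 (vr 16 - r) ;; .assign 17 (vr 17 + 1)) ;;
  (.write a (vr 8 + rd 19 (vr 14)) (vr 16) ;; .assign 16 (vr 17))

/-- Tabulates the states with a given code. -/
def decode : Program :=
  forLoop 8 (vr 9) (.assign 16 (vr 8) ;;
    forLoop 14 (vr 6)
      (divide (vr 3) 15 ;; divide (vr 2 + 1) 16 ;; divide 2 17 ;; divide 2 18))

/-- The loop keeps `var 16 + r * var 17 = y` while `var 16` decreases. Bounding the rounds crudely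
by `y + 1` is harmless, as decoding stays of order `N ^ 2 * S`. The quotient is left in variable
`16`, so that divisions can be chained. -/
theorem divide_spec {r : Expr} (hr : r.arrs = []) (hr' : 16 ∉ r.vars ∧ 17 ∉ r.vars)
    (hrc : r.cost ≤ 3) (a : ℕ) {s : Store} {y : ℕ} (hpos : 0 < r.eval s)
    (hy : s.var 16 = y) :
    WP (divide r a) s ((y + 2) * 40) (fun s' => s'.var 16 = y / r.eval s ∧
      ∀ i, s'.arr a i = if i = s.var 8 + s.arr 19 (s.var 14) then y % r.eval s else s.arr a i) := by
  refine WP.mono (T := 2 + ((y + 1) * 24 + 20)) (WP.straight_seq rfl (by decide) fun hF1 => ?_)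
    (by omega) (fun _ _ h => h)
  set s1 := Program.straight _ s with hs1
  have k17 : s1.var 17 = 0 := by simp [hs1, Program.straight, Expr.eval_zero]
  clear_value s1
  have k16 : s1.var 16 = y := (hF1.var 16 (by decide)).trans hy
  have harr1 : s1.arr = s.arr := hF1.arr_eq rfl
  have heval : ∀ s', (∀ x, x ≠ 16 → x ≠ 17 → s'.var x = s.var x) → r.eval s' = r.eval s :=
    fun s' h => r.eval_congr
      (fun x hx => h x (fun h' => hr'.1 (h' ▸ hx)) (fun h' => hr'.2 (h' ▸ hx))) (by simp [hr])
  have hloop := WP.loop (e := vr 16 + 1 - r)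
    (P := .assign 16 (vr 16 - r) ;; .assign 17 (vr 17 + 1)) (t := 12)
    (I := fun s' => (∀ x, x ≠ 16 → x ≠ 17 → s'.var x = s.var x) ∧
      s'.var 16 + r.eval s * s'.var 17 = y) (μ := fun s' => s'.var 16) (s := s1) (by
      intro s' he hI
      refine WP.straight rfl _ ?_ ?_
      · have : (Program.assign 16 (vr 16 - r) ;; Program.assign 17 (vr 17 + 1)).straightCost =
          (1 + r.cost + 1 + 1) + 4 := rfl
        omega
      have h1 := heval s' hI.1
      simp only [Expr.eval_sub, Expr.eval_add, Expr.eval_vr, Expr.eval_one, h1] at he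
      simp only [Program.straight, Expr.eval_sub, Expr.eval_add, Expr.eval_vr, Expr.eval_one,
        Store.setVar_var, if_true, Nat.reduceEqDiff, if_false, h1]
      refine ⟨⟨fun x h16 h17 => ?_, ?_⟩, by omega⟩
      · rw [if_neg h17, if_neg h16]
        exact hI.1 x h16 h17
      · have h2 := hI.2
        rw [Nat.mul_add, mul_one]
        omega) ⟨fun x _ h17 => hF1.var x (by simpa [Program.modV] using h17), by
          rw [k16, k17]; simp⟩
  refine (hloop.mono ?_ (fun _ _ h => h)).seq fun s2 hF2 h2 => ?_
  · rw [k16]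
    refine Nat.mul_le_mul_left _ ?_
    have : (vr 16 + 1 - r).cost = 3 + r.cost + 1 := rfl
    omega
  · obtain ⟨⟨h3, h4⟩, h5⟩ := h2
    have h1 := heval s2 h3
    simp only [Expr.eval_sub, Expr.eval_add, Expr.eval_vr, Expr.eval_one, h1] at h5
    have hlt : s2.var 16 < r.eval s := by omega
    have hq : s2.var 17 = y / r.eval s := by
      rw [← h4, Nat.add_mul_div_left _ _ hpos, Nat.div_eq_of_lt hlt, zero_add]
    have hm : s2.var 16 = y % r.eval s := by
      rw [← h4, Nat.add_mul_mod_self_left, Nat.mod_eq_of_lt hlt]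
    have harr2 : s2.arr = s.arr := (hF2.arr_eq rfl).trans harr1
    refine WP.straight rfl _ ?_ ?_
    · simp only [Program.straightCost]
      decide
    · simp only [Program.straight, Expr.eval_rd, Expr.eval_add, Expr.eval_vr, Store.setVar_var,
        Store.setVar_arr, Store.setArr_arr, Store.setArr_var, harr2, h3 8 (by decide) (by decide),
        h3 14 (by decide) (by decide), true_and, if_true]
      exact ⟨hq, fun i => by rw [hm]⟩

/-- The states with the code `X` are tabulated for the place `a`. -/
def Store.Decoded (s : Store) (N b L k X a : ℕ) : Prop :=
  s.arr 15 (X + a * N) = X / b ^ a % L ∧ s.arr 16 (X + a * N) = X / b ^ a / L % (k + 1) ∧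
    s.arr 17 (X + a * N) = X / b ^ a / L / (k + 1) % 2 ∧
    s.arr 18 (X + a * N) = X / b ^ a / L / (k + 1) / 2 % 2

theorem decode_spec {S k L N : ℕ} (hL : 0 < L) {s : Store}
    (h2 : s.var 2 = k) (h3 : s.var 3 = L) (h6 : s.var 6 = S) (h9 : s.var 9 = N)
    (h19 : ∀ i < S, s.arr 19 i = i * N) :
    WP decode s ((N + 1) * ((S + 1) * ((N + 2) * 160 + 8) + 10)) (fun s' =>
      ∀ X < N, ∀ a < S, s'.Decoded N (stateCount L k) L k X a) := by
  set b := stateCount L k with hb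
  have hb9 : (vr 9).eval s = N := h9
  refine (WP.forLoop (t := 2 + (S + 1) * ((N + 2) * 160 + 8)) (by decide)
    (fun j s' => ∀ X < j, X < N → ∀ a < S, s'.Decoded N b L k X a) ?_ ?_).mono ?_ ?_
  · simp
  · intro X s' hX hF hX' hI
    rw [hb9] at hX
    refine WP.straight_seq (by decide) (by decide) fun hF1 => ?_
    set s1 := Program.straight _ s' with hs1
    have k16 : s1.var 16 = X := by simp [hs1, Program.straight, Expr.eval_vr, hX']
    clear_value s1
    have harr1 : s1.arr = s'.arr := hF1.arr_eq rfl
    have hb6 : (vr 6).eval s1 = S :=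
      (hF1.var 6 (by decide)).trans ((hF.var 6 (by decide)).trans h6)
    have e8 : s1.var 8 = X := (hF1.var 8 (by decide)).trans hX'
    have e3 : s1.var 3 = L := (hF1.var 3 (by decide)).trans ((hF.var 3 (by decide)).trans h3)
    have e2 : s1.var 2 = k := (hF1.var 2 (by decide)).trans ((hF.var 2 (by decide)).trans h2)
    have e19 : ∀ i < S, s1.arr 19 i = i * N := fun i hi => by
      rw [harr1, hF.arr 19 (by decide), h19 i hi]
    -- The invariant follows the lexicographic order of the writes: all places of smaller codes, and
    -- the first `j` places of the code `X`.
    refine (WP.forLoop (t := (N + 2) * 160) (by decide)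
      (fun j s'' => s''.var 16 = X / b ^ j ∧ ∀ Y < N, ∀ a < S, (Y < X ∨ Y = X ∧ a < j) →
        s''.Decoded N b L k Y a) ?_ ?_).mono (le_of_eq ?_) ?_
    · refine ⟨by simp [k16], fun Y hY a ha h => ?_⟩
      have := hI Y (by omega) hY a ha
      simpa [Store.Decoded, harr1] using this
    · intro a s2 ha hF2 ha' hI2
      rw [hb6] at ha
      obtain ⟨hI2, hI3⟩ := hI2
      have hle : X / b ^ a ≤ X := Nat.div_le_self _ _
      have hm : ∀ y, y ≤ X → (y + 2) * 40 ≤ (N + 2) * 40 := fun y hy =>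
        Nat.mul_le_mul_right _ (by omega)
      have f8 : s2.var 8 = X := (hF2.var 8 (by decide)).trans e8
      have f3 : s2.var 3 = L := (hF2.var 3 (by decide)).trans e3
      have f2 : s2.var 2 = k := (hF2.var 2 (by decide)).trans e2
      have f19 : s2.arr 19 a = a * N := by rw [hF2.arr 19 (by decide), e19 a ha]
      have w1 := divide_spec (r := vr 3) rfl (by decide) (by decide) 15
        (by simpa [Expr.eval_vr, f3] using hL) hI2
      refine ((w1.mono (hm _ hle) fun _ _ h => h).seq
        (T' := (N + 2) * 40 + ((N + 2) * 40 + (N + 2) * 40)) fun s3 hF3 g3 => ?_).mono (by omega)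
        fun _ _ h => h
      simp only [Expr.eval_vr, f3, f8, ha', f19] at g3
      have w2 := divide_spec (r := vr 2 + 1) (s := s3) rfl (by decide) (by decide) 16
        (by simp [Expr.eval_add, Expr.eval_one]) g3.1
      refine (w2.mono (hm _ ((Nat.div_le_self _ _).trans hle)) fun _ _ h => h).seq
        fun s4 hF4 g4 => ?_
      simp only [Expr.eval_vr, Expr.eval_add, Expr.eval_one, hF3.var 2 (by decide),
        hF3.var 8 (by decide), hF3.var 14 (by decide), hF3.arr 19 (by decide), f2, f8, ha',
        f19] at g4
      have w3 := divide_spec (r := 2) (s := s4) rfl (by decide) (by decide) 17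
        (by simp [Expr.eval_two]) g4.1
      refine (w3.mono (hm _ ((Nat.div_le_self _ _).trans ((Nat.div_le_self _ _).trans hle)))
        fun _ _ h => h).seq fun s5 hF5 g5 => ?_
      simp only [Expr.eval_two, hF4.var 8 (by decide), hF4.var 14 (by decide),
        hF4.arr 19 (by decide), hF3.var 8 (by decide), hF3.var 14 (by decide),
        hF3.arr 19 (by decide), f8, ha', f19] at g5
      have w4 := divide_spec (r := 2) (s := s5) rfl (by decide) (by decide) 18
        (by simp [Expr.eval_two]) g5.1
      refine w4.mono (hm _ ((Nat.div_le_self _ _).trans ((Nat.div_le_self _ _).trans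
        ((Nat.div_le_self _ _).trans hle)))) fun s6 hF6 g6 => ?_
      simp only [Expr.eval_two, hF5.var 8 (by decide), hF5.var 14 (by decide),
        hF5.arr 19 (by decide), hF4.var 8 (by decide), hF4.var 14 (by decide),
        hF4.arr 19 (by decide), hF3.var 8 (by decide), hF3.var 14 (by decide),
        hF3.arr 19 (by decide), f8, ha', f19] at g6
      have q15 : ∀ i, s6.arr 15 i = if i = X + a * N then X / b ^ a % L else s2.arr 15 i :=
        fun i => by
          rw [hF6.arr 15 (by decide), hF5.arr 15 (by decide), hF4.arr 15 (by decide), g3.2]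
      have q16 : ∀ i, s6.arr 16 i =
          if i = X + a * N then X / b ^ a / L % (k + 1) else s2.arr 16 i := fun i => by
        rw [hF6.arr 16 (by decide), hF5.arr 16 (by decide), g4.2, hF3.arr 16 (by decide)]
      have q17 : ∀ i, s6.arr 17 i =
          if i = X + a * N then X / b ^ a / L / (k + 1) % 2 else s2.arr 17 i := fun i => by
        rw [hF6.arr 17 (by decide), g5.2, hF4.arr 17 (by decide), hF3.arr 17 (by decide)]
      have q18 : ∀ i, s6.arr 18 i =
          if i = X + a * N then X / b ^ a / L / (k + 1) / 2 % 2 else s2.arr 18 i := fun i => by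
        rw [g6.2, hF5.arr 18 (by decide), hF4.arr 18 (by decide), hF3.arr 18 (by decide)]
      -- The four divisors `L`, `k + 1`, `2`, `2` multiply to `b`, so the last quotient is ready for
      -- the next digit.
      have q16v : s6.var 16 = X / b ^ (a + 1) := by
        rw [g6.1, hb, stateCount, pow_succ]
        simp only [Nat.div_div_eq_div_mul, mul_assoc]
      refine ⟨by simpa using q16v, fun Y hY a' ha' hYa => ?_⟩
      simp only [Store.Decoded, Store.setVar_arr, q15, q16, q17, q18]
      by_cases hnew : Y = X ∧ a' = a
      · obtain ⟨rfl, rfl⟩ := hnew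
        simp
      · have hne : Y + a' * N ≠ X + a * N := fun h => by
          rw [add_comm Y, add_comm X] at h
          obtain ⟨h1, h2⟩ := mul_add_inj hY hX h
          exact hnew ⟨h2, h1⟩
        simp only [if_neg hne]
        exact hI3 Y hY a' ha' (by omega)
    · rw [hb6]; rfl
    · intro s3 _ h
      rw [hb6] at h
      intro Y hY hYN a ha
      have := h.2 Y hYN a ha (by omega)
      simpa [Store.Decoded] using this
  · rw [hb9]
    refine Nat.mul_le_mul_left _ ?_
    have : (vr 9).cost = 1 := rfl
    omega
  · intro s' _ h
    rw [hb9] at h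
    exact fun X hX => h X hX hX

end RAM

/-! ### The input in memory -/

/-- The blocks before block `t` occupy as many places as the sum of their lengths; this justifies
the offsets stored by `sizes`. -/
theorem List.getD_flatten_sum {ls : List (List ℕ)} {t a : ℕ} (ht : t < ls.length)
    (ha : a < ls[t].length) :
    ls.flatten.getD (∑ i ∈ Finset.range t, (ls.map List.length).getD i 0 + a) 0 =
      ls[t].getD a 0 := by
  induction ls generalizing t with
  | nil => simp at ht
  | cons l ls ih =>
    cases t with
    | zero =>
      simp only [List.getElem_cons_zero] at ha
      simp [List.getElem?_append_left ha]
    | succ t =>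
      simp only [List.getElem_cons_succ] at ha
      have := ih (by simpa using ht) ha
      rw [Finset.sum_range_succ', List.flatten_cons, List.getD_append_right _ _ _ _ (by simp; omega)]
      simp only [List.map_cons, List.getD_cons_succ, List.getD_cons_zero, List.getElem_cons_succ]
      rw [← this]
      congr 1
      omega

theorem List.flatMap_singleton_eq_map {α β : Type*} (f : α → β) (l : List α) :
    (l.flatMap fun a => [f a]) = l.map f := by
  induction l <;> simp_all

namespace Listing

variable {n m : ℕ} {G : SimpleGraph (Fin n)} {D : RootedTreeDecomposition G (Fin m)}
  (I : Listing G D) (F : Set (Sym2 (Fin n))) (k L : ℕ)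

theorem initialStore_arr_zero {j : ℕ} (hj : j < I.edges.length) :
    (I.initialStore F k L).arr 0 j = I.edges[j].1 := by
  simp [initialStore, hj]

theorem initialStore_arr_one {j : ℕ} (hj : j < I.edges.length) :
    (I.initialStore F k L).arr 1 j = I.edges[j].2 := by
  simp [initialStore, hj]

open Classical in
theorem initialStore_arr_two {j : ℕ} (hj : j < I.edges.length) :
    (I.initialStore F k L).arr 2 j = if s(I.edges[j].1, I.edges[j].2) ∈ F then 1 else 0 := by
  simp [initialStore, hj]

theorem initialStore_arr_three (t : Fin m) :
    (I.initialStore F k L).arr 3 t = (I.bag t).length := by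
  simp [initialStore]

/-- Reading past the end gives size zero, so the nonexistent node `m` can play the role of the
additional empty bag. -/
theorem initialStore_arr_three_of_le {t : ℕ} (ht : m ≤ t) :
    (I.initialStore F k L).arr 3 t = 0 := by
  simp [initialStore, ht]

theorem initialStore_arr_four (t : Fin m) {a : ℕ} (ha : a < (I.bag t).length) :
    (I.initialStore F k L).arr 4
      (∑ i ∈ Finset.range t, (I.initialStore F k L).arr 3 i + a) =
      ((I.bag t).map Fin.val).getD a 0 := by
  have h := List.getD_flatten_sum (ls := (List.finRange m).map fun i => (I.bag i).map Fin.val)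
    (t := t) (a := a) (by simp) (by simpa using ha)
  simp only [List.getElem_map, List.getElem_finRange, Fin.cast_mk, Fin.eta] at h
  rw [← h, ← List.flatMap_def]
  simp [initialStore, List.flatMap_singleton_eq_map, Function.comp_def]

theorem initialStore_arr_five (t : Fin m) :
    (I.initialStore F k L).arr 5 t = (I.children t).length := by
  simp [initialStore]

theorem initialStore_arr_six (t : Fin m) (h : 0 < (I.children t).length) :
    (I.initialStore F k L).arr 6 t = (I.children t)[0] := by
  simp [initialStore, h, List.flatMap_singleton_eq_map]

theorem initialStore_arr_seven (t : Fin m) (h : 1 < (I.children t).length) :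
    (I.initialStore F k L).arr 7 t = (I.children t)[1] := by
  simp [initialStore, h, List.flatMap_singleton_eq_map]

theorem initialStore_arr_of_le {a : ℕ} (ha : 8 ≤ a) (i : ℕ) :
    (I.initialStore F k L).arr a i = 0 := by
  simp [initialStore, ha]

end Listing

/-! ### Tabulating offsets, multiples and edge weights -/

namespace RAM

/-- Computes the offsets of the bags and the largest size of a bag. -/
def sizes : Program :=
  forLoop 8 (vr 1) (.write 8 (vr 8) (vr 7) ;; .assign 7 (vr 7 + rd 3 (vr 8)) ;;
    .assign 6 (vr 6 + (rd 3 (vr 8) - vr 6)))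

/-- Tabulates the multiples of the variable `y` in the array `a`. -/
def multiples (a : ℕ) (b : Expr) (y : ℕ) : Program :=
  .assign 7 0 ;; forLoop 8 b (.write a (vr 8) (vr 7) ;; .assign 7 (vr 7 + vr y))

/-- Tabulates the weights of the pairs of vertices. -/
def adjacency : Program :=
  forLoop 8 (vr 4)
    (.write 10 (rd 9 (rd 0 (vr 8)) + rd 1 (vr 8)) (1 + rd 2 (vr 8)) ;;
    .write 10 (rd 9 (rd 1 (vr 8)) + rd 0 (vr 8)) (1 + rd 2 (vr 8)))

theorem sizes_spec {s : Store} {m : ℕ} (h1 : s.var 1 = m) (h6 : s.var 6 = 0) (h7 : s.var 7 = 0) :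
    WP sizes s ((m + 1) * 40) (fun s' =>
      (∀ t < m, s'.arr 8 t = ∑ i ∈ Finset.range t, s.arr 3 i) ∧
      s'.var 6 = (Finset.range m).sup (s.arr 3)) := by
  have hb : (vr 1).eval s = m := h1
  refine (WP.forLoop (t := 30) (by decide) (fun j s' =>
    (∀ t < j, s'.arr 8 t = ∑ i ∈ Finset.range t, s.arr 3 i) ∧
      s'.var 7 = ∑ i ∈ Finset.range j, s.arr 3 i ∧
      s'.var 6 = (Finset.range j).sup (s.arr 3)) ?_ ?_).mono ?_ ?_
  · simp [h6, h7]
  · intro i s' hi hF hi' hI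
    refine WP.straight (by decide) _ (by decide) ?_
    obtain ⟨hI1, hI2, hI3⟩ := hI
    have e3 : s'.arr 3 = s.arr 3 := hF.arr 3 (by decide)
    simp only [Program.straight, Expr.eval_rd, Expr.eval_vr, Expr.eval_add, Expr.eval_sub,
      Store.setVar_var, Store.setVar_arr, Store.setArr_var, Store.setArr_arr, hi', if_true,
      Nat.reduceEqDiff, if_false, true_and, forall_lt_succ_iff, e3, hI2, hI3,
      Finset.sum_range_succ, and_true]
    refine ⟨fun t ht => ?_, ?_⟩
    · rw [if_neg ht.ne]
      exact hI1 t ht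
    · rw [Finset.range_add_one, Finset.sup_insert, max_def]
      split_ifs <;> omega
  · rw [hb]
    exact Nat.mul_le_mul_left _ (by decide)
  · intro s' _ h
    rw [hb] at h
    exact ⟨h.1, h.2.2⟩

theorem multiples_spec {a y : ℕ} {b : Expr} (hb7 : 7 ∉ b.vars) (hy : y ≠ 7) (hy' : y ≠ 8)
    (hok : forOK 8 b (.write a (vr 8) (vr 7) ;; .assign 7 (vr 7 + vr y)) = true) {s : Store} :
    WP (multiples a b y) s ((b.eval s + 1) * (b.cost + 16) + 2)
      (fun s' => ∀ i < b.eval s, s'.arr a i = i * s.var y) := by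
  rw [add_comm]
  refine WP.straight_seq rfl (by decide) fun hF1 => ?_
  set s1 := Program.straight _ s with hs1
  have k7 : s1.var 7 = 0 := by simp [hs1, Program.straight, Expr.eval_zero]
  clear_value s1
  have hb : b.eval s1 = b.eval s := b.eval_congr (fun x hx => hF1.var x (by
    simp only [Program.modV, List.mem_singleton]
    rintro rfl
    exact hb7 hx)) (fun a _ => hF1.arr a (by simp [Program.modA]))
  have ey : s1.var y = s.var y := hF1.var y (by simpa [Program.modV] using hy)
  refine (WP.forLoop (t := 9) hok (fun j s' => (∀ i < j, s'.arr a i = i * s.var y) ∧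
    s'.var 7 = j * s.var y) ?_ ?_).mono ?_ ?_
  · simp [k7]
  · intro i s' hi hF hi' hI
    refine WP.straight rfl _ (Nat.le_of_ble_eq_true rfl) ?_
    have ey' : s'.var y = s.var y := (hF.var y (by simp [forLoop, Program.modV, hy, hy'])).trans ey
    simp only [Program.straight, Expr.eval_vr, Expr.eval_add, Store.setVar_var, Store.setVar_arr,
      Store.setArr_var, Store.setArr_arr, hi', if_true, Nat.reduceEqDiff, if_false, true_and,
      forall_lt_succ_iff, hI.2, ey']
    refine ⟨⟨fun j hj => ?_, trivial⟩, by ring⟩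
    rw [if_neg hj.ne]
    exact hI.1 j hj
  · rw [hb]
    exact Nat.mul_le_mul_left _ (by omega)
  · intro s' _ h
    rw [hb] at h
    exact h.1

/-- The weight matrix is never initialized: untouched memory is zero, which is the weight of a
nonedge, so the time depends on the number of edges and not on `n ^ 2`. Each edge is written in both
orientations. -/
theorem adjacency_spec {n m : ℕ} {G : SimpleGraph (Fin n)} {D : RootedTreeDecomposition G (Fin m)}
    (I : Listing G D) (F : Set (Sym2 (Fin n))) (k L : ℕ) {s : Store}
    (h4 : s.var 4 = I.edges.length) (hs : ∀ a < 8, s.arr a = (I.initialStore F k L).arr a)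
    (h9 : ∀ i < n, s.arr 9 i = i * n) (h10 : ∀ i, s.arr 10 i = 0) :
    WP adjacency s ((I.edges.length + 1) * 60) (fun s' =>
      ∀ u < n, ∀ v < n, s'.arr 10 (u * n + v) = edgeWeight G F u v) := by
  classical
  have hb : (vr 4).eval s = I.edges.length := h4
  refine (WP.forLoop (t := 40) (by decide) (fun j s' => ∀ u v : Fin n,
    s'.arr 10 (u * n + v) = if s(u, v) ∈ (I.edges.take j).map (fun e => s(e.1, e.2)) then
      edgeWeight G F u v else 0) ?_ ?_).mono ?_ ?_
  · simp [h10]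
  · intro i s' hi hF hi' hI
    rw [hb] at hi
    refine WP.straight (by decide) _ (by decide) ?_
    have e0 : s'.arr 0 i = I.edges[i].1 := by
      rw [hF.arr 0 (by decide), hs 0 (by decide), I.initialStore_arr_zero F k L hi]
    have e1 : s'.arr 1 i = I.edges[i].2 := by
      rw [hF.arr 1 (by decide), hs 1 (by decide), I.initialStore_arr_one F k L hi]
    have e2 : s'.arr 2 i = if s(I.edges[i].1, I.edges[i].2) ∈ F then 1 else 0 := by
      rw [hF.arr 2 (by decide), hs 2 (by decide), I.initialStore_arr_two F k L hi]
    have e9 : ∀ v : Fin n, s'.arr 9 v = v * n := fun v => by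
      rw [hF.arr 9 (by decide), h9 v v.2]
    have hadj : G.Adj I.edges[i].1 I.edges[i].2 := by
      have := (I.mem_edges s(I.edges[i].1, I.edges[i].2)).1
        (List.mem_map_of_mem (f := fun e => s(e.1, e.2)) (List.getElem_mem hi))
      simpa using this
    obtain ⟨p, hp⟩ : ∃ p, I.edges[i].1 = p := ⟨_, rfl⟩
    obtain ⟨q, hq⟩ : ∃ q, I.edges[i].2 = q := ⟨_, rfl⟩
    have hpq : I.edges[i] = (p, q) := by rw [← hp, ← hq]
    rw [hp] at e0 e2 hadj
    rw [hq] at e1 e2 hadj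
    have hw : edgeWeight G F p q = 1 + if s(p, q) ∈ F then 1 else 0 := by
      simp only [edgeWeight, p.2, q.2, and_self, dite_true, Fin.eta, hadj, if_true]
      split_ifs <;> rfl
    intro u v
    simp only [Program.straight, Expr.eval_rd, Expr.eval_vr, Expr.eval_add, Expr.eval_one,
      Store.setVar_arr, Store.setArr_var, Store.setArr_arr, hi', e0, e1, e2, e9, true_and,
      Nat.reduceEqDiff, if_false, false_and, ← hw]
    rw [List.take_add_one, List.getElem?_eq_getElem hi, hpq]
    simp only [Option.toList_some, List.map_append, List.map_cons, List.map_nil, List.mem_append,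
      List.mem_singleton, Sym2.eq_iff]
    have hinj : ∀ x y : Fin n, (u * n + v : ℕ) = x * n + y ↔ u = x ∧ v = y := fun x y => by
      constructor
      · intro h
        obtain ⟨h1, h2⟩ := mul_add_inj v.2 y.2 h
        exact ⟨Fin.ext h1, Fin.ext h2⟩
      · rintro ⟨rfl, rfl⟩; rfl
    simp only [hinj]
    have hI' := hI u v
    by_cases h1 : u = p ∧ v = q
    · obtain ⟨rfl, rfl⟩ := h1
      simp
    · by_cases h2 : u = q ∧ v = p
      · obtain ⟨rfl, rfl⟩ := h2
        simp [edgeWeight_symm (G := G) (F := F) (v : ℕ) u]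
      · have h3 : ¬ (p = u ∧ q = v ∨ p = v ∧ q = u) := by grind
        simp only [h1, h2, if_false, hI', or_false]
  · rw [hb]
    exact Nat.mul_le_mul_left _ (by decide)
  · intro s' _ h u hu v hv
    rw [hb] at h
    have := h ⟨u, hu⟩ ⟨v, hv⟩
    rw [List.take_length] at this
    simp only at this
    simp only [I.mem_edges, SimpleGraph.mem_edgeSet] at this
    rw [this]
    split_ifs with hA
    · rfl
    · by_contra hc
      exact hA ((edgeWeight_coe_ne_zero (F := F)).1 (Ne.symm hc))

end RAM

/-! ### Listing the nodes with parents before children -/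

namespace Listing

variable {n m : ℕ} {G : SimpleGraph (Fin n)} {D : RootedTreeDecomposition G (Fin m)}

/-- This is what niceness is for here: the two arrays of children record all of them. -/
theorem length_children_le (I : Listing G D) (hD : D.IsNice) (i : Fin m) :
    (I.children i).length ≤ 2 := by
  classical
  rw [← List.toFinset_card_of_nodup (I.children_nodup i)]
  have key : ∀ s : Finset (Fin m), D.children i = s → s.card ≤ 2 →
      (I.children i).toFinset.card ≤ 2 := fun s hs hc => by
    refine (Finset.card_le_card fun j hj => ?_).trans hc
    rwa [List.mem_toFinset, I.mem_children, hs, Finset.mem_coe] at hj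
  rcases hD i with h | ⟨j, h, -⟩ | ⟨j, h, -⟩ | ⟨j, j', -, h, -⟩
  · exact key ∅ (by simpa using h.1) (by simp)
  · exact key {j} (by simpa using h) (by simp)
  · exact key {j} (by simpa using h) (by simp)
  · exact key {j, j'} (by simpa using h) Finset.card_le_two

end Listing

namespace RAM

variable {n m : ℕ} {G : SimpleGraph (Fin n)} {D : RootedTreeDecomposition G (Fin m)}

/-- Arrays `11` and `12` hold the nodes `q` found so far and the places of their parents; the nodes
before place `h` have been treated. -/
structure Store.Queue (D : RootedTreeDecomposition G (Fin m)) (s : Store) (q : List (Fin m))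
    (h : ℕ) : Prop where
  nodup : q.Nodup
  root : q[0]? = some D.root
  le_length : h ≤ q.length
  head : s.var 11 = h + 1
  tail : s.var 12 = q.length + 1
  dummy : s.arr 11 0 = m
  node : ∀ (a : ℕ) (i : Fin m), q[a]? = some i → s.arr 11 (a + 1) = i
  par_one : s.arr 12 1 = 0
  par_eq : ∀ a < q.length, 0 < a → ∃ b < a, b < h ∧ s.arr 12 (a + 1) = b + 1 ∧
    ∃ i j, q[b]? = some i ∧ q[a]? = some j ∧ j ∈ D.children i
  children_subset : ∀ b < h, ∀ i, q[b]? = some i → ∀ j ∈ D.children i, j ∈ q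

theorem Store.Queue.isOrder {s : Store} {q : List (Fin m)} (h : s.Queue D q q.length) :
    D.IsOrder q (s.arr 12) where
  nodup := h.nodup
  mem := D.mem_of_closed (s := {i | i ∈ q}) (List.mem_of_getElem? h.root) fun i hi j hj => by
    obtain ⟨b, hb⟩ := List.mem_iff_getElem?.1 hi
    exact h.children_subset b (List.getElem?_eq_some_iff.1 hb).1 i hb j hj
  root := h.root
  par_one := h.par_one
  par_eq a ha ha' := by
    obtain ⟨b, hb, -, h'⟩ := h.par_eq a ha ha'
    exact ⟨b, hb, h'⟩

/-- One round of breadth-first search: the children of the node at place `h` are all new, because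
every listed node except the root has its parent at a place before `h`. -/
theorem Store.Queue.append {s s' : Store} {q : List (Fin m)} {h : ℕ} (hq : s.Queue D q h)
    {i : Fin m} (hi : q[h]? = some i) {l : List (Fin m)} (hl : l.Nodup)
    (hmem : ∀ j, j ∈ l ↔ j ∈ D.children i) (h11 : s'.var 11 = h + 2)
    (h12 : s'.var 12 = q.length + l.length + 1)
    (hold : ∀ a < q.length + 1, s'.arr 11 a = s.arr 11 a ∧ s'.arr 12 a = s.arr 12 a)
    (hnew : ∀ (a : ℕ) (j : Fin m), l[a]? = some j →
      s'.arr 11 (q.length + 1 + a) = j ∧ s'.arr 12 (q.length + 1 + a) = h + 1) :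
    s'.Queue D (q ++ l) (h + 1) := by
  have hlt : h < q.length := (List.getElem?_eq_some_iff.1 hi).1
  have hinj : ∀ {a b : ℕ} {i : Fin m}, q[a]? = some i → q[b]? = some i → a = b := fun h1 h2 => by
    obtain ⟨h3, h3'⟩ := List.getElem?_eq_some_iff.1 h1
    obtain ⟨h4, h4'⟩ := List.getElem?_eq_some_iff.1 h2
    exact hq.nodup.getElem_inj_iff.1 (h3'.trans h4'.symm)
  have hdisj : ∀ j ∈ l, j ∉ q := by
    intro j hj hjq
    rw [hmem] at hj
    obtain ⟨a, ha⟩ := List.mem_iff_getElem?.1 hjq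
    rcases Nat.eq_zero_or_pos a with rfl | ha0
    · rw [hq.root, Option.some_inj] at ha
      subst ha
      exact D.root_not_mem_children i hj
    -- A listed child of `i` would have `i` as its parent at a place `b < h`, but `i` stands only at
    -- place `h`.
    · obtain ⟨b, -, hb, -, i', j', hi', hj', hij⟩ :=
        hq.par_eq a (List.getElem?_eq_some_iff.1 ha).1 ha0
      rw [ha, Option.some_inj] at hj'
      subst hj'
      rw [D.parent_unique hij hj] at hi'
      exact hb.ne (hinj hi' hi)
  have hleft : ∀ {a : ℕ}, a < q.length → (q ++ l)[a]? = q[a]? := fun ha =>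
    List.getElem?_append_left ha
  have hright : ∀ {a : ℕ}, q.length ≤ a → (q ++ l)[a]? = l[a - q.length]? := fun ha =>
    List.getElem?_append_right ha
  refine ⟨List.nodup_append'.2 ⟨hq.nodup, hl, fun j hj hj' => hdisj j hj' hj⟩, ?_, ?_, h11, ?_, ?_,
    fun a j ha => ?_, ?_, fun a ha ha0 => ?_, fun b hb i' hi' j hj => ?_⟩
  · rw [hleft (by omega), hq.root]
  · rw [List.length_append]; omega
  · rw [h12, List.length_append]
  · rw [(hold 0 (by omega)).1, hq.dummy]
  · rcases lt_or_ge a q.length with hal | hal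
    · rw [hleft hal] at ha
      rw [(hold (a + 1) (by omega)).1, hq.node a j ha]
    · rw [hright hal] at ha
      rw [← (hnew _ j ha).1]
      congr 1
      omega
  · rw [(hold 1 (by omega)).2, hq.par_one]
  · rcases lt_or_ge a q.length with hal | hal
    · obtain ⟨b, hba, hbh, hp, i', j', hi', hj', hij⟩ := hq.par_eq a hal ha0
      refine ⟨b, hba, by omega, by rw [(hold (a + 1) (by omega)).2, hp], i', j', ?_, ?_, hij⟩
      · rwa [hleft (by omega)]
      · rwa [hleft hal]
    · rw [List.length_append] at ha
      have hj := List.getElem?_eq_getElem (l := l) (i := a - q.length) (by omega)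
      refine ⟨h, by omega, by omega, ?_, i, _, by rwa [hleft hlt], by rw [hright hal, hj],
        (hmem _).1 (List.getElem_mem _)⟩
      rw [← (hnew _ _ hj).2]
      congr 1
      omega
  · rw [List.mem_append]
    rcases Nat.lt_succ_iff_lt_or_eq.1 hb with hb | rfl
    · rw [hleft (by omega)] at hi'
      exact .inl (hq.children_subset b hb i' hi' j hj)
    · rw [hleft hlt, hi, Option.some_inj] at hi'
      subst hi'
      exact .inr ((hmem j).2 hj)

/-- Appends the child recorded in the array `a` of the node `var 13`. -/
def pushChild (a : ℕ) : Program :=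
  .write 11 (vr 12) (rd a (vr 13)) ;; .write 12 (vr 12) (vr 11) ;; .assign 12 (vr 12 + 1)

/-- Lists the nodes of the tree, parents before children. -/
def order : Program :=
  (.write 11 0 (vr 1) ;; .write 11 1 (vr 5) ;; .write 12 1 0 ;; .assign 11 1 ;; .assign 12 2) ;;
  .loop (vr 12 - vr 11)
    (.assign 13 (rd 11 (vr 11)) ;;
    .branch (rd 5 (vr 13)) (pushChild 6) .skip ;;
    .branch (rd 5 (vr 13) - 1) (pushChild 7) .skip ;;
    .assign 11 (vr 11 + 1))

/-- The head of the queue advances in every round and nodes never repeat, so there are at most `m`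
rounds. When head and tail meet, the list is closed under children and contains the root, hence it
contains every node. -/
theorem order_spec (I : Listing G D) (hD : D.IsNice) (F : Set (Sym2 (Fin n))) (k L : ℕ) {s : Store}
    (h1 : s.var 1 = m) (h5 : s.var 5 = D.root)
    (hs : ∀ a < 8, s.arr a = (I.initialStore F k L).arr a) :
    WP order s (20 + (m + 1) * 50) (fun s' => ∃ q, s'.Queue D q q.length) := by
  refine WP.straight_seq (by decide) (by decide) fun hF1 => ?_
  set s1 := Program.straight _ s with hs1
  have hs' : ∀ a < 8, s1.arr a = (I.initialStore F k L).arr a := fun a ha => by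
    rw [← hs a ha]
    exact hF1.arr a (by simp [Program.modA]; omega)
  have hQ : s1.Queue D [D.root] 0 := by
    refine ⟨by simp, rfl, by simp, ?_, ?_, ?_, ?_, ?_, ?_, by simp⟩
    · simp [hs1, Program.straight, Expr.eval_one]
    · simp [hs1, Program.straight, Expr.eval_two]
    · simp [hs1, Program.straight, Expr.eval_one, Expr.eval_zero, Expr.eval_vr, h1]
    · intro a i ha
      obtain ⟨ha', rfl⟩ := List.getElem?_eq_some_iff.1 ha
      simp only [List.length_singleton, Nat.lt_one_iff] at ha'
      subst ha'
      simp [hs1, Program.straight, Expr.eval_one, Expr.eval_vr, h5]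
    · simp [hs1, Program.straight, Expr.eval_one, Expr.eval_zero]
    · intro a ha ha'
      simp at ha
      omega
  clear_value s1
  have hlen : ∀ {s : Store} {q : List (Fin m)} {h : ℕ}, s.Queue D q h → q.length ≤ m :=
    fun h => by simpa using List.Nodup.length_le_card h.nodup
  refine (WP.loop (t := 40) (I := fun s' => (∃ q h, s'.Queue D q h) ∧
    ∀ a < 8, s'.arr a = (I.initialStore F k L).arr a) (μ := fun s' => m + 1 - s'.var 11) ?_
    ⟨⟨_, _, hQ⟩, hs'⟩).mono ?_ ?_
  · rintro s ht ⟨⟨q, h, hq⟩, hs⟩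
    simp only [Expr.eval_sub, Expr.eval_vr, hq.head, hq.tail] at ht
    have hlt : h < q.length := by omega
    have hi := List.getElem?_eq_getElem hlt
    set i := q[h]
    have := hlen hq
    have e5 : s.arr 5 i = (I.children i).length := by
      rw [hs 5 (by decide), I.initialStore_arr_five]
    have e13 : s.arr 11 (h + 1) = i := hq.node h i hi
    refine WP.straight (by decide) s (by decide) ?_
    set s' := Program.straight _ s with hs'
    have hF : ∀ a < 8, s'.arr a = s.arr a := fun a ha =>
      (WP.straight (Q := fun r => r = s') (by decide) s le_rfl rfl).elim
        fun r ⟨_, hx, _, hr⟩ => hr ▸ hx.frame.arr a (by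
          simp [Program.modA, pushChild]; omega)
    have key : s'.var 11 = h + 2 ∧ s'.var 12 = q.length + (I.children i).length + 1 ∧
        (∀ a < q.length + 1, s'.arr 11 a = s.arr 11 a ∧ s'.arr 12 a = s.arr 12 a) ∧
        ∀ (a : ℕ) (j : Fin m), (I.children i)[a]? = some j →
          s'.arr 11 (q.length + 1 + a) = j ∧ s'.arr 12 (q.length + 1 + a) = h + 1 := by
      have e6 := I.initialStore_arr_six F k L i
      have e7 := I.initialStore_arr_seven F k L i
      rw [← hs 6 (by decide)] at e6
      rw [← hs 7 (by decide)] at e7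
      have h2 := I.length_children_le hD i
      rw [hs']
      generalize I.children i = l at *
      match l with
      | [] =>
        simp [Program.straight, Expr.eval_rd, Expr.eval_vr, Expr.eval_add, Expr.eval_sub,
          Expr.eval_one, hq.head, hq.tail, e13, e5]
      | [x] =>
        simp only [List.length_singleton, zero_lt_one, forall_true_left, List.getElem_cons_zero]
          at e6
        simp [Program.straight, pushChild, Expr.eval_rd, Expr.eval_vr, Expr.eval_add,
          Expr.eval_sub, Expr.eval_one, hq.head, hq.tail, e13, e5, e6]
        refine ⟨fun a ha => by omega, fun a j ha => ?_⟩
        match a with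
        | 0 => simp_all
        | _ + 1 => simp at ha
      | [x, y] =>
        simp only [List.length_cons, List.length_nil, zero_add, Nat.reduceAdd, Nat.reduceLT,
          forall_true_left, List.getElem_cons_zero, List.getElem_cons_succ] at e6 e7 e5
        simp [Program.straight, pushChild, Expr.eval_rd, Expr.eval_vr, Expr.eval_add,
          Expr.eval_sub, Expr.eval_one, hq.head, hq.tail, e13, e5, e6, e7]
        refine ⟨fun a ha => ?_, fun a j ha => ?_⟩
        · rw [if_neg (by omega), if_neg (by omega), if_neg (by omega), if_neg (by omega)]
          exact ⟨rfl, rfl⟩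
        · match a with
          | 0 => simp_all
          | 1 => simp_all
          | _ + 2 => simp at ha
      | _ :: _ :: _ :: _ => simp at h2
    exact ⟨⟨⟨_, _, hq.append hi (I.children_nodup i) (I.mem_children i) key.1 key.2.1 key.2.2.1
      key.2.2.2⟩, fun a ha => (hF a ha).trans (hs a ha)⟩, by rw [key.1, hq.head]; omega⟩
  · rw [hQ.head]
    have : (vr 12 - vr 11).cost = 3 := rfl
    rw [this]
    omega
  · rintro s' - ⟨⟨⟨q, h, hq⟩, -⟩, h0⟩
    simp only [Expr.eval_sub, Expr.eval_vr, hq.head, hq.tail] at h0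
    have := hq.le_length
    obtain rfl : h = q.length := by omega
    exact ⟨q, hq⟩

end RAM

/-! ### Tabulating places in bags and computing the number of states -/

namespace RAM

/-- Tabulates the places of the vertices in the bags. -/
def places : Program :=
  forLoop 8 (vr 1 + 1)
    (.assign 13 (rd 11 (vr 8)) ;;
    forLoop 14 (rd 3 (vr 13))
      (.write 14 (rd 9 (vr 8) + rd 4 (rd 8 (vr 13) + vr 14)) (vr 14 + 1)))

theorem places_spec {s : Store} {m n S : ℕ} {b : ℕ → List ℕ} (h1 : s.var 1 = m)
    (hnd : ∀ t, (b t).Nodup) (hlt : ∀ t ≤ m, ∀ v ∈ b t, v < n)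
    (hS : ∀ t ≤ m, (b t).length ≤ S) (h3 : ∀ t ≤ m, s.arr 3 (s.arr 11 t) = (b t).length)
    (h4 : ∀ t ≤ m, ∀ a < (b t).length, s.arr 4 (s.arr 8 (s.arr 11 t) + a) = (b t).getD a 0)
    (h9 : ∀ t ≤ m, s.arr 9 t = t * n) (h14 : ∀ i, s.arr 14 i = 0) :
    WP places s ((m + 2) * ((S + 1) * 40 + 20)) (fun s' => ∀ t ≤ m, ∀ v < n,
      s'.arr 14 (t * n + v) = if v ∈ b t then (b t).idxOf v + 1 else 0) := by
  have hb : (vr 1 + 1).eval s = m + 1 := by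
    simp [Expr.eval_add, Expr.eval_vr, Expr.eval_one, h1]
  refine (WP.forLoop (t := 3 + (S + 1) * 40) (by decide) (fun j s' => ∀ t, ∀ v < n,
    s'.arr 14 (t * n + v) = if t < j ∧ v ∈ b t then (b t).idxOf v + 1 else 0) ?_ ?_).mono ?_ ?_
  · simp [h14]
  · intro i s' hi hF hi' hI
    rw [hb] at hi
    refine WP.straight_seq rfl (by decide) fun hF1 => ?_
    set s1 := Program.straight _ s' with hs1
    have e11 : s'.arr 11 = s.arr 11 := hF.arr 11 (by decide)
    have k13 : s1.var 13 = s.arr 11 i := by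
      simp [hs1, Program.straight, Expr.eval_rd, Expr.eval_vr, hi', e11]
    have k8 : s1.var 8 = i := (hF1.var 8 (by decide)).trans hi'
    have k14 : s1.arr 14 = s'.arr 14 := rfl
    have e : ∀ a, a ≠ 14 → s1.arr a = s.arr a := fun a ha =>
      hF.arr a (by simpa [places, forLoop, Program.modA] using ha)
    clear_value s1
    have hb' : (rd 3 (vr 13)).eval s1 = (b i).length := by
      rw [Expr.eval_rd, Expr.eval_vr, k13, e 3 (by decide), h3 i (by omega)]
    -- Earlier bags are complete, and of the bag `i` the first `j` vertices are recorded. Entries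
    -- not yet written are zero, which already means absence.
    refine (WP.forLoop (t := 20) (by decide) (fun j s' => ∀ t, ∀ v < n,
      s'.arr 14 (t * n + v) = if t < i ∧ v ∈ b t ∨ t = i ∧ v ∈ (b t).take j then
        (b t).idxOf v + 1 else 0) ?_ ?_).mono ?_ ?_
    · simp only [Store.setVar_arr, k14, List.take_zero, List.not_mem_nil, and_false, or_false]
      exact hI
    · intro j s2 hj hF2 hj' hI2
      rw [hb'] at hj
      refine WP.straight (by decide) _ (by decide) ?_
      have e' : ∀ a, a ≠ 14 → s2.arr a = s.arr a := fun a ha =>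
        (hF2.arr a (by simpa [forLoop, Program.modA] using ha)).trans (e a ha)
      have k8' : s2.var 8 = i := (hF2.var 8 (by decide)).trans k8
      have k13' : s2.var 13 = s.arr 11 i := (hF2.var 13 (by decide)).trans k13
      intro t v hv
      have hget : (b i).getD j 0 = (b i)[j] := List.getD_eq_getElem _ _ hj
      simp only [Program.straight, Expr.eval_rd, Expr.eval_vr, Expr.eval_add, Expr.eval_one,
        Store.setVar_arr, Store.setArr_arr, hj', k8', k13', e' 9 (by decide), e' 4 (by decide),
        e' 8 (by decide), h9 i (by omega), h4 i (by omega) j hj, true_and, hget]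
      have hlt' := hlt i (by omega) _ (List.getElem_mem hj)
      by_cases hc : t = i ∧ v = (b i)[j]
      · obtain ⟨rfl, rfl⟩ := hc
        rw [if_pos rfl, if_pos, (hnd t).idxOf_getElem]
        exact .inr ⟨rfl, List.mem_take_iff_getElem.2 ⟨j, by omega, rfl⟩⟩
      · rw [if_neg fun h => hc (by
          obtain ⟨h1, h2⟩ := mul_add_inj hv hlt' h
          exact ⟨h1, h2⟩), hI2 t v hv]
        refine if_congr (or_congr_right (and_congr_right fun ht => ?_)) rfl rfl
        subst ht
        rw [List.take_add_one, List.getElem?_eq_getElem hj]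
        simp only [Option.toList_some, List.mem_append, List.mem_singleton]
        simp only [true_and] at hc
        simp [hc]
    · rw [hb']
      exact Nat.mul_le_mul (by have := hS i (by omega); omega) (by decide)
    · intro s2 _ h t v hv
      rw [hb'] at h
      rw [Store.setVar_arr, h t v hv]
      refine if_congr ?_ rfl rfl
      constructor
      · rintro (h | ⟨rfl, h⟩)
        · exact ⟨by omega, h.2⟩
        · exact ⟨by omega, List.mem_of_mem_take h⟩
      · rintro ⟨h, h'⟩
        rcases Nat.lt_succ_iff_lt_or_eq.1 h with h | rfl
        · exact .inl ⟨h, h'⟩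
        · exact .inr ⟨rfl, by rwa [List.take_length]⟩
  · rw [hb]
    refine Nat.mul_le_mul_left _ ?_
    have : (vr 1 + 1 : Expr).cost = 3 := rfl
    omega
  · intro s' _ h t ht v hv
    rw [hb] at h
    rw [h t v hv]
    simp only [show t < m + 1 by omega, true_and]

/-- Computes the number of colors with positions and flags, and its power with exponent
`var 6`. -/
def counts : Program :=
  (.assign 15 (vr 3 + vr 3 + vr 3 + vr 3) ;; .assign 10 0) ;;
  forLoop 8 (vr 15) (.assign 10 (vr 10 + vr 2 + 1)) ;;
  .assign 9 1 ;;
  forLoop 8 (vr 6) (.assign 7 0 ;; forLoop 14 (vr 10) (.assign 7 (vr 7 + vr 9)) ;;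
    .assign 9 (vr 7))

/-- Products are computed by repeated addition: `4 * L` summands `k + 1`, then `S` multiplications
by `stateCount L k`. In this way `k` enters the number of rounds only through the number of states.
-/
theorem counts_spec {s : Store} {k L S : ℕ} (h2 : s.var 2 = k) (h3 : s.var 3 = L)
    (h6 : s.var 6 = S) :
    WP counts s (20 + ((4 * L + 1) * 30 + (2 + (S + 1) * ((stateCount L k + 1) * 20 + 20))))
      (fun s' => s'.var 10 = stateCount L k ∧ s'.var 9 = stateCount L k ^ S) := by
  refine WP.straight_seq rfl (by decide) fun hF1 => ?_
  set s1 := Program.straight _ s with hs1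
  have k15 : s1.var 15 = 4 * L := by
    simp [hs1, Program.straight, Expr.eval_add, Expr.eval_vr, h3]
    omega
  have k10 : s1.var 10 = 0 := by simp [hs1, Program.straight, Expr.eval_zero]
  have k2 : s1.var 2 = k := (hF1.var 2 (by decide)).trans h2
  have k6 : s1.var 6 = S := (hF1.var 6 (by decide)).trans h6
  clear_value s1
  have hb1 : (vr 15).eval s1 = 4 * L := k15
  refine WP.seq (R := fun s' => s'.var 10 = stateCount L k)
    ((WP.forLoop (t := 10) (by decide) (fun j s' => s'.var 10 = j * (k + 1)) ?_ ?_).mono ?_ ?_)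
    fun s2 hF2 hs2 => ?_
  · simp [k10]
  · intro i s' hi hF hi' hI
    refine WP.straight (by decide) _ (by decide) ?_
    have k2' : s'.var 2 = k := (hF.var 2 (by decide)).trans k2
    simp [Program.straight, Expr.eval_add, Expr.eval_vr, Expr.eval_one, hI, k2']
    ring
  · rw [hb1]
    exact Nat.mul_le_mul_left _ (by decide)
  · intro s' _ h
    rw [hb1] at h
    rw [h, stateCount]
    ring
  · have k6' : s2.var 6 = S := (hF2.var 6 (by decide)).trans k6
    refine WP.straight_seq rfl (by decide) fun hF3 => ?_
    set s3 := Program.straight _ s2 with hs3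
    have k9 : s3.var 9 = 1 := by simp [hs3, Program.straight, Expr.eval_one]
    have k6'' : s3.var 6 = S := (hF3.var 6 (by decide)).trans k6'
    have k10' : s3.var 10 = stateCount L k := (hF3.var 10 (by decide)).trans hs2
    clear_value s3
    have hb2 : (vr 6).eval s3 = S := k6''
    refine (WP.forLoop (t := 2 + ((stateCount L k + 1) * 20 + 2)) (by decide)
      (fun j s' => s'.var 10 = stateCount L k ∧ s'.var 9 = stateCount L k ^ j) ?_ ?_).mono ?_ ?_
    · simp [k9, k10']
    · intro i s' hi hF hi' hI
      obtain ⟨hI, hI'⟩ := hI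
      refine WP.straight_seq rfl (by decide) fun hF4 => ?_
      set s4 := Program.straight _ s' with hs4
      have j7 : s4.var 7 = 0 := by simp [hs4, Program.straight, Expr.eval_zero]
      have j9 : s4.var 9 = stateCount L k ^ i := (hF4.var 9 (by decide)).trans hI'
      have j10 : s4.var 10 = stateCount L k := (hF4.var 10 (by decide)).trans hI
      clear_value s4
      have hb3 : (vr 10).eval s4 = stateCount L k := j10
      refine WP.seq (R := fun s' => s'.var 7 = stateCount L k * stateCount L k ^ i)
        ((WP.forLoop (t := 10) (by decide) (fun j s' => s'.var 7 = j * stateCount L k ^ i) ?_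
          ?_).mono ?_ ?_) fun s5 hF5 hs5 => ?_
      · simp [j7]
      · intro j s6 hj hF6 hj' hI6
        refine WP.straight (by decide) _ (by decide) ?_
        have j9' : s6.var 9 = stateCount L k ^ i := (hF6.var 9 (by decide)).trans j9
        simp [Program.straight, Expr.eval_add, Expr.eval_vr, hI6, j9']
        ring
      · rw [hb3]
        exact Nat.mul_le_mul_left _ (by decide)
      · intro s' _ h
        rwa [hb3] at h
      · refine WP.straight rfl _ (by decide) ?_
        have j10' : s5.var 10 = stateCount L k := (hF5.var 10 (by decide)).trans j10
        simp [Program.straight, Expr.eval_vr, hs5, j10', pow_succ']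
    · rw [hb2]
      refine Nat.mul_le_mul_left _ ?_
      have : (vr 6).cost = 1 := rfl
      omega
    · intro s' _ h
      rwa [hb2] at h

end RAM

/-! ### Bounds on vertices, edges and bags -/

namespace Listing

variable {n m : ℕ} {G : SimpleGraph (Fin n)} {D : RootedTreeDecomposition G (Fin m)}
  (I : Listing G D)

/-- The size of the largest bag. -/
def maxBag (D : RootedTreeDecomposition G (Fin m)) : ℕ :=
  Finset.univ.sup fun i => (D.bag i).card

theorem card_bag_le (i : Fin m) : (D.bag i).card ≤ maxBag D :=
  Finset.le_sup (f := fun i => (D.bag i).card) (Finset.mem_univ i)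

theorem length_bag (i : Fin m) : (I.bag i).length = (D.bag i).card := by
  rw [← List.toFinset_card_of_nodup (I.bag_nodup i)]
  congr 1
  ext v
  rw [List.mem_toFinset, I.mem_bag]

theorem length_bagList_le (q : List (Fin m)) (t : ℕ) : (I.bagList q t).length ≤ maxBag D := by
  cases t with
  | zero => simp [bagList]
  | succ h =>
    cases hi : q[h]? with
    | none => simp [bagList, hi]
    | some i =>
      rw [I.bagList_succ hi, List.length_map, I.length_bag]
      exact card_bag_le i

theorem sup_arr_three (F : Set (Sym2 (Fin n))) (k L : ℕ) :
    (Finset.range m).sup ((I.initialStore F k L).arr 3) = maxBag D := by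
  refine le_antisymm (Finset.sup_le fun t ht => ?_) (Finset.sup_le fun i _ => ?_)
  · rw [Finset.mem_range] at ht
    rw [I.initialStore_arr_three F k L ⟨t, ht⟩, I.length_bag]
    exact card_bag_le _
  · rw [← I.length_bag, ← I.initialStore_arr_three F k L i]
    exact Finset.le_sup (f := (I.initialStore F k L).arr 3) (Finset.mem_range.2 i.2)

theorem card_vertices_le (D : RootedTreeDecomposition G (Fin m)) : n ≤ m * maxBag D := by
  have h : (Finset.univ : Finset (Fin n)) ⊆ Finset.univ.biUnion D.bag := fun v _ => by
    simpa using D.exists_mem_bag v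
  have := (Finset.card_le_card h).trans
    (Finset.card_biUnion_le_card_mul _ _ (maxBag D) fun i _ => card_bag_le i)
  simpa using this

/-- Every edge is a pair inside one of the `m` bags, which makes reading all edges affordable. -/
theorem length_edges_le : I.edges.length ≤ m * (maxBag D * maxBag D) := by
  classical
  have h : (I.edges.map fun e => s(e.1, e.2)).toFinset ⊆ Finset.univ.biUnion fun i =>
      (D.bag i ×ˢ D.bag i).image fun e => s(e.1, e.2) := fun e he => by
    rw [List.mem_toFinset, I.mem_edges] at he
    induction e with
    | _ u v =>
      obtain ⟨i, hu, hv⟩ := D.exists_edge_bag u v he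
      exact Finset.mem_biUnion.2 ⟨i, Finset.mem_univ i, Finset.mem_image.2
        ⟨(u, v), Finset.mem_product.2 ⟨hu, hv⟩, rfl⟩⟩
  have := (Finset.card_le_card h).trans (Finset.card_biUnion_le_card_mul _ _
    (maxBag D * maxBag D) fun i _ => Finset.card_image_le.trans (by
      rw [Finset.card_product]
      exact Nat.mul_le_mul (card_bag_le i) (card_bag_le i)))
  rw [List.toFinset_card_of_nodup I.edges_nodup] at this
  simpa using this

/-- The correctness of the search program doubles as the existence proof; its input is irrelevant
beyond the tree. -/
theorem exists_isOrder (I : Listing G D) (hD : D.IsNice) : ∃ q par, D.IsOrder q par := by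
  obtain ⟨s, t, -, -, q, hq⟩ := RAM.order_spec I hD ∅ 0 0 (s := I.initialStore ∅ 0 0) rfl rfl
    fun _ _ => rfl
  exact ⟨q, _, hq.isOrder⟩

end Listing

/-! ### The complete preparation and the whole program -/

namespace RAM

variable {n m : ℕ} {G : SimpleGraph (Fin n)} {D : RootedTreeDecomposition G (Fin m)}

/-- Tabulates everything which the merging needs. -/
def prepare : Program :=
  multiples 9 (vr 0 + vr 1 + 1) 0 ;; adjacency ;; order ;; places ;; counts ;;
    multiples 19 (vr 6 + vr 1 + 1) 9 ;; decode

/-- The whole program. -/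
def solve : Program :=
  sizes ;; .branch (vr 6 - vr 3)
    (.branch (vr 3) (prepare ;; mergeAll ;; readAnswer) (.assign 0 0)) (.assign 0 1)

theorem Store.Queue.length_eq {s : Store} {q : List (Fin m)} (hq : s.Queue D q q.length) :
    q.length = m := by
  have := List.toFinset_card_of_nodup hq.nodup
  rw [← this, show q.toFinset = Finset.univ from Finset.eq_univ_iff_forall.2 fun i => by
    simpa using hq.isOrder.mem i]
  simp

theorem prepare_spec (I : Listing G D) (hD : D.IsNice) (F : Set (Sym2 (Fin n))) {k L : ℕ}
    (hL : 0 < L) {s : Store} (hv : ∀ x < 6, s.var x = (I.initialStore F k L).var x)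
    (h6 : s.var 6 = Listing.maxBag D) (hs : ∀ a < 8, s.arr a = (I.initialStore F k L).arr a)
    (h8 : ∀ t < m, s.arr 8 t = ∑ i ∈ Finset.range t, s.arr 3 i)
    (h0 : ∀ a, 9 ≤ a → ∀ i, s.arr a i = 0) :
    WP prepare s (((n + m + 2) * 21 + 2) + ((I.edges.length + 1) * 60 + ((20 + (m + 1) * 50) +
      ((m + 2) * ((Listing.maxBag D + 1) * 40 + 20) +
      ((20 + ((4 * L + 1) * 30 +
        (2 + (Listing.maxBag D + 1) * ((stateCount L k + 1) * 20 + 20)))) +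
      (((Listing.maxBag D + m + 2) * 21 + 2) +
      (stateCount L k ^ Listing.maxBag D + 1) * ((Listing.maxBag D + 1) *
        ((stateCount L k ^ Listing.maxBag D + 2) * 160 + 8) + 10)))))))
      (fun s' => (∃ q par, ∃ h : D.IsOrder q par,
        Ready (I.toBagSequence F h) (digitCode (Listing.maxBag D) k L hL) s') ∧
        ∀ i, s'.arr 20 i = 0) := by
  set S := Listing.maxBag D with hS
  have v0 : s.var 0 = n := hv 0 (by decide)
  have v1 : s.var 1 = m := hv 1 (by decide)
  have v2 : s.var 2 = k := hv 2 (by decide)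
  have v3 : s.var 3 = L := hv 3 (by decide)
  have v4 : s.var 4 = I.edges.length := hv 4 (by decide)
  have v5 : s.var 5 = D.root := hv 5 (by decide)
  have hb1 : (vr 0 + vr 1 + 1).eval s = n + m + 1 := by
    simp [Expr.eval_add, Expr.eval_vr, Expr.eval_one, v0, v1]
  refine ((multiples_spec (by decide) (by decide) (by decide) (by decide)).mono
    (le_of_eq (by rw [hb1]; rfl)) fun _ _ h => h).seq fun s1 F1 g1 => ?_
  rw [hb1, v0] at g1
  refine (adjacency_spec I F k L ((F1.var 4 (by decide)).trans v4)
    (fun a ha => (F1.arr a (by simp [multiples, forLoop, Program.modA]; omega)).trans (hs a ha))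
    (fun i hi => g1 i (by omega))
    (fun i => by rw [F1.arr 10 (by decide), h0 10 (by decide)])).seq fun s2 F2 g2 => ?_
  refine (order_spec I hD F k L (s := s2) (by
      rw [F2.var 1 (by decide), F1.var 1 (by decide), v1]) (by
      rw [F2.var 5 (by decide), F1.var 5 (by decide), v5]) (fun a ha => by
      rw [F2.arr a (by simp [adjacency, forLoop, Program.modA]; omega),
        F1.arr a (by simp [multiples, forLoop, Program.modA]; omega), hs a ha])).seq
    fun s3 F3 g3 => ?_
  obtain ⟨q, hq⟩ := g3
  have hlen := hq.length_eq
  have hnode : ∀ t ≤ m, t = 0 ∧ s3.arr 11 t = m ∨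
      ∃ a i, t = a + 1 ∧ q[a]? = some i ∧ s3.arr 11 t = (i : Fin m) := fun t ht => by
    cases t with
    | zero => exact .inl ⟨rfl, hq.dummy⟩
    | succ a =>
      have hi := List.getElem?_eq_getElem (l := q) (i := a) (by omega)
      exact .inr ⟨a, _, rfl, hi, hq.node a _ hi⟩
  have e3 : s3.arr 3 = (I.initialStore F k L).arr 3 := by
    rw [F3.arr 3 (by decide), F2.arr 3 (by decide), F1.arr 3 (by decide), hs 3 (by decide)]
  have e4 : s3.arr 4 = (I.initialStore F k L).arr 4 := by
    rw [F3.arr 4 (by decide), F2.arr 4 (by decide), F1.arr 4 (by decide), hs 4 (by decide)]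
  have e8 : s3.arr 8 = s.arr 8 := by
    rw [F3.arr 8 (by decide), F2.arr 8 (by decide), F1.arr 8 (by decide)]
  have e9 : ∀ i < n + m + 1, s3.arr 9 i = i * n := fun i hi => by
    rw [F3.arr 9 (by decide), F2.arr 9 (by decide), g1 i hi]
  have hl3 : ∀ t ≤ m, s3.arr 3 (s3.arr 11 t) = (I.bagList q t).length := fun t ht => by
    rcases hnode t ht with ⟨rfl, h⟩ | ⟨a, i, rfl, hi, h⟩
    · rw [h, e3, I.initialStore_arr_three_of_le F k L le_rfl]
      rfl
    · rw [h, e3, I.initialStore_arr_three, I.bagList_succ hi, List.length_map]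
  have hl4 : ∀ t ≤ m, ∀ a < (I.bagList q t).length,
      s3.arr 4 (s3.arr 8 (s3.arr 11 t) + a) = (I.bagList q t).getD a 0 := fun t ht a ha => by
    rcases hnode t ht with ⟨rfl, h⟩ | ⟨b, i, rfl, hi, h⟩
    · simp [Listing.bagList] at ha
    · rw [I.bagList_succ hi, List.length_map] at ha
      rw [h, e4, e8, h8 i i.2, hs 3 (by decide), I.initialStore_arr_four F k L i ha,
        I.bagList_succ hi]
  have hltn : ∀ t ≤ m, ∀ v ∈ I.bagList q t, v < n := fun t _ v hvt => by
    obtain ⟨-, -, w, -, -, rfl, -⟩ := I.exists_of_mem_bagList hvt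
    exact w.2
  have w1 : s3.var 1 = m := by
    rw [F3.var 1 (by decide), F2.var 1 (by decide), F1.var 1 (by decide), v1]
  refine (places_spec w1 (fun t => I.bagList_nodup t) hltn (fun t _ => I.length_bagList_le q t)
    hl3 hl4 (fun t ht => e9 t (by omega)) (fun i => by
      rw [F3.arr 14 (by decide), F2.arr 14 (by decide), F1.arr 14 (by decide),
        h0 14 (by decide)])).seq fun s4 F4 g4 => ?_
  refine (counts_spec (k := k) (L := L) (S := S) (by
      rw [F4.var 2 (by decide), F3.var 2 (by decide), F2.var 2 (by decide), F1.var 2 (by decide),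
        v2]) (by
      rw [F4.var 3 (by decide), F3.var 3 (by decide), F2.var 3 (by decide), F1.var 3 (by decide),
        v3]) (by
      rw [F4.var 6 (by decide), F3.var 6 (by decide), F2.var 6 (by decide), F1.var 6 (by decide),
        h6])).seq fun s5 F5 g5 => ?_
  have x1 : s5.var 1 = m := by rw [F5.var 1 (by decide), F4.var 1 (by decide), w1]
  have x6 : s5.var 6 = S := by
    rw [F5.var 6 (by decide), F4.var 6 (by decide), F3.var 6 (by decide), F2.var 6 (by decide),
      F1.var 6 (by decide), h6]
  have hb2 : (vr 6 + vr 1 + 1).eval s5 = S + m + 1 := by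
    simp [Expr.eval_add, Expr.eval_vr, Expr.eval_one, x1, x6]
  refine ((multiples_spec (by decide) (by decide) (by decide) (by decide)).mono
    (le_of_eq (by rw [hb2]; rfl)) fun _ _ h => h).seq fun s6 F6 g6 => ?_
  rw [hb2, g5.2] at g6
  have x9 : s6.var 9 = stateCount L k ^ S := (F6.var 9 (by decide)).trans g5.2
  refine (decode_spec hL (k := k) (S := S) (by
      rw [F6.var 2 (by decide), F5.var 2 (by decide), F4.var 2 (by decide), F3.var 2 (by decide),
        F2.var 2 (by decide), F1.var 2 (by decide), v2]) (by
      rw [F6.var 3 (by decide), F5.var 3 (by decide), F4.var 3 (by decide), F3.var 3 (by decide),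
        F2.var 3 (by decide), F1.var 3 (by decide), v3]) ((F6.var 6 (by decide)).trans x6) x9
      (fun i hi => g6 i (by omega))).mono le_rfl fun s7 F7 g7 => ?_
  -- After the nodes have been ordered, only the arrays `14` to `19` are written.
  have late : ∀ a, a ≠ 14 → a ≠ 15 → a ≠ 16 → a ≠ 17 → a ≠ 18 → a ≠ 19 →
      s7.arr a = s3.arr a := fun a h1 h2 h3 h4 h5 h6 => by
    rw [F7.arr a (by simp [decode, divide, forLoop, Program.modA]; omega),
      F6.arr a (by simp [multiples, forLoop, Program.modA]; omega),
      F5.arr a (by simp [counts, forLoop, Program.modA]),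
      F4.arr a (by simp [places, forLoop, Program.modA]; omega)]
  have l14 : s7.arr 14 = s4.arr 14 := by
    rw [F7.arr 14 (by decide), F6.arr 14 (by decide), F5.arr 14 (by decide)]
  refine ⟨⟨q, s3.arr 12, hq.isOrder, ?_⟩, fun i => ?_⟩
  · have hlt' : ∀ t ≤ m, ∀ a < (I.bagList q t).length, (I.bagList q t).getD a 0 < n :=
      fun t ht a ha => hltn t ht _ (by
        rw [List.getD_eq_getElem _ _ ha]
        exact List.getElem_mem ha)
    constructor
    · rw [F7.var 1 (by decide), F6.var 1 (by decide), x1]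
      rfl
    · rw [F7.var 9 (by decide), x9]
    · exact fun t _ => I.length_bagList_le q t
    · intro t ht
      rw [late 3 (by decide) (by decide) (by decide) (by decide) (by decide) (by decide),
        late 11 (by decide) (by decide) (by decide) (by decide) (by decide) (by decide)]
      exact hl3 t ht
    · intro t ht a ha
      rw [late 4 (by decide) (by decide) (by decide) (by decide) (by decide) (by decide),
        late 8 (by decide) (by decide) (by decide) (by decide) (by decide) (by decide),
        late 11 (by decide) (by decide) (by decide) (by decide) (by decide) (by decide)]
      exact hl4 t ht a ha
    · intro t ht a ha b hb
      have ha' := hlt' t ht a ha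
      have hb' := hlt' t ht b hb
      rw [late 10 (by decide) (by decide) (by decide) (by decide) (by decide) (by decide),
        late 9 (by decide) (by decide) (by decide) (by decide) (by decide) (by decide)]
      change s3.arr 10 (s3.arr 9 ((I.bagList q t).getD b 0) + (I.bagList q t).getD a 0) =
        edgeWeight G F ((I.bagList q t).getD b 0) ((I.bagList q t).getD a 0)
      rw [e9 _ (by omega), F3.arr 10 (by decide), g2 _ hb' _ ha']
    · intro t ht t' ht' a ha
      change t' ≤ m at ht'
      rw [late 9 (by decide) (by decide) (by decide) (by decide) (by decide) (by decide), l14,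
        e9 t' (by omega)]
      exact g4 t' ht' _ (hlt' t ht a ha)
    · intro h _ _
      rw [late 12 (by decide) (by decide) (by decide) (by decide) (by decide) (by decide)]
      rfl
    · intro i hi
      change i < S + m + 1 at hi
      rw [F7.arr 19 (by decide), g6 i hi]
    · exact fun X hX a ha => (g7 X hX a ha).1
    · exact fun X hX a ha => (g7 X hX a ha).2.1
    · exact fun X hX a ha => (g7 X hX a ha).2.2.1
    · exact fun X hX a ha => (g7 X hX a ha).2.2.2
  · rw [late 20 (by decide) (by decide) (by decide) (by decide) (by decide) (by decide),
      F3.arr 20 (by decide), F2.arr 20 (by decide), F1.arr 20 (by decide), h0 20 (by decide)]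

end RAM

/-! ### The running time -/

theorem prepare_time_le {n m e S L k N : ℕ} (hm : 1 ≤ m) (hS : 1 ≤ S) (hN : 4 * L ≤ stateCount L k)
    (hN' : stateCount L k ≤ N) (hN1 : 1 ≤ N) (hn : n ≤ m * S) (he : e ≤ m * (S * S)) :
    ((n + m + 2) * 21 + 2) + ((e + 1) * 60 + ((20 + (m + 1) * 50) +
      ((m + 2) * ((S + 1) * 40 + 20) +
      ((20 + ((4 * L + 1) * 30 + (2 + (S + 1) * ((stateCount L k + 1) * 20 + 20)))) +
      (((S + m + 2) * 21 + 2) + (N + 1) * ((S + 1) * ((N + 2) * 160 + 8) + 10)))))) ≤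
      5000 * (m * N ^ 3 * S ^ 2) := by
  -- All monomials of the bound are compared with this dominating one; it remains to add their
  -- coefficients.
  set X := m * N ^ 3 * S ^ 2 with hX
  have hmono : ∀ a b c : ℕ, a ≤ m → b ≤ N ^ 3 → c ≤ S ^ 2 → a * b * c ≤ X := fun a b c h1 h2 h3 =>
    Nat.mul_le_mul (Nat.mul_le_mul h1 h2) h3
  have n1 : 1 ≤ N ^ 3 := Nat.one_le_pow _ _ hN1
  have n2 : N ≤ N ^ 3 := Nat.le_self_pow (by decide) N
  have n3 : N * N ≤ N ^ 3 := by
    rw [← sq]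
    exact Nat.pow_le_pow_right hN1 (by decide)
  have s1 : 1 ≤ S ^ 2 := Nat.one_le_pow _ _ hS
  have s2 : S ≤ S ^ 2 := Nat.le_self_pow (by decide) S
  have x1 := hmono 1 1 1 hm n1 s1
  have xm := hmono m 1 1 le_rfl n1 s1
  have xS := hmono 1 1 S hm n1 s2
  have xN := hmono 1 N 1 hm n2 s1
  have xmS := hmono m 1 S le_rfl n1 s2
  have xmSS := hmono m 1 (S ^ 2) le_rfl n1 le_rfl
  have xNS := hmono 1 N S hm n2 s2
  have xNN := hmono 1 (N * N) 1 hm n3 s1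
  have xNNS := hmono 1 (N * N) S hm n3 s2
  have hcS : S * stateCount L k ≤ N * S := by nlinarith
  simp only [one_mul, mul_one] at x1 xm xS xN xmS xmSS xNS xNN xNNS
  have : e ≤ m * S ^ 2 := by rwa [sq]
  nlinarith

theorem merge_time_le {m S N : ℕ} (hm : 1 ≤ m) (hS : 1 ≤ S) (hN1 : 1 ≤ N) :
    (m + 1) * ((N + 1) * ((N + 1) * ((N + 1) * ((S + 1) * (S + 1) * 550 + 8) + 8) + 60) + 40) +
      (N + 1) * 40 ≤ 36000 * (m * N ^ 3 * S ^ 2) := by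
  have s1 : 1 ≤ S ^ 2 := Nat.one_le_pow _ _ hS
  have h1 : (S + 1) * (S + 1) * 550 + 8 ≤ 2208 * S ^ 2 := by nlinarith
  have a1 : 1 ≤ N * S ^ 2 := Nat.mul_pos hN1 s1
  have h2 : (N + 1) * ((S + 1) * (S + 1) * 550 + 8) + 8 ≤ 4424 * (N * S ^ 2) :=
    calc _ ≤ (2 * N) * (2208 * S ^ 2) + 8 := by gcongr; omega
      _ ≤ _ := by linarith
  have a2 : 1 ≤ N * (N * S ^ 2) := Nat.mul_pos hN1 a1
  have h3 : (N + 1) * ((N + 1) * ((S + 1) * (S + 1) * 550 + 8) + 8) + 60 ≤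
      8908 * (N * (N * S ^ 2)) :=
    calc _ ≤ (2 * N) * (4424 * (N * S ^ 2)) + 60 := by gcongr; omega
      _ ≤ _ := by linarith
  have a3 : N ≤ N * (N * (N * S ^ 2)) := Nat.le_mul_of_pos_right _ a2
  have h4 : (N + 1) * ((N + 1) * ((N + 1) * ((S + 1) * (S + 1) * 550 + 8) + 8) + 60) + 40 ≤
      17856 * (N * (N * (N * S ^ 2))) :=
    calc _ ≤ (2 * N) * (8908 * (N * (N * S ^ 2))) + 40 := by gcongr; omega
      _ ≤ _ := by linarith
  have a4 : N ≤ m * (N * (N * (N * S ^ 2))) := a3.trans (Nat.le_mul_of_pos_left _ hm)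
  calc _ ≤ (2 * m) * (17856 * (N * (N * (N * S ^ 2)))) + (N + 1) * 40 := by gcongr; omega
    _ ≤ 36000 * (m * (N * (N * (N * S ^ 2)))) := by linarith
    _ = _ := by ring

/-- Of the `3 w + 3` factors `L`, only `w` are kept. Each of the others is at most `w ≤ 2 ^ (w - 1)
≤ max k 2 ^ (w - 1)`, and the factors `4 (k + 1)` are at most `8 * max k 2`. The quadratic exponent
`18 w ^ 2` leaves room for all of this. -/
theorem stateCount_pow_le {L k w : ℕ} (hL : 0 < L) (hLw : L ≤ w) :
    (stateCount L k ^ (w + 1)) ^ 3 ≤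
      2 ^ 18 * (max L 1 ^ w * max k 2 ^ (2 * (3 * w) ^ 2)) := by
  set K := max k 2 with hK
  have hK2 : 2 ≤ K := le_max_right _ _
  have hLK : L ≤ K ^ (w - 1) :=
    calc L ≤ w := hLw
      _ ≤ 2 ^ (w - 1) := by
        have := Nat.lt_two_pow_self (n := w - 1)
        omega
      _ ≤ K ^ (w - 1) := Nat.pow_le_pow_left hK2 _
  have hk : (k + 1) * (2 * 2) ≤ 8 * K := by
    have : k ≤ K := le_max_left _ _
    omega
  have h8 : 8 ^ (3 * w + 3) ≤ 2 ^ 18 * K ^ (9 * (w - 1)) :=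
    calc 8 ^ (3 * w + 3) = 2 ^ (3 * (3 * w + 3)) := by rw [pow_mul]; norm_num
      _ = 2 ^ 18 * 2 ^ (9 * (w - 1)) := by
        rw [← pow_add]
        congr 1
        omega
      _ ≤ _ := Nat.mul_le_mul_left _ (Nat.pow_le_pow_left hK2 _)
  rw [max_eq_left hL, ← pow_mul, stateCount, mul_pow]
  calc L ^ ((w + 1) * 3) * ((k + 1) * (2 * 2)) ^ ((w + 1) * 3)
      ≤ (L ^ w * (K ^ (w - 1)) ^ (2 * w + 3)) * (8 * K) ^ (3 * w + 3) := by
        have e1 : (w + 1) * 3 = w + (2 * w + 3) := by ring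
        have e2 : (w + 1) * 3 = 3 * w + 3 := by ring
        refine Nat.mul_le_mul ?_ ?_
        · rw [e1, pow_add]
          exact Nat.mul_le_mul_left _ (Nat.pow_le_pow_left hLK _)
        · rw [e2]
          exact Nat.pow_le_pow_left hk _
    _ ≤ (L ^ w * (K ^ (w - 1)) ^ (2 * w + 3)) * (2 ^ 18 * K ^ (9 * (w - 1)) * K ^ (3 * w + 3)) := by
        rw [mul_pow 8]
        gcongr
    _ = 2 ^ 18 * (L ^ w * K ^ ((w - 1) * (2 * w + 3) + 9 * (w - 1) + (3 * w + 3))) := by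
        rw [pow_add, pow_add, ← pow_mul]
        ring
    -- With `w = v + 1` the exponents compare as `2 v ^ 2 + 17 v + 6 ≤ 18 (v + 1) ^ 2`.
    _ ≤ _ := by
        gcongr
        · omega
        · obtain ⟨v, rfl⟩ : ∃ v, w = v + 1 := ⟨w - 1, by omega⟩
          simp only [Nat.add_sub_cancel]
          nlinarith

theorem mainTheorem1 :
    ∃ (P : RAM.Program) (C : ℕ),
      ∀ (n m : ℕ) (G : SimpleGraph (Fin n)) (F : Set (Sym2 (Fin n)))
        (D : RootedTreeDecomposition G (Fin m)) (I : Listing G D) (k L w : ℕ),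
        F ⊆ G.edgeSet → D.IsNice → D.width = w →
        SolvesPathColoring P G F D I k L
          (C * (max L 1 ^ w * max k 2 ^ (2 * (3 * w) ^ 2) * max (3 * w) 1 ^ 2 * m)) := by
  -- Preparation and merging contribute `5000 + 36000`, the factor `2 ^ 18` comes from
  -- `stateCount_pow_le`, and `100` covers the scan of the bag sizes and the two tests.
  refine ⟨RAM.solve, 41000 * 2 ^ 18 + 100, fun n m G F D I k L w _ hD hw => ?_⟩
  set R := max L 1 ^ w * max k 2 ^ (2 * (3 * w) ^ 2) * max (3 * w) 1 ^ 2 * m with hR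
  have hm : 1 ≤ m := (Nat.zero_le _).trans_lt D.root.2
  have hR1 : 1 ≤ max L 1 ^ w * max k 2 ^ (2 * (3 * w) ^ 2) * max (3 * w) 1 ^ 2 :=
    Nat.mul_pos (Nat.mul_pos (pow_pos (by omega) _) (pow_pos (by omega) _)) (pow_pos (by omega) _)
  have hmR : m ≤ R := Nat.le_mul_of_pos_left _ hR1
  have hw' : Listing.maxBag D - 1 = w := hw
  suffices h : RAM.WP RAM.solve (I.initialStore F k L)
      ((m + 1) * 40 + (4 + (2 + 41000 * 2 ^ 18 * R))) (fun s =>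
        (PathColorable G F k L → s.var 0 = 1) ∧ (¬ PathColorable G F k L → s.var 0 = 0)) by
    obtain ⟨s, t, hs, ht, h⟩ := h
    exact ⟨s, t, hs, ht.trans (by omega), h⟩
  refine (RAM.sizes_spec (m := m) rfl rfl rfl).seq fun s hF hs => RAM.WP.branch (fun hb => ?_)
    fun hb => ?_
  · rw [RAM.Expr.eval_sub, RAM.Expr.eval_vr, RAM.Expr.eval_vr, hs.2, I.sup_arr_three,
      hF.var 3 (by decide)] at hb
    change Listing.maxBag D - L ≠ 0 at hb
    refine RAM.WP.branch (fun hb' => ?_) fun hb' => ?_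
    · rw [RAM.Expr.eval_vr, hF.var 3 (by decide)] at hb'
      have hL : 0 < L := Nat.pos_of_ne_zero hb'
      set S := Listing.maxBag D with hS
      set N := stateCount L k ^ S with hN
      have hc : 4 * L ≤ stateCount L k := by
        rw [stateCount]
        nlinarith [Nat.zero_le (L * k)]
      have hcN : stateCount L k ≤ N := Nat.le_self_pow (by omega) _
      have hN1 : 1 ≤ N := by omega
      have hsw : S = w + 1 := by omega
      have hT : 41000 * (m * N ^ 3 * S ^ 2) ≤ 41000 * 2 ^ 18 * R := by
        have h1 := stateCount_pow_le (k := k) hL (show L ≤ w by omega)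
        rw [← hsw, ← hN] at h1
        -- Here `w ≥ L ≥ 1`, so `S = w + 1 ≤ 3 * w`.
        have h2 : S ^ 2 ≤ max (3 * w) 1 ^ 2 := Nat.pow_le_pow_left (by omega) 2
        calc 41000 * (m * N ^ 3 * S ^ 2)
            ≤ 41000 * (m * (2 ^ 18 * (max L 1 ^ w * max k 2 ^ (2 * (3 * w) ^ 2))) *
              max (3 * w) 1 ^ 2) := by gcongr
          _ = 41000 * 2 ^ 18 * R := by rw [hR]; ring
      have hp := prepare_time_le (k := k) (S := S) hm (by omega) hc hcN hN1
        (Listing.card_vertices_le D) I.length_edges_le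
      have hM := merge_time_le (S := S) hm (by omega) hN1
      refine ((RAM.prepare_spec I hD F hL (fun x hx => hF.var x (by
        simp [RAM.sizes, RAM.forLoop, RAM.Program.modV]; omega)) (hs.2.trans
        (I.sup_arr_three F k L)) (fun a ha => hF.arr a (by
        simp [RAM.sizes, RAM.forLoop, RAM.Program.modA]; omega)) (fun t ht => ?_)
        (fun a ha i => ?_)).seq fun s1 hF1 h1 => ?_).mono ((Nat.add_le_add hp hM).trans
          (by omega)) fun _ _ h => h
      · rw [hs.1 t ht, hF.arr 3 (by decide)]
      · rw [hF.arr a (by simp [RAM.sizes, RAM.forLoop, RAM.Program.modA]; omega),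
          I.initialStore_arr_of_le F k L (by omega)]
      · obtain ⟨⟨q, par, h, hready⟩, h20⟩ := h1
        refine (RAM.mergeAll_spec hready hL h20).seq fun s2 hF2 h2 => ?_
        have hready2 := hready.congr (hF2.var 1 (by decide)) (hF2.var 9 (by decide))
          fun a ha => hF2.arr a (by
            simp [RAM.mergeAll, RAM.mergeTable, RAM.copyTable, RAM.mergeTest, RAM.checkParent,
              RAM.checkChild, RAM.checkNeighbors, RAM.forLoop, RAM.Program.modA]
            omega)
        refine (RAM.readAnswer_spec hready2).mono le_rfl fun s3 _ h3 => ?_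
        rwa [← h2, (I.toBagSequence F h).certified_iff_pathColorable rfl
          fun v => I.mem_below_toBagSequence h] at h3
    · rw [RAM.Expr.eval_vr, hF.var 3 (by decide)] at hb'
      have hL : L = 0 := hb'
      refine RAM.WP.straight rfl _ (show 2 ≤ _ by omega) ⟨fun ⟨c, _⟩ => ?_, fun _ => rfl⟩
      subst hL
      -- Some bag is nonempty, so there is a vertex, which no map into `Fin 0` can color.
      have hn : Listing.maxBag D ≤ n := Finset.sup_le fun i _ => by
        simpa using Finset.card_le_univ (D.bag i)
      exact (c ⟨0, by omega⟩).elim0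
  · rw [RAM.Expr.eval_sub, RAM.Expr.eval_vr, RAM.Expr.eval_vr, hs.2, I.sup_arr_three,
      hF.var 3 (by decide)] at hb
    change Listing.maxBag D - L = 0 at hb
    refine RAM.WP.straight rfl _ (show 2 ≤ _ by omega) ⟨fun _ => rfl, fun hc => absurd ?_ hc⟩
    -- The program answers yes without ordering the nodes; the order is needed only to prove that
    -- the greedy coloring exists.
    obtain ⟨q, par, h⟩ := I.exists_isOrder hD
    rw [← (I.toBagSequence F h).certified_iff_pathColorable rfl
      fun v => I.mem_below_toBagSequence h]
    exact BagSequence.certified_of_le (fun t _ => I.length_bagList_le q t) (by omega)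
      (fun v => edgeWeight_self v) k
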